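/- For $k\in\mathbb{C}$ let $L_k=-\partial_x^2+k^2e^{2x}$ on $\mathbb{R}$. Let $L_k^{\max}$ be the operator on $L^2(\mathbb{R})$ given by $L_k$ on the domain of all $f\in L^2(\mathbb{R})$ that are differentiable with locally absolutely continuous derivative and satisfy $L_kf\in L^2(\mathbb{R})$. Let $L_k^{\min}$ be the closure of the restriction of $L_k^{\max}$ to those $f$ in its domain that vanish near $-\infty$ and near $+\infty$. A closed realization of $L_k$ is a closed operator $A$ with $L_k^{\min}\subset A\subset L_k^{\max}$. Let $$I_m(r)=\Big(\frac r2\Big)^m\sum_{n=0}^\infty\frac{(r^2/4)^n}{n!\,\Gamma(m+1+n)},\qquad K_m(r)=\frac{\pi}{2\sin(\pi m)}\big(I_{-m}(r)-I_m(r)\big)$$ (for integer $m$, $K_m$ is defined by the limit in $m$) be the modified Bessel and Macdonald functions. (1) If $\Re(k)>0$ or $k=0$, then $L_k$ has exactly one closed realization $M_k$, namely $M_k=L_k^{\max}$. Its spectrum is $\sigma(M_k)=[0,\infty[$ and it has no eigenvalues: $\sigma_{\mathrm p}(M_k)=\emptyset$. (2) $\{\Re(k)>0\}\ni k\mapsto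 M_k$ is a holomorphic family of closed operators (in the sense of Kato: near each point of the half-plane there are a Banach space $\mathcal K$ and a holomorphic family of bounded injective operators $S_k:\mathcal K\to L^2(\mathbb{R})$ with range $\mathcal D(M_k)$ such that $M_kS_k$ is a holomorphic family of bounded operators). (3) Let $\Re(m)>0$. For $\Re(k)>0$ the bounded resolvent $R_k(-m^2)=(M_k+m^2)^{-1}$ exists and has the integral kernel $$(M_k+m^2)^{-1}(x,y)=I_m\big(ke^{\min(x,y)}\big)\,K_m\big(ke^{\max(x,y)}\big),$$ that is, $(f|R_k(-m^2)g)=\int\overline{f(x)}\,I_m(ke^{\min(x,y)})K_m(ke^{\max(x,y)})\,g(y)\,dx\,dy$, with an absolutely convergent integral, for all $f,g\in L^2(\mathbb{R})$. The map $k\mapsto R_k(-m^2)$, with values in the bounded operators on $L^2(\mathbb{R})$, is holomorphic on $\{\Re(k)>0\}$, and it has no holomorphic extension to a connected open subset of $\mathbb{C}$ that strictly contains $\{\Re(k)>0\}$. -/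

import Mathlib

open Set Filter Topology MeasureTheory
open scoped ComplexConjugate

/-! ## Closed operators on a Banach or Hilbert space -/

section Operators

variable {H : Type} [NormedAddCommGroup H] [NormedSpace ℂ H]

/-- `R` is the (bounded, everywhere defined) inverse `(A - z)⁻¹` of `A - z : D(A) → H`. -/
def IsResolventAt (A : H →ₗ.[ℂ] H) (z : ℂ) (R : H →L[ℂ] H) : Prop :=
  (∀ f : A.domain, R (A f - z • (f : H)) = f) ∧
  (∀ g : H, ∃ f : A.domain, (f : H) = R g ∧ A f - z • (f : H) = g)

/-- The spectrum of an unbounded operator: the complement of the set of all `z` such that `A - z`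
has a bounded everywhere defined inverse. -/
def unboundedSpectrum (A : H →ₗ.[ℂ] H) : Set ℂ :=
  {z | ¬ ∃ R : H →L[ℂ] H, IsResolventAt A z R}

/-- The point spectrum (set of eigenvalues) of an unbounded operator. -/
def unboundedPointSpectrum (A : H →ₗ.[ℂ] H) : Set ℂ :=
  {z | ∃ f : A.domain, (f : H) ≠ 0 ∧ A f = z • (f : H)}

/-- Holomorphic families of closed operators (Kato): each `T z` with `z ∈ Ω` is closed, and
near each `z₀ ∈ Ω` there are a Banach space `K` and a holomorphic family of bounded injective
operators `S z : K → H` with range `D(T z)` such that `T z ∘ S z` is a holomorphic family of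
bounded operators. -/
def IsHolomorphicFamily (Ω : Set ℂ) (T : ℂ → H →ₗ.[ℂ] H) : Prop :=
  (∀ z ∈ Ω, (T z).IsClosed) ∧
  ∀ z₀ ∈ Ω, ∃ U : Set ℂ, IsOpen U ∧ z₀ ∈ U ∧ U ⊆ Ω ∧
    ∃ (K : Type) (_ : NormedAddCommGroup K) (_ : NormedSpace ℂ K) (_ : CompleteSpace K)
      (S W : ℂ → K →L[ℂ] H),
      DifferentiableOn ℂ S U ∧ DifferentiableOn ℂ W U ∧
      ∀ z ∈ U, Function.Injective (S z) ∧ Set.range (S z) = ((T z).domain : Set H) ∧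
        ∀ (u : K) (f : (T z).domain), (f : H) = S z u → T z f = W z u

end Operators

/-! ## Schrödinger operators on `L²(ℝ)` -/

/-- The Hilbert space `L²(ℝ)`. -/
abbrev L2R : Type := Lp ℂ 2 (volume : Measure ℝ)

/-- `AC¹(ℝ)`: differentiable functions with (locally) absolutely continuous derivative. -/
def IsAC1 (φ : ℝ → ℂ) : Prop :=
  Differentiable ℝ φ ∧ ∀ a b : ℝ, AbsolutelyContinuousOnInterval (deriv φ) a b

/-- The formal expression `-∂² + V`. -/
noncomputable def schrodingerExpr (V : ℝ → ℂ) (φ : ℝ → ℂ) (x : ℝ) : ℂ :=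
  -deriv (deriv φ) x + V x * φ x

theorem IsAC1.ae_differentiableAt_deriv {φ : ℝ → ℂ} (h : IsAC1 φ) :
    ∀ᵐ x : ℝ, DifferentiableAt ℝ (deriv φ) x := by
  have h1 : ∀ n : ℕ, ∀ᵐ x : ℝ, x ∈ uIcc (-(n : ℝ)) n → DifferentiableAt ℝ (deriv φ) x :=
    fun n => (h.2 (-(n : ℝ)) n).boundedVariationOn.ae_differentiableAt_of_mem_uIcc
  filter_upwards [ae_all_iff.2 h1] with x hx
  obtain ⟨n, hn⟩ := exists_nat_ge |x|
  refine hx n ?_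
  rw [uIcc_of_le (by linarith [abs_nonneg x])]
  exact abs_le.1 hn

theorem IsAC1.add {φ ψ : ℝ → ℂ} (hφ : IsAC1 φ) (hψ : IsAC1 ψ) : IsAC1 (φ + ψ) := by
  refine ⟨hφ.1.add hψ.1, fun a b => ?_⟩
  have : deriv (φ + ψ) = deriv φ + deriv ψ := by
    funext x
    exact deriv_add (hφ.1 x) (hψ.1 x)
  rw [this]
  exact (hφ.2 a b).add (hψ.2 a b)

theorem deriv_const_smul_fun (c : ℂ) (φ : ℝ → ℂ) :
    deriv (fun x => c • φ x) = fun x => c • deriv φ x := by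
  funext x
  simp only [smul_eq_mul]
  exact deriv_const_mul_field c

theorem IsAC1.smul {φ : ℝ → ℂ} (c : ℂ) (hφ : IsAC1 φ) : IsAC1 (fun x => c • φ x) := by
  refine ⟨hφ.1.const_smul c, fun a b => ?_⟩
  rw [deriv_const_smul_fun]
  exact (hφ.2 a b).const_smul c

/-- The graph of the maximal operator: pairs `(f, L f)` with
`f ∈ L² ∩ AC¹` and `L f = -f'' + V f ∈ L²`. -/
noncomputable def maxGraph (V : ℝ → ℂ) : Submodule ℂ (L2R × L2R) where
  carrier := {p | ∃ φ : ℝ → ℂ, IsAC1 φ ∧ (p.1 : ℝ → ℂ) =ᵐ[volume] φ ∧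
    (p.2 : ℝ → ℂ) =ᵐ[volume] schrodingerExpr V φ}
  zero_mem' := by
    refine ⟨fun x => (0 : ℂ) • (0 : ℂ), ?_, ?_, ?_⟩
    · refine IsAC1.smul (φ := fun _ => 0) 0 ⟨differentiable_const _, fun a b => ?_⟩
      have : deriv (fun _ : ℝ => (0 : ℂ)) = fun _ => 0 := by funext x; simp
      rw [this]
      simpa using! ((LipschitzWith.const (0 : ℂ)).lipschitzOnWith
        (s := uIcc a b)).absolutelyContinuousOnInterval
    · filter_upwards [Lp.coeFn_zero ℂ 2 (volume : Measure ℝ)] with x hx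
      simp
    · filter_upwards [Lp.coeFn_zero ℂ 2 (volume : Measure ℝ)] with x hx
      simpa [schrodingerExpr] using hx
  add_mem' := by
    rintro p q ⟨φ, hφ, hp1, hp2⟩ ⟨ψ, hψ, hq1, hq2⟩
    refine ⟨φ + ψ, hφ.add hψ, ?_, ?_⟩
    · exact (Lp.coeFn_add p.1 q.1).trans (hp1.add hq1)
    · have hd : deriv (φ + ψ) = deriv φ + deriv ψ := by
        funext x
        exact deriv_add (hφ.1 x) (hψ.1 x)
      filter_upwards [Lp.coeFn_add p.2 q.2, hp2, hq2, hφ.ae_differentiableAt_deriv,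
        hψ.ae_differentiableAt_deriv] with x h1 h2 h3 h4 h5
      change (p.2 + q.2 : L2R) x = _
      rw [h1, Pi.add_apply, h2, h3, schrodingerExpr, schrodingerExpr, schrodingerExpr, hd,
        deriv_add h4 h5, Pi.add_apply]
      ring
  smul_mem' := by
    rintro c p ⟨φ, hφ, hp1, hp2⟩
    refine ⟨fun x => c • φ x, hφ.smul c, ?_, ?_⟩
    · filter_upwards [Lp.coeFn_smul c p.1, hp1] with x h1 h2
      change (c • p.1 : L2R) x = _
      rw [h1, Pi.smul_apply, h2]
    · filter_upwards [Lp.coeFn_smul c p.2, hp2] with x h1 h2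
      change (c • p.2 : L2R) x = _
      rw [h1, Pi.smul_apply, h2, schrodingerExpr, schrodingerExpr, deriv_const_smul_fun,
        deriv_const_smul_fun]
      simp only [smul_eq_mul]
      ring

/-- The maximal realization `L^max` of `-∂² + V`. -/
noncomputable def maxOp (V : ℝ → ℂ) : L2R →ₗ.[ℂ] L2R := (maxGraph V).toLinearPMap

/-- The expression `L f` does not depend on representatives, so `maxGraph V` is indeed the graph
of `maxOp V`. -/
theorem maxOp_graph (V : ℝ → ℂ) : (maxOp V).graph = maxGraph V := by
  refine Submodule.toLinearPMap_graph_eq _ ?_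
  rintro ⟨f, g⟩ ⟨φ, hφ, h1, h2⟩ h0
  simp only at h0 h1 h2 ⊢
  subst h0
  have hz : φ = fun _ => 0 := by
    have h3 : φ =ᵐ[volume] fun _ => (0 : ℂ) := h1.symm.trans (Lp.coeFn_zero ℂ 2 volume)
    exact (Continuous.ae_eq_iff_eq volume hφ.1.continuous continuous_const).1 h3
  rw [Lp.eq_zero_iff_ae_eq_zero]
  filter_upwards [h2] with x hx
  rw [hx, hz]
  simp [schrodingerExpr]

/-- The subspace of elements of `L²(ℝ)` vanishing near `-∞` and near `+∞`. -/
def vanishingNearInfinity : Submodule ℂ L2R where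
  carrier := {f | ∃ r : ℝ, ∀ᵐ x : ℝ, r < |x| → (f : ℝ → ℂ) x = 0}
  zero_mem' := ⟨0, by
    filter_upwards [Lp.coeFn_zero ℂ 2 (volume : Measure ℝ)] with x hx _
    exact hx⟩
  add_mem' := by
    rintro f g ⟨r, hr⟩ ⟨s, hs⟩
    refine ⟨max r s, ?_⟩
    filter_upwards [Lp.coeFn_add f g, hr, hs] with x h1 h2 h3 hx
    rw [h1, Pi.add_apply, h2 (lt_of_le_of_lt (le_max_left _ _) hx),
      h3 (lt_of_le_of_lt (le_max_right _ _) hx), add_zero]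
  smul_mem' := by
    rintro c f ⟨r, hr⟩
    refine ⟨r, ?_⟩
    filter_upwards [Lp.coeFn_smul c f, hr] with x h1 h2 hx
    rw [h1, Pi.smul_apply, h2 hx, smul_zero]

/-- The minimal realization `L^min` of `-∂² + V`: the closure of the restriction of `L^max` to the
functions in its domain that vanish near `-∞` and near `+∞`. -/
noncomputable def minOp (V : ℝ → ℂ) : L2R →ₗ.[ℂ] L2R :=
  ((maxOp V).domRestrict vanishingNearInfinity).closure

/-- Closed realizations of `-∂² + V`: closed operators between `L^min` and `L^max`. -/
def IsClosedRealization (V : ℝ → ℂ) (A : L2R →ₗ.[ℂ] L2R) : Prop :=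
  A.IsClosed ∧ minOp V ≤ A ∧ A ≤ maxOp V

/-- The bounded operator `R` has the integral kernel `N`:
`(f | R g) = ∫ conj (f x) N(x, y) g(y) dx dy`, with an absolutely convergent integral, for all
`f, g ∈ L²(ℝ)`. -/
def HasIntegralKernel (R : L2R →L[ℂ] L2R) (N : ℝ → ℝ → ℂ) : Prop :=
  ∀ f g : L2R,
    Integrable (fun p : ℝ × ℝ => conj (f p.1) * N p.1 p.2 * g p.2) (volume.prod volume) ∧
    inner ℂ f (R g) = ∫ p : ℝ × ℝ, conj (f p.1) * N p.1 p.2 * g p.2 ∂(volume.prod volume)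

/-- The exponential potential `k² e^{2x}`. -/
noncomputable def expPotential (k : ℂ) (x : ℝ) : ℂ := k ^ 2 * (Real.exp (2 * x) : ℂ)

/-! ## Modified Bessel functions -/

/-- The modified Bessel function
`I_m(r) = (r/2)^m ∑ₙ (r²/4)ⁿ / (n! Γ(m+1+n))`, where `1/Γ` vanishes at the poles of `Γ`
(principal branch of the power). -/
noncomputable def besselI (m r : ℂ) : ℂ :=
  (r / 2) ^ m * ∑' n : ℕ, (r ^ 2 / 4) ^ n / ((n.factorial : ℂ) * Complex.Gamma (m + 1 + n))

/-- The quotient `π (I_{-m}(r) - I_m(r)) / (2 sin (π m))`, for non-integer `m`. -/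
noncomputable def besselKAux (m r : ℂ) : ℂ :=
  Real.pi / (2 * Complex.sin (Real.pi * m)) * (besselI (-m) r - besselI m r)

open Classical in
/-- The Macdonald function `K_m(r) = π (I_{-m}(r) - I_m(r)) / (2 sin (π m))`, extended to
integer `m` by taking the limit in `m`. -/
noncomputable def besselK (m r : ℂ) : ℂ :=
  if ∃ n : ℤ, m = n then limUnder (𝓝[≠] m) (fun ν => besselKAux ν r) else besselKAux m r

/-- The kernel `I_m(k e^{min(x,y)}) K_m(k e^{max(x,y)})`. -/
noncomputable def expKernel (m k : ℂ) (x y : ℝ) : ℂ :=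
  besselI m (k * Real.exp (min x y)) * besselK m (k * Real.exp (max x y))

/-! The potential is complex, but `conj k * k² = |k|² k`, so some `c` with `Re c > 0` makes `Re (c
V) ≥ 0` (`exists_accretive`). Testing `-φ'' + V φ` against `c w conj φ` with a compactly supported
weight `w` then shows that every `φ` in the maximal domain has `φ' ∈ L²` (`IsAC1.deriv_memLp`), and,
for `Re k > 0` and a weight containing `e^{2x}`, that `e^{2x} φ ∈ L²` (`IsAC1.exp_mul_memLp`).
Because `φ' ∈ L²`, cutting off at infinity converges in the graph norm, so `L^min = L^max` once the
latter is closed. For the same reason the boundary terms in Green's identity vanish: `L^max` is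
symmetric for the bilinear pairing `∫ f g` (`maxGraph_symm`), and hence a bounded right inverse of
`L^max - z` is automatically the resolvent.

Right inverses come from variation of constants (`IsGreenPair`), with one solution that decays at
`-∞` and one at `+∞`. For `z = -m²` these are `I_m(k e^x)` and `K_m(k e^x)`, or exponentials if `k =
0`. The function `K_m` is handled through `½ ∫ e^{-z cosh t - m t} dt`; the bridge between the two
is the identity `z (I_m K_{m+1} + I_{m+1} K_m) = 1` (`besselCross_eq_one`). Every `z` outside `[0,
∞[` has the form `-m²` with `Re m > 0`. On `[0, ∞[` plane waves cut off far to the left, where the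
potential is small, are quasimodes. Positive eigenvalues are excluded by a Gronwall argument from
`-∞`, the eigenvalue zero by the energy estimate.

Since `e^{2x}` is bounded on the graph of `M_1`, all domains with `Re k > 0` coincide and `M_k = M_1
+ (k² - 1) e^{2x}` is polynomial in `k` on one fixed Banach space; holomorphy of the family and of
the resolvent follows.

For the natural boundary, translations implement `k ↦ e^τ k`, and the expression depends only on
`k²`. A holomorphic extension to a larger connected domain must agree with the even extension
`R(-k)` on the left half-plane, and it crosses the imaginary axis at some `b ≠ 0`. Real rescaling
carries this crossing to every nonzero imaginary point, so the resolvent extends to `ℂ \ {0}`, with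
norm bounded by its maximum on the unit circle. Composed with `exp` it is a bounded entire function,
hence constant by Liouville, which `resolvent_one_ne_two` forbids. -/

/-! ## Locally absolutely continuous functions -/

/-- `F` is locally absolutely continuous with almost everywhere derivative `f`. -/
def IsPrimitive (F f : ℝ → ℂ) : Prop :=
  (∀ a b : ℝ, AbsolutelyContinuousOnInterval F a b) ∧ ∀ᵐ x, HasDerivAt F (f x) x

/-- Gives access to real and imaginary parts, to which the fundamental theorem of calculus for
absolutely continuous real functions is applied, and to complex conjugates. -/
theorem AbsolutelyContinuousOnInterval.comp_lipschitz {X Y : Type*} [PseudoMetricSpace X]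
    [PseudoMetricSpace Y] {F : ℝ → X} {a b : ℝ} (hF : AbsolutelyContinuousOnInterval F a b)
    {g : X → Y} (hg : LipschitzWith 1 g) :
    AbsolutelyContinuousOnInterval (fun x => g (F x)) a b := by
  refine squeeze_zero (fun t => Finset.sum_nonneg fun i _ => dist_nonneg) (fun t => ?_) hF
  refine Finset.sum_le_sum fun i _ => ?_
  simpa using hg.dist_le_mul (F (t.2 i).1) (F (t.2 i).2)

theorem Complex.lipschitzWith_re : LipschitzWith 1 Complex.re :=
  LipschitzWith.mk_one fun x y => by
    rw [Real.dist_eq, Complex.dist_eq, ← Complex.sub_re]; exact Complex.abs_re_le_norm _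

theorem Complex.lipschitzWith_im : LipschitzWith 1 Complex.im :=
  LipschitzWith.mk_one fun x y => by
    rw [Real.dist_eq, Complex.dist_eq, ← Complex.sub_im]; exact Complex.abs_im_le_norm _

theorem AbsolutelyContinuousOnInterval.of_re_im {F : ℝ → ℂ} {a b : ℝ}
    (h1 : AbsolutelyContinuousOnInterval (fun x => (F x).re) a b)
    (h2 : AbsolutelyContinuousOnInterval (fun x => (F x).im) a b) :
    AbsolutelyContinuousOnInterval F a b := by
  refine squeeze_zero (fun t => Finset.sum_nonneg fun i _ => dist_nonneg) (fun t => ?_)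
    (by simpa using Tendsto.add h1 h2)
  rw [← Finset.sum_add_distrib]
  refine Finset.sum_le_sum fun i _ => ?_
  rw [Complex.dist_eq, Real.dist_eq, Real.dist_eq, ← Complex.sub_re, ← Complex.sub_im]
  exact Complex.norm_le_abs_re_add_abs_im _

theorem HasDerivAt.complex_re {F : ℝ → ℂ} {z : ℂ} {x : ℝ} (h : HasDerivAt F z x) :
    HasDerivAt (fun x => (F x).re) z.re x := by
  exact Complex.reCLM.hasFDerivAt.comp_hasDerivAt x h

theorem HasDerivAt.complex_im {F : ℝ → ℂ} {z : ℂ} {x : ℝ} (h : HasDerivAt F z x) :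
    HasDerivAt (fun x => (F x).im) z.im x := by
  exact Complex.imCLM.hasFDerivAt.comp_hasDerivAt x h

theorem HasDerivAt.complex_conj {F : ℝ → ℂ} {z : ℂ} {x : ℝ} (h : HasDerivAt F z x) :
    HasDerivAt (fun x => conj (F x)) (conj z) x := by
  exact Complex.conjCLE.toContinuousLinearMap.hasFDerivAt.comp_hasDerivAt x h

theorem intervalIntegrable_complex_iff {f : ℝ → ℂ} {a b : ℝ} :
    IntervalIntegrable f volume a b ↔ IntervalIntegrable (fun x => (f x).re) volume a b ∧
      IntervalIntegrable (fun x => (f x).im) volume a b := by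
  simp only [intervalIntegrable_iff]
  exact (MeasureTheory.Integrable.re_im_iff (𝕜 := ℂ) (f := f)).symm

theorem intervalIntegral_re {f : ℝ → ℂ} {a b : ℝ} (h : IntervalIntegrable f volume a b) :
    (∫ x in a..b, f x).re = ∫ x in a..b, (f x).re := by
  simpa using (Complex.reCLM.intervalIntegral_comp_comm h).symm

theorem intervalIntegral_im {f : ℝ → ℂ} {a b : ℝ} (h : IntervalIntegrable f volume a b) :
    (∫ x in a..b, f x).im = ∫ x in a..b, (f x).im := by
  simpa using (Complex.imCLM.intervalIntegral_comp_comm h).symm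

namespace IsPrimitive

variable {F G f g : ℝ → ℂ}

theorem continuous (h : IsPrimitive F f) : Continuous F := by
  refine continuous_iff_continuousAt.2 fun x => ?_
  refine (h.1 (x - 1) (x + 1)).continuousOn.continuousAt ?_
  rw [uIcc_of_le (by linarith)]
  exact Icc_mem_nhds (by linarith) (by linarith)

theorem intervalIntegrable (h : IsPrimitive F f) (a b : ℝ) :
    IntervalIntegrable f volume a b := by
  have h1 := ((h.1 a b).comp_lipschitz Complex.lipschitzWith_re).intervalIntegrable_deriv
  have h2 := ((h.1 a b).comp_lipschitz Complex.lipschitzWith_im).intervalIntegrable_deriv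
  refine intervalIntegrable_complex_iff.2 ⟨h1.congr_ae ?_, h2.congr_ae ?_⟩ <;>
  · refine ae_restrict_of_ae ?_
    filter_upwards [h.2] with x hx
    first | exact hx.complex_re.deriv | exact hx.complex_im.deriv

theorem integral_eq_sub (h : IsPrimitive F f) (a b : ℝ) : ∫ x in a..b, f x = F b - F a := by
  have hi := h.intervalIntegrable a b
  have h1 := ((h.1 a b).comp_lipschitz Complex.lipschitzWith_re).integral_deriv_eq_sub
  have h2 := ((h.1 a b).comp_lipschitz Complex.lipschitzWith_im).integral_deriv_eq_sub
  apply Complex.ext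
  · rw [intervalIntegral_re hi, Complex.sub_re, ← h1]
    refine intervalIntegral.integral_congr_ae ?_
    filter_upwards [h.2] with x hx _ using hx.complex_re.deriv.symm
  · rw [intervalIntegral_im hi, Complex.sub_im, ← h2]
    refine intervalIntegral.integral_congr_ae ?_
    filter_upwards [h.2] with x hx _ using hx.complex_im.deriv.symm

theorem of_integral (hf : LocallyIntegrable f)
    (h : ∀ x, F x = F 0 + ∫ t in (0 : ℝ)..x, f t) : IsPrimitive F f := by
  have hi : ∀ a b : ℝ, IntervalIntegrable f volume a b := fun a b =>
    intervalIntegrable_iff.mpr <|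
      (hf.integrableOn_isCompact isCompact_uIcc).mono_set uIoc_subset_uIcc
  have key : ∀ {p : ℝ → ℝ} (a b : ℝ), (∀ a b : ℝ, IntervalIntegrable p volume a b) →
      AbsolutelyContinuousOnInterval (fun x => ∫ t in (0 : ℝ)..x, p t) a b := by
    intro p a b hp
    -- The interval is enlarged so that it contains the base point `0` of the primitive.
    have hle : min (min a b) 0 ≤ max (max a b) 0 := (min_le_right _ _).trans (le_max_right _ _)
    refine ((hp (min (min a b) 0)
      (max (max a b) 0)).absolutelyContinuousOnInterval_intervalIntegral (c := 0) ?_).mono ?_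
    · rw [uIcc_of_le hle]
      exact ⟨min_le_right _ _, le_max_right _ _⟩
    · rw [uIcc_of_le hle]
      exact Icc_subset_Icc (min_le_left _ _) (le_max_left _ _)
  refine ⟨fun a b => ?_, ?_⟩
  · have h0 : F = (fun x => F 0) + fun x => ∫ t in (0 : ℝ)..x, f t := funext h
    rw [h0]
    refine AbsolutelyContinuousOnInterval.add
      (LipschitzWith.const (F 0)).lipschitzOnWith.absolutelyContinuousOnInterval
      (AbsolutelyContinuousOnInterval.of_re_im ?_ ?_)
    · simp_rw [intervalIntegral_re (hi _ _)]
      exact key a b fun a b => (intervalIntegrable_complex_iff.1 (hi a b)).1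
    · simp_rw [intervalIntegral_im (hi _ _)]
      exact key a b fun a b => (intervalIntegrable_complex_iff.1 (hi a b)).2
  · filter_upwards [LocallyIntegrable.ae_hasDerivAt_integral hf] with x hx
    have h0 : F = fun x => F 0 + ∫ t in (0 : ℝ)..x, f t := funext h
    rw [h0]
    exact (hx 0).const_add _

theorem of_hasDerivAt (hf : Continuous f) (h : ∀ x, HasDerivAt F (f x) x) : IsPrimitive F f := by
  refine ⟨fun a b => ?_, ae_of_all _ h⟩
  refine ContDiffOn.absolutelyContinuousOnInterval (ContDiff.contDiffOn ?_)
  refine contDiff_one_iff_deriv.2 ⟨fun x => (h x).differentiableAt, ?_⟩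
  rwa [show deriv F = f from funext fun x => (h x).deriv]

theorem mul (hF : IsPrimitive F f) (hG : IsPrimitive G g) :
    IsPrimitive (fun x => F x * G x) (fun x => f x * G x + F x * g x) := by
  refine ⟨fun a b => (hF.1 a b).smul (hG.1 a b), ?_⟩
  filter_upwards [hF.2, hG.2] with x h1 h2 using h1.mul h2

theorem add (hF : IsPrimitive F f) (hG : IsPrimitive G g) :
    IsPrimitive (fun x => F x + G x) (fun x => f x + g x) := by
  refine ⟨fun a b => (hF.1 a b).add (hG.1 a b), ?_⟩
  filter_upwards [hF.2, hG.2] with x h1 h2 using h1.add h2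

theorem sub (hF : IsPrimitive F f) (hG : IsPrimitive G g) :
    IsPrimitive (fun x => F x - G x) (fun x => f x - g x) := by
  refine ⟨fun a b => (hF.1 a b).sub (hG.1 a b), ?_⟩
  filter_upwards [hF.2, hG.2] with x h1 h2 using h1.sub h2

theorem star (hF : IsPrimitive F f) :
    IsPrimitive (fun x => conj (F x)) (fun x => conj (f x)) := by
  refine ⟨fun a b => (hF.1 a b).comp_lipschitz ?_, ?_⟩
  · exact Complex.isometry_conj.lipschitz
  · filter_upwards [hF.2] with x hx using hx.complex_conj

theorem congr_ae (hF : IsPrimitive F f) (h : f =ᵐ[volume] g) : IsPrimitive F g := by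
  refine ⟨hF.1, ?_⟩
  filter_upwards [hF.2, h] with x hx h2
  rwa [← h2]

/-- Because `F` is the integral of `f`, continuity of `f` removes the exceptional null set. This
turns solutions in the absolutely continuous sense into classical ones. -/
theorem hasDerivAt_of_continuous (hF : IsPrimitive F f) (hf : Continuous f) (x : ℝ) :
    HasDerivAt F (f x) x := by
  have h : F = fun x => F 0 + ∫ t in (0 : ℝ)..x, f t := by
    funext x
    rw [hF.integral_eq_sub]
    ring
  rw [h]
  exact (intervalIntegral.integral_hasDerivAt_right (hf.intervalIntegrable _ _)
    hf.stronglyMeasurable.stronglyMeasurableAtFilter hf.continuousAt).const_add _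

/-- The derivative of a compactly supported locally absolutely continuous function is integrable
with integral zero. -/
theorem integral_eq_zero (hF : IsPrimitive F f) {r : ℝ} (hr : ∀ x, r < |x| → F x = 0) :
    Integrable f ∧ ∫ x, f x = 0 := by
  have hr' : ∀ x, |r| < |x| → F x = 0 := fun x hx => hr x (lt_of_le_of_lt (le_abs_self r) hx)
  set s : ℝ := |r| + 1 with hs
  have hs0 : 0 < s := by positivity
  have hz : ∀ᵐ x, x ∉ Ioc (-s) s → f x = 0 := by
    filter_upwards [hF.2] with x hx hxs
    have hx1 : |r| < |x| := by
      by_contra hcon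
      push Not at hcon
      exact hxs ⟨by linarith [(abs_le.1 hcon).1], by linarith [(abs_le.1 hcon).2]⟩
    have h0 : F =ᶠ[𝓝 x] fun _ => 0 := by
      filter_upwards [(continuous_abs.isOpen_preimage _ isOpen_Ioi).mem_nhds
        (show x ∈ (fun y : ℝ => |y|) ⁻¹' Ioi |r| from hx1)] with y hy using hr' y hy
    exact hx.unique ((hasDerivAt_const x (0 : ℂ)).congr_of_eventuallyEq h0)
  have heq : (Ioc (-s) s).indicator f =ᵐ[volume] f := by
    filter_upwards [hz] with x hx
    by_cases hxs : x ∈ Ioc (-s) s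
    · rw [indicator_of_mem hxs]
    · rw [indicator_of_notMem hxs, hx hxs]
  have hI := hF.intervalIntegrable (-s) s
  rw [intervalIntegrable_iff_integrableOn_Ioc_of_le (by linarith)] at hI
  refine ⟨(hI.integrable_indicator measurableSet_Ioc).congr heq, ?_⟩
  rw [← integral_congr_ae heq, integral_indicator measurableSet_Ioc,
    ← intervalIntegral.integral_of_le (by linarith), hF.integral_eq_sub, hr', hr', sub_zero]
  · rw [abs_neg, abs_of_pos hs0]; linarith
  · rw [abs_of_pos hs0]; linarith

end IsPrimitive

theorem IsAC1.isPrimitive_deriv {φ : ℝ → ℂ} (h : IsAC1 φ) :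
    IsPrimitive (deriv φ) (deriv (deriv φ)) := by
  refine ⟨h.2, ?_⟩
  filter_upwards [h.ae_differentiableAt_deriv] with x hx using hx.hasDerivAt

theorem IsAC1.continuous_deriv {φ : ℝ → ℂ} (h : IsAC1 φ) : Continuous (deriv φ) :=
  h.isPrimitive_deriv.continuous

theorem IsAC1.isPrimitive {φ : ℝ → ℂ} (h : IsAC1 φ) : IsPrimitive φ (deriv φ) :=
  IsPrimitive.of_hasDerivAt h.continuous_deriv fun x => (h.1 x).hasDerivAt

theorem IsAC1.of_isPrimitive {φ ψ η : ℝ → ℂ} (h1 : ∀ x, HasDerivAt φ (ψ x) x)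
    (h2 : IsPrimitive ψ η) : IsAC1 φ ∧ deriv φ = ψ ∧ deriv (deriv φ) =ᵐ[volume] η := by
  have h : deriv φ = ψ := funext fun x => (h1 x).deriv
  refine ⟨⟨fun x => (h1 x).differentiableAt, fun a b => by rw [h]; exact h2.1 a b⟩, h, ?_⟩
  rw [h]
  filter_upwards [h2.2] with x hx using hx.deriv

/-! ## Cutoff functions and energy estimates -/

theorem exists_bound_of_compact_support {f : ℝ → ℝ} (hf : Continuous f) {r : ℝ}
    (hr : ∀ x, r < |x| → f x = 0) : ∃ M, 0 < M ∧ ∀ x, |f x| ≤ M := by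
  obtain ⟨M, hM⟩ := (isCompact_Icc (a := -r) (b := r)).exists_bound_of_continuousOn hf.continuousOn
  refine ⟨max M 1, by positivity, fun x => ?_⟩
  by_cases hx : r < |x|
  · simp [hr x hx]
  · exact (hM x (abs_le.1 (not_lt.1 hx))).trans (le_max_left _ _)

theorem integrable_of_continuous_of_support {E : Type*} [NormedAddCommGroup E] {f : ℝ → E}
    (hf : Continuous f) {r : ℝ} (hr : ∀ x, r < |x| → f x = 0) : Integrable f := by
  refine hf.integrable_of_hasCompactSupport
    (HasCompactSupport.intro (isCompact_Icc (a := -r) (b := r)) fun x hx => hr x ?_)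
  by_contra hcon
  exact hx (abs_le.1 (not_lt.1 hcon))

/-- A twice continuously differentiable cutoff function together with its derivatives. -/
structure IsCutoff (δ r : ℝ) (χ χ' χ'' : ℝ → ℝ) : Prop where
  hasDerivAt : ∀ x, HasDerivAt χ (χ' x) x
  hasDerivAt' : ∀ x, HasDerivAt χ' (χ'' x) x
  continuous'' : Continuous χ''
  nonneg : ∀ x, 0 ≤ χ x
  le_one : ∀ x, χ x ≤ 1
  abs_deriv_le : ∀ x, |χ' x| ≤ δ
  abs_deriv2_le : ∀ x, |χ'' x| ≤ δ
  eq_one : ∀ x, |x| ≤ 1 / δ → χ x = 1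
  eq_zero : ∀ x, r < |x| → χ x = 0
  deriv_eq_zero : ∀ x, r < |x| → χ' x = 0
  deriv2_eq_zero : ∀ x, r < |x| → χ'' x = 0

theorem hasDerivAt_eq_zero_of_outside {f : ℝ → ℝ} {r : ℝ} (hr : ∀ x, r < |x| → f x = 0)
    {x y : ℝ} (hx : r < |x|) (h : HasDerivAt f y x) : y = 0 := by
  have h0 : f =ᶠ[𝓝 x] fun _ => 0 := by
    filter_upwards [(continuous_abs.isOpen_preimage _ isOpen_Ioi).mem_nhds
      (show x ∈ (fun y : ℝ => |y|) ⁻¹' Ioi r from hx)] with y hy using hr y hy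
  exact h.unique ((hasDerivAt_const x (0 : ℝ)).congr_of_eventuallyEq h0)

/-- Stretching a fixed bump `b` to `b (c x)` multiplies its two derivatives by `c` and `c²` and
widens the plateau to `|x| ≤ 1 / c`; a small `c` does everything at once. -/
theorem exists_isCutoff {δ : ℝ} (hδ : 0 < δ) : ∃ r χ χ' χ'', IsCutoff δ r χ χ' χ'' := by
  let b : ContDiffBump (0 : ℝ) := ⟨1, 2, by norm_num, by norm_num⟩
  have hb : ContDiff ℝ 2 b := b.contDiff
  have h1 : ∀ x, HasDerivAt b (deriv b x) x := fun x =>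
    (hb.differentiable (by norm_num) x).hasDerivAt
  have hb1 : ContDiff ℝ 1 (deriv b) := by
    have : ContDiff ℝ (1 + 1) b := by simpa using! hb
    exact (contDiff_succ_iff_deriv.1 this).2.2
  have h2 : ∀ x, HasDerivAt (deriv b) (deriv (deriv b) x) x := fun x =>
    (hb1.differentiable (by norm_num) x).hasDerivAt
  have hb2 : Continuous (deriv (deriv b)) := hb1.continuous_deriv (by norm_num)
  have z0 : ∀ x, (2 : ℝ) < |x| → b x = 0 := fun x hx =>
    b.zero_of_le_dist (by rw [Real.dist_eq, sub_zero]; exact hx.le)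
  have z1 : ∀ x, (2 : ℝ) < |x| → deriv b x = 0 := fun x hx =>
    hasDerivAt_eq_zero_of_outside z0 hx (h1 x)
  have z2 : ∀ x, (2 : ℝ) < |x| → deriv (deriv b) x = 0 := fun x hx =>
    hasDerivAt_eq_zero_of_outside z1 hx (h2 x)
  obtain ⟨M1, hM1, hM1'⟩ := exists_bound_of_compact_support hb1.continuous z1
  obtain ⟨M2, hM2, hM2'⟩ := exists_bound_of_compact_support hb2 z2
  -- `c ≤ δ` makes the plateau long enough; `c ≤ 1` lets `c * M2 ≤ δ` control the second derivative,
  -- which carries `c²`.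
  obtain ⟨c, hc0, hc1, hcδ, hc2, hc3⟩ :
      ∃ c : ℝ, 0 < c ∧ c ≤ 1 ∧ c ≤ δ ∧ c * M1 ≤ δ ∧ c * M2 ≤ δ := by
    refine ⟨min (min 1 δ) (min (δ / M1) (δ / M2)), by positivity, ?_, ?_, ?_, ?_⟩
    · exact (min_le_left _ _).trans (min_le_left _ _)
    · exact (min_le_left _ _).trans (min_le_right _ _)
    · exact (le_div_iff₀ hM1).1 ((min_le_right _ _).trans (min_le_left _ _))
    · exact (le_div_iff₀ hM2).1 ((min_le_right _ _).trans (min_le_right _ _))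
  have hout : ∀ x : ℝ, 2 / c < |x| → 2 < |c * x| := fun x hx => by
    rw [abs_mul, abs_of_pos hc0]
    rwa [div_lt_iff₀ hc0, mul_comm] at hx
  have hlin : ∀ x : ℝ, HasDerivAt (fun x : ℝ => c * x) c x := fun x => by
    simpa using (hasDerivAt_id x).const_mul c
  refine ⟨2 / c, fun x => b (c * x), fun x => deriv b (c * x) * c,
    fun x => deriv (deriv b) (c * x) * c * c, ?_⟩
  constructor
  · exact fun x => (h1 (c * x)).comp x (hlin x)
  · exact fun x => ((h2 (c * x)).comp x (hlin x)).mul_const c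
  · fun_prop
  · exact fun x => b.nonneg
  · exact fun x => b.le_one
  · intro x
    rw [abs_mul, abs_of_pos hc0]
    nlinarith [hM1' (c * x)]
  · intro x
    rw [abs_mul, abs_mul, abs_of_pos hc0]
    have := hM2' (c * x)
    have h3 : |deriv (deriv b) (c * x)| * c ≤ δ := by nlinarith
    nlinarith [abs_nonneg (deriv (deriv b) (c * x))]
  · intro x hx
    refine b.one_of_mem_closedBall ?_
    rw [Metric.mem_closedBall, Real.dist_eq, sub_zero, abs_mul, abs_of_pos hc0]
    rw [le_div_iff₀ hδ] at hx
    change c * |x| ≤ 1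
    nlinarith [abs_nonneg x]
  · exact fun x hx => z0 _ (hout x hx)
  · exact fun x hx => by simp [z1 _ (hout x hx)]
  · exact fun x hx => by simp [z2 _ (hout x hx)]

namespace IsCutoff

variable {δ r : ℝ} {χ χ' χ'' : ℝ → ℝ}

theorem continuous (h : IsCutoff δ r χ χ' χ'') : Continuous χ :=
  continuous_iff_continuousAt.2 fun x => (h.hasDerivAt x).continuousAt

theorem continuous' (h : IsCutoff δ r χ χ' χ'') : Continuous χ' :=
  continuous_iff_continuousAt.2 fun x => (h.hasDerivAt' x).continuousAt

end IsCutoff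

/-- For `R ≥ 1` the uniform bound `B + |D|` gives integrability by monotone exhaustion; afterwards
`R → ∞` removes the error `D / R` from the bound. -/
theorem integrable_of_intervalIntegral_le {h : ℝ → ℝ} (hc : Continuous h) (h0 : ∀ x, 0 ≤ h x)
    {B D : ℝ} (hB : ∀ R : ℝ, 1 ≤ R → ∫ x in -R..R, h x ≤ B + D / R) :
    Integrable h ∧ ∫ x, h x ≤ B := by
  have hint : Integrable h := by
    refine integrable_of_intervalIntegral_norm_bounded (ι := ℝ) (l := atTop) (B + |D|)
      (fun i => (hc.intervalIntegrable (-i) i).1) tendsto_neg_atTop_atBot tendsto_id ?_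
    filter_upwards [eventually_ge_atTop (1 : ℝ)] with R hR
    simp only [Real.norm_eq_abs, abs_of_nonneg (h0 _)]
    refine (hB R hR).trans (add_le_add_right ?_ _)
    rw [div_le_iff₀ (by linarith)]
    nlinarith [le_abs_self D, abs_nonneg D]
  refine ⟨hint, ?_⟩
  have h1 : Tendsto (fun R : ℝ => ∫ x in -R..R, h x) atTop (𝓝 (∫ x, h x)) :=
    intervalIntegral_tendsto_integral hint tendsto_neg_atTop_atBot tendsto_id
  have h2 : Tendsto (fun R : ℝ => B + D / R) atTop (𝓝 (B + 0)) :=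
    tendsto_const_nhds.add (tendsto_const_nhds.div_atTop tendsto_id)
  rw [add_zero] at h2
  refine le_of_tendsto_of_tendsto h1 h2 ?_
  filter_upwards [eventually_ge_atTop (1 : ℝ)] with R hR using hB R hR

/-- The pointwise form of the energy identity with weight `w`: up to a function with vanishing
integral, `λ w |φ'|²` and `w p |φ|²` are controlled by `φ` and `-φ'' + V φ`. -/
theorem IsAC1.energy {φ V : ℝ → ℂ} (hφ : IsAC1 φ) {c : ℂ} {p w w' : ℝ → ℝ}
    (hp : ∀ x, p x ≤ (c * V x).re)
    (hw : ∀ x, HasDerivAt w (w' x) x) (hw' : Continuous w') (hw0 : ∀ x, 0 ≤ w x) {r : ℝ}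
    (hr : ∀ x, r < |x| → w x = 0) :
    ∃ f : ℝ → ℝ, Integrable f ∧ ∫ x, f x = 0 ∧ ∀ᵐ x,
      c.re * w x * ‖deriv φ x‖ ^ 2 + w x * p x * ‖φ x‖ ^ 2 ≤
        ‖c‖ * (w x * ‖φ x‖ * ‖schrodingerExpr V φ x‖ + |w' x| * ‖φ x‖ * ‖deriv φ x‖) + f x := by
  have hwP : IsPrimitive (fun x => (w x : ℂ)) (fun x => (w' x : ℂ)) :=
    IsPrimitive.of_hasDerivAt (by fun_prop) fun x => (hw x).ofReal_comp
  -- The function with vanishing integral is the real part of `c (w conj φ φ')'`. Expanding it by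
  -- Leibniz and replacing `φ''` by `V φ - L φ` yields the inequality.
  have hP := (hwP.mul hφ.isPrimitive.star).mul hφ.isPrimitive_deriv
  obtain ⟨hi, hz⟩ := hP.integral_eq_zero (r := r) (fun x hx => by simp [hr x hx])
  have hi' := hi.const_mul c
  refine ⟨_, hi'.re, ?_, ?_⟩
  · have h0 := integral_re (𝕜 := ℂ) hi'
    rw [h0, integral_const_mul, hz, mul_zero]
    simp
  · refine ae_of_all _ fun x => ?_
    set a := φ x with ha
    set d := deriv φ x with hd
    set e := deriv (deriv φ) x with he
    have hL : schrodingerExpr V φ x = -e + V x * a := rfl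
    set ℓ := schrodingerExpr V φ x with hℓ
    have he' : e = V x * a - ℓ := by rw [hL]; ring
    have n1 : ‖d‖ ^ 2 = d.re * d.re + d.im * d.im := by
      rw [← Complex.normSq_eq_norm_sq, Complex.normSq_apply]
    have n2 : ‖a‖ ^ 2 = a.re * a.re + a.im * a.im := by
      rw [← Complex.normSq_eq_norm_sq, Complex.normSq_apply]
    have key : (c * ((↑(w' x) * conj a + ↑(w x) * conj d) * d + ↑(w x) * conj a * e)).re =
        c.re * w x * ‖d‖ ^ 2 + w x * (c * V x).re * ‖a‖ ^ 2
          + (c * (w' x * (conj a * d))).re - (c * (w x * (conj a * ℓ))).re := by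
      rw [he', n1, n2]
      simp only [Complex.mul_re, Complex.mul_im, Complex.add_re, Complex.add_im, Complex.sub_re,
        Complex.sub_im, Complex.conj_re, Complex.conj_im, Complex.ofReal_re, Complex.ofReal_im]
      ring
    change _ ≤ _ + (c * ((↑(w' x) * conj a + ↑(w x) * conj d) * d + ↑(w x) * conj a * e)).re
    rw [key]
    have b1 : -(c * (w' x * (conj a * d))).re ≤ ‖c‖ * (|w' x| * ‖a‖ * ‖d‖) := by
      refine (neg_le_abs _).trans ((Complex.abs_re_le_norm _).trans (le_of_eq ?_))
      simp [mul_assoc]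
    have b2 : (c * (w x * (conj a * ℓ))).re ≤ ‖c‖ * (w x * ‖a‖ * ‖ℓ‖) := by
      refine (le_abs_self _).trans ((Complex.abs_re_le_norm _).trans (le_of_eq ?_))
      simp [mul_assoc, abs_of_nonneg (hw0 x)]
    have b3 : w x * p x * ‖a‖ ^ 2 ≤ w x * (c * V x).re * ‖a‖ ^ 2 := by
      have := hw0 x
      have := hp x
      gcongr
    linarith

theorem MeasureTheory.MemLp.integrable_norm_sq {f : ℝ → ℂ} (hf : MemLp f 2) :
    Integrable (fun x => ‖f x‖ ^ 2) :=
  (memLp_two_iff_integrable_sq_norm hf.1).1 hf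

theorem MeasureTheory.MemLp.integrable_norm_mul_norm {f g : ℝ → ℂ} (hf : MemLp f 2)
    (hg : MemLp g 2) : Integrable (fun x => ‖f x‖ * ‖g x‖) :=
  hf.norm.integrable_mul hg.norm

theorem setIntegral_le_of_cutoff {h χ : ℝ → ℝ} (hc : Continuous h) (h0 : ∀ x, 0 ≤ h x)
    (hχ : Continuous χ) {r R : ℝ} (hR : 0 ≤ R) (hr : ∀ x, r < |x| → χ x = 0)
    (h1 : ∀ x, |x| ≤ R → χ x = 1) :
    ∫ x in -R..R, h x ≤ ∫ x, χ x ^ 2 * h x := by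
  rw [intervalIntegral.integral_of_le (by linarith)]
  have hi : Integrable (fun x => χ x ^ 2 * h x) :=
    integrable_of_continuous_of_support (by fun_prop) (r := r) fun x hx => by simp [hr x hx]
  calc ∫ x in Ioc (-R) R, h x = ∫ x in Ioc (-R) R, χ x ^ 2 * h x := by
        refine setIntegral_congr_fun measurableSet_Ioc fun x hx => ?_
        simp only [h1 x (abs_le.2 ⟨hx.1.le, hx.2⟩)]
        ring
    _ ≤ ∫ x, χ x ^ 2 * h x :=
        setIntegral_le_integral hi (ae_of_all _ fun x => mul_nonneg (sq_nonneg _) (h0 x))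

theorem integral_linear_comb₃ {f g h : ℝ → ℝ} (hf : Integrable f) (hg : Integrable g)
    (hh : Integrable h) (a b c : ℝ) :
    ∫ x, (a * f x + b * g x + c * h x) = a * (∫ x, f x) + b * (∫ x, g x) + c * ∫ x, h x := by
  have h1 : Integrable fun x => a * f x + b * g x := (hf.const_mul a).add (hg.const_mul b)
  rw [integral_add h1 (hh.const_mul c), integral_add (hf.const_mul a) (hg.const_mul b),
    integral_const_mul, integral_const_mul, integral_const_mul]

/-- The derivative of an element of the domain of the maximal operator is square integrable. -/
theorem IsAC1.deriv_memLp {φ V : ℝ → ℂ} (hφ : IsAC1 φ) (h2 : MemLp φ 2)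
    (hL : MemLp (schrodingerExpr V φ) 2) {c : ℂ} (hc : 0 < c.re) (hV : ∀ x, 0 ≤ (c * V x).re) :
    Integrable (fun x => ‖deriv φ x‖ ^ 2) ∧
      ∫ x, ‖deriv φ x‖ ^ 2 ≤ 2 * ‖c‖ / c.re * ∫ x, ‖φ x‖ * ‖schrodingerExpr V φ x‖ := by
  have hd := hφ.continuous_deriv
  have hφc := hφ.1.continuous
  have hi1 := h2.integrable_norm_mul_norm hL
  have hi2 := h2.integrable_norm_sq
  refine integrable_of_intervalIntegral_le (by fun_prop) (fun x => by positivity)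
    (D := 4 * ‖c‖ ^ 2 / c.re ^ 2 * ∫ x, ‖φ x‖ ^ 2) fun R hR => ?_
  have hR0 : 0 < R := by linarith
  -- The plateau has radius `R` and `χ'` is at most `1 / R`, so the term that contains `χ'`
  -- contributes only the error `D / R`.
  obtain ⟨r, χ, χ', χ'', hχ⟩ := exists_isCutoff (δ := 1 / R) (by positivity)
  have hχc := hχ.continuous
  have hχc' := hχ.continuous'
  refine (setIntegral_le_of_cutoff (χ := χ) (r := r) (by fun_prop) (fun x => by positivity)
    hχ.continuous hR0.le hχ.eq_zero fun x hx => hχ.eq_one x (by simpa using hx)).trans ?_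
  obtain ⟨f, hf1, hf2, hf3⟩ := hφ.energy (c := c) (p := fun _ => 0) (w := fun x => χ x ^ 2)
    (w' := fun x => 2 * χ x * χ' x) hV
    (fun x => by simpa using! (hχ.hasDerivAt x).pow 2)
    (by fun_prop) (fun x => sq_nonneg _) (r := r) (fun x hx => by simp [hχ.eq_zero x hx])
  have hmain : ∫ x, χ x ^ 2 * ‖deriv φ x‖ ^ 2 ≤ ∫ x,
      (2 * ‖c‖ / c.re * (‖φ x‖ * ‖schrodingerExpr V φ x‖) +
        4 * ‖c‖ ^ 2 / c.re ^ 2 * (1 / R) * ‖φ x‖ ^ 2 + 2 / c.re * f x) := by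
    refine integral_mono_ae (integrable_of_continuous_of_support (by fun_prop) (r := r)
      fun x hx => by simp [hχ.eq_zero x hx])
      (((hi1.const_mul _).add (hi2.const_mul _)).add (hf1.const_mul _)) ?_
    filter_upwards [hf3] with x hx
    have hA : χ x ^ 2 * ‖φ x‖ * ‖schrodingerExpr V φ x‖ ≤ ‖φ x‖ * ‖schrodingerExpr V φ x‖ := by
      rw [mul_assoc]
      exact mul_le_of_le_one_left (by positivity) (pow_le_one₀ (hχ.nonneg x) (hχ.le_one x))
    have hB : |2 * χ x * χ' x| ≤ 2 * χ x * (1 / R) := by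
      rw [abs_mul, abs_of_nonneg (by linarith [hχ.nonneg x])]
      exact mul_le_mul_of_nonneg_left (hχ.abs_deriv_le x) (by linarith [hχ.nonneg x])
    set t := χ x
    set n := ‖c‖
    have hn : 0 ≤ n := norm_nonneg _
    set a := ‖φ x‖
    have ha : 0 ≤ a := norm_nonneg _
    set d := ‖deriv φ x‖
    have hd0 : 0 ≤ d := norm_nonneg _
    set l := ‖schrodingerExpr V φ x‖
    set e := c.re
    have hs : 1 / R ≤ 1 := by rw [div_le_one hR0]; exact hR
    have hs0 : 0 < 1 / R := by positivity
    set s := 1 / R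
    have hx2 : e * t ^ 2 * d ^ 2 ≤ n * (a * l) + n * (2 * t * s * a * d) + f x := by
      have h3 : |2 * t * χ' x| * a * d ≤ 2 * t * s * a * d := by gcongr
      have h4 := mul_le_mul_of_nonneg_left h3 hn
      have h5 := mul_le_mul_of_nonneg_left hA hn
      linarith
    -- Young's inequality: half of `e (t d)²` is given back to the left side, and `s² ≤ s` leaves a
    -- remainder of order `1 / R`.
    have hY : n * (2 * t * s * a * d) ≤ e / 2 * (t * d) ^ 2 + 2 * n ^ 2 / e * s * a ^ 2 := by
      have h3 : n * (2 * t * s * a * d) ≤ e / 2 * (t * d) ^ 2 + 2 * n ^ 2 / e * (s * a) ^ 2 := by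
        have h4 : 0 ≤ (e * (t * d) - 2 * n * (s * a)) ^ 2 / (2 * e) := by positivity
        have h5 : (e * (t * d) - 2 * n * (s * a)) ^ 2 / (2 * e) =
          e / 2 * (t * d) ^ 2 + 2 * n ^ 2 / e * (s * a) ^ 2 - n * (2 * t * s * a * d) := by
          field_simp
          ring
        linarith
      refine h3.trans ?_
      have h6 : (s * a) ^ 2 ≤ s * a ^ 2 := by
        rw [mul_pow]
        exact mul_le_mul_of_nonneg_right (by nlinarith) (by positivity)
      have h7 := mul_le_mul_of_nonneg_left h6 (show 0 ≤ 2 * n ^ 2 / e by positivity)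
      linarith
    have hfin : e / 2 * (t ^ 2 * d ^ 2) ≤ n * (a * l) + 2 * n ^ 2 / e * s * a ^ 2 + f x := by
      have : (t * d) ^ 2 = t ^ 2 * d ^ 2 := by ring
      rw [this] at hY
      linarith
    have h8 := mul_le_mul_of_nonneg_left hfin (show 0 ≤ 2 / e by positivity)
    refine le_trans (le_of_eq ?_) (h8.trans (le_of_eq ?_))
    · field_simp
    · field_simp
      ring
  refine hmain.trans (le_of_eq ?_)
  rw [integral_linear_comb₃ hi1 hi2 hf1, hf2]
  ring

/-- For the exponential potential, multiplication by `e^{2x}` is relatively bounded. -/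
theorem IsAC1.exp_mul_memLp {φ : ℝ → ℂ} {k : ℂ} (hk : 0 < k.re) (hφ : IsAC1 φ)
    (hL : MemLp (schrodingerExpr (expPotential k) φ) 2)
    (hd2 : Integrable (fun x => ‖deriv φ x‖ ^ 2)) :
    Integrable (fun x => (Real.exp (2 * x) * ‖φ x‖) ^ 2) ∧
      ∫ x, (Real.exp (2 * x) * ‖φ x‖) ^ 2 ≤ 2 / (k.re ^ 2 * ‖k‖ ^ 2) *
        ((∫ x, ‖schrodingerExpr (expPotential k) φ x‖ ^ 2) + 16 * ∫ x, ‖deriv φ x‖ ^ 2) := by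
  have hd := hφ.continuous_deriv
  have hφc := hφ.1.continuous
  have hi1 := hL.integrable_norm_sq
  have hk0 : 0 < ‖k‖ := lt_of_lt_of_le hk (Complex.re_le_norm k)
  -- No decaying error is needed (`D = 0`): the terms from the derivative of the weight are paid for
  -- by `∫ ‖φ'‖²`, already known to be finite.
  refine integrable_of_intervalIntegral_le (by fun_prop) (fun x => by positivity)
    (D := 0) fun R hR => ?_
  have hR0 : 0 < R := by linarith
  obtain ⟨r, χ, χ', χ'', hχ⟩ := exists_isCutoff (δ := 1 / R) (by positivity)
  have hχc := hχ.continuous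
  have hχc' := hχ.continuous'
  refine (setIntegral_le_of_cutoff (χ := χ) (r := r) (by fun_prop) (fun x => by positivity)
    hχ.continuous hR0.le hχ.eq_zero fun x hx => hχ.eq_one x (by simpa using hx)).trans ?_
  have hexp : ∀ x : ℝ, HasDerivAt (fun x : ℝ => Real.exp (2 * x)) (2 * Real.exp (2 * x)) x :=
    fun x => by simpa [mul_comm] using ((hasDerivAt_id x).const_mul (2 : ℝ)).exp
  have hpV : ∀ x, ‖k‖ ^ 2 * k.re * Real.exp (2 * x) = (conj k * expPotential k x).re := fun x => by
    rw [expPotential, ← mul_assoc, Complex.re_mul_ofReal, pow_two k, ← mul_assoc,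
      ← Complex.normSq_eq_conj_mul_self, Complex.normSq_eq_norm_sq, Complex.re_ofReal_mul]
  obtain ⟨f, hf1, hf2, hf3⟩ := hφ.energy (V := expPotential k) (c := conj k)
    (p := fun x => ‖k‖ ^ 2 * k.re * Real.exp (2 * x))
    (w := fun x => χ x ^ 2 * Real.exp (2 * x))
    (w' := fun x => 2 * χ x * χ' x * Real.exp (2 * x) + χ x ^ 2 * (2 * Real.exp (2 * x)))
    (fun x => (hpV x).le)
    (fun x => by simpa using! ((hχ.hasDerivAt x).pow 2).mul (hexp x))
    (by fun_prop) (fun x => by positivity) (r := r) (fun x hx => by simp [hχ.eq_zero x hx])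
  have hmain : ∫ x, χ x ^ 2 * (Real.exp (2 * x) * ‖φ x‖) ^ 2 ≤ ∫ x,
      (2 / (k.re ^ 2 * ‖k‖ ^ 2) * ‖schrodingerExpr (expPotential k) φ x‖ ^ 2 +
        2 / (k.re ^ 2 * ‖k‖ ^ 2) * 16 * ‖deriv φ x‖ ^ 2 + 2 / (k.re * ‖k‖ ^ 2) * f x) := by
    refine integral_mono_ae (integrable_of_continuous_of_support (by fun_prop) (r := r)
      fun x hx => by simp [hχ.eq_zero x hx])
      (((hi1.const_mul _).add (hd2.const_mul _)).add (hf1.const_mul _)) ?_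
    filter_upwards [hf3] with x hx
    have hs : 1 / R ≤ 1 := by rw [div_le_one hR0]; exact hR
    have hE := Real.exp_pos (2 * x)
    have ht0 := hχ.nonneg x
    have ht1 := hχ.le_one x
    -- One factor of `χ e^{2x}` is kept. Multiplied by `‖φ‖` it is exactly the quantity `A` to be
    -- estimated, so the product with `‖φ'‖` can be split by Young's inequality.
    have hB : |2 * χ x * χ' x * Real.exp (2 * x) + χ x ^ 2 * (2 * Real.exp (2 * x))| ≤
        4 * (χ x * Real.exp (2 * x)) := by
      have h3 : 2 * χ x * χ' x * Real.exp (2 * x) + χ x ^ 2 * (2 * Real.exp (2 * x)) =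
        (2 * χ' x + 2 * χ x) * (χ x * Real.exp (2 * x)) := by ring
      rw [h3, abs_mul, abs_of_nonneg (a := χ x * Real.exp (2 * x)) (by positivity)]
      refine mul_le_mul_of_nonneg_right ?_ (by positivity)
      have h4 := abs_le.1 ((hχ.abs_deriv_le x).trans hs)
      exact abs_le.2 ⟨by linarith [h4.1], by linarith [h4.2]⟩
    simp only [Complex.conj_re, RCLike.norm_conj] at hx
    set t := χ x
    set E := Real.exp (2 * x)
    set n := ‖k‖
    set a := ‖φ x‖
    have ha : 0 ≤ a := norm_nonneg _
    set d := ‖deriv φ x‖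
    have hd0 : 0 ≤ d := norm_nonneg _
    set l := ‖schrodingerExpr (expPotential k) φ x‖
    have hl : 0 ≤ l := norm_nonneg _
    set e := k.re
    set A := t * E * a with hA
    have hA0 : 0 ≤ A := by positivity
    have h5 : e * (t ^ 2 * E) * d ^ 2 + n ^ 2 * e * A ^ 2 ≤ n * (A * l + 4 * A * d) + f x := by
      have h6 : t ^ 2 * E * a * l ≤ A * l := by
        have : t ^ 2 * E * a * l = t * (A * l) := by rw [hA]; ring
        rw [this]
        exact mul_le_of_le_one_left (by positivity) ht1
      have h7 : |2 * t * χ' x * E + t ^ 2 * (2 * E)| * a * d ≤ 4 * A * d := by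
        have : 4 * A * d = 4 * (t * E) * a * d := by rw [hA]; ring
        rw [this]
        gcongr
      have h8 := mul_le_mul_of_nonneg_left (add_le_add h6 h7) hk0.le
      have h9 : t ^ 2 * E * (n ^ 2 * e * E) * a ^ 2 = n ^ 2 * e * A ^ 2 := by rw [hA]; ring
      linarith
    -- This and the next Young inequality each use a quarter of the coercive term `e n² A²`; half of
    -- it survives.
    have h10 : n * (A * l) ≤ e * n ^ 2 / 4 * A ^ 2 + 1 / e * l ^ 2 := by
      have h4 : 0 ≤ (e * n * A - 2 * l) ^ 2 / (4 * e) := by positivity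
      have h5 : (e * n * A - 2 * l) ^ 2 / (4 * e) =
          e * n ^ 2 / 4 * A ^ 2 + 1 / e * l ^ 2 - n * (A * l) := by
        field_simp
        ring
      linarith
    have h11 : n * (4 * A * d) ≤ e * n ^ 2 / 4 * A ^ 2 + 16 / e * d ^ 2 := by
      have h4 : 0 ≤ (e * n * A - 8 * d) ^ 2 / (4 * e) := by positivity
      have h5 : (e * n * A - 8 * d) ^ 2 / (4 * e) =
          e * n ^ 2 / 4 * A ^ 2 + 16 / e * d ^ 2 - n * (4 * A * d) := by
        field_simp
        ring
      linarith
    have h12 : 0 ≤ e * (t ^ 2 * E) * d ^ 2 := by positivity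
    have h13 : e * n ^ 2 / 2 * A ^ 2 ≤ 1 / e * l ^ 2 + 16 / e * d ^ 2 + f x := by linarith
    have h14 := mul_le_mul_of_nonneg_left h13 (show 0 ≤ 2 / (e * n ^ 2) by positivity)
    refine le_trans (le_of_eq ?_) (h14.trans (le_of_eq ?_))
    · rw [hA]; field_simp
    · field_simp
  refine hmain.trans (le_of_eq ?_)
  rw [integral_linear_comb₃ hi1 hd2 hf1, hf2]
  ring

/-! ## The maximal operator: core and symmetry -/

theorem norm_sq_L2R (f : L2R) : ‖f‖ ^ 2 = ∫ x, ‖f x‖ ^ 2 := by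
  have h : (inner ℂ f f : ℂ) = ((‖f‖ ^ 2 : ℝ) : ℂ) := by
    rw [inner_self_eq_norm_sq_to_K]; simp
  rw [L2.inner_def] at h
  have h2 : ∀ x, (inner ℂ (f x) (f x) : ℂ) = ((‖f x‖ ^ 2 : ℝ) : ℂ) := fun x => by
    rw [inner_self_eq_norm_sq_to_K]; simp
  simp only [h2] at h
  rw [integral_complex_ofReal] at h
  exact_mod_cast h.symm

theorem norm_sub_sq_L2R {f g : L2R} {φ ψ : ℝ → ℂ} (hf : f =ᵐ[volume] φ) (hg : g =ᵐ[volume] ψ) :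
    ‖f - g‖ ^ 2 = ∫ x, ‖φ x - ψ x‖ ^ 2 := by
  rw [norm_sq_L2R]
  refine integral_congr_ae ?_
  filter_upwards [Lp.coeFn_sub f g, hf, hg] with x h1 h2 h3
  rw [h1, Pi.sub_apply, h2, h3]

theorem norm_sq_eq_of_ae {f : L2R} {φ : ℝ → ℂ} (hf : f =ᵐ[volume] φ) :
    ‖f‖ ^ 2 = ∫ x, ‖φ x‖ ^ 2 := by
  rw [norm_sq_L2R]
  refine integral_congr_ae ?_
  filter_upwards [hf] with x h1
  rw [h1]

theorem memLp_of_ae {f : L2R} {φ : ℝ → ℂ} (hf : f =ᵐ[volume] φ) : MemLp φ 2 :=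
  (memLp_congr_ae hf).1 (Lp.memLp f)

theorem tendsto_L2R_of_sq {F : ℕ → L2R} {f : L2R}
    (h : Tendsto (fun n => ‖F n - f‖ ^ 2) atTop (𝓝 0)) : Tendsto F atTop (𝓝 f) := by
  rw [tendsto_iff_norm_sub_tendsto_zero]
  have := h.sqrt
  simpa [Real.sqrt_sq] using this

theorem mem_maxGraph_of_isPrimitive {V φ ψ η : ℝ → ℂ} {f g : L2R}
    (h1 : ∀ x, HasDerivAt φ (ψ x) x) (h2 : IsPrimitive ψ η) (hf : f =ᵐ[volume] φ)
    (hg : g =ᵐ[volume] fun x => -η x + V x * φ x) : (f, g) ∈ maxGraph V := by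
  obtain ⟨h3, -, h5⟩ := IsAC1.of_isPrimitive h1 h2
  refine ⟨φ, h3, hf, ?_⟩
  filter_upwards [hg, h5] with x hx hy
  rw [schrodingerExpr, hx, hy]

theorem mem_maxOp_domain {V : ℝ → ℂ} {f g : L2R} (h : (f, g) ∈ maxGraph V) :
    ∃ hf : f ∈ (maxOp V).domain, maxOp V ⟨f, hf⟩ = g := by
  rw [← maxOp_graph, LinearPMap.mem_graph_iff] at h
  obtain ⟨y, hy1, hy2⟩ := h
  simp only at hy1 hy2
  subst hy1
  exact ⟨y.2, hy2⟩

theorem maxOp_mem_maxGraph {V : ℝ → ℂ} (f : (maxOp V).domain) :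
    ((f : L2R), maxOp V f) ∈ maxGraph V := by
  rw [← maxOp_graph]
  exact LinearPMap.mem_graph _ f

/-- The restriction of the maximal operator to functions vanishing near infinity. -/
noncomputable abbrev coreOp (V : ℝ → ℂ) : L2R →ₗ.[ℂ] L2R :=
  (maxOp V).domRestrict vanishingNearInfinity

theorem mem_coreOp_graph {V : ℝ → ℂ} {p : L2R × L2R} :
    p ∈ (coreOp V).graph ↔ p ∈ maxGraph V ∧ p.1 ∈ vanishingNearInfinity := by
  constructor
  · intro h
    refine ⟨?_, ?_⟩
    · rw [← maxOp_graph]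
      exact LinearPMap.le_graph_of_le LinearPMap.domRestrict_le h
    · rw [LinearPMap.mem_graph_iff] at h
      obtain ⟨y, hy1, -⟩ := h
      rw [← hy1]
      exact y.2.1
  · rintro ⟨h1, h2⟩
    obtain ⟨hf, hg⟩ := mem_maxOp_domain (f := p.1) (g := p.2) h1
    rw [LinearPMap.mem_graph_iff]
    refine ⟨⟨p.1, h2, hf⟩, rfl, ?_⟩
    rw [← hg]
    exact LinearPMap.domRestrict_apply rfl

theorem IsAC1.mul_cutoff {δ r : ℝ} {χ χ' χ'' : ℝ → ℝ} (hχ : IsCutoff δ r χ χ' χ'')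
    {φ : ℝ → ℂ} (hφ : IsAC1 φ) (V : ℝ → ℂ) :
    IsAC1 (fun x => χ x * φ x) ∧ schrodingerExpr V (fun x => χ x * φ x) =ᵐ[volume]
      fun x => χ x * schrodingerExpr V φ x - 2 * χ' x * deriv φ x - χ'' x * φ x := by
  have hχc := hχ.continuous
  have hχc' := hχ.continuous'
  have hχc'' := hχ.continuous''
  have p0 : IsPrimitive (fun x => (χ x : ℂ)) (fun x => (χ' x : ℂ)) :=
    IsPrimitive.of_hasDerivAt (by fun_prop) fun x => (hχ.hasDerivAt x).ofReal_comp
  have p1 : IsPrimitive (fun x => (χ' x : ℂ)) (fun x => (χ'' x : ℂ)) :=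
    IsPrimitive.of_hasDerivAt (by fun_prop) fun x => (hχ.hasDerivAt' x).ofReal_comp
  obtain ⟨h1, -, h3⟩ := IsAC1.of_isPrimitive
    (fun x => (hχ.hasDerivAt x).ofReal_comp.mul (hφ.1 x).hasDerivAt)
    ((p1.mul hφ.isPrimitive).add (p0.mul hφ.isPrimitive_deriv))
  refine ⟨h1, ?_⟩
  filter_upwards [h3] with x hx
  rw [schrodingerExpr, schrodingerExpr]
  erw [hx]
  ring

/-- Multiplication by `χ_n` turns `L φ` into `χ_n L φ - 2 χ_n' φ' - χ_n'' φ`. Since `φ' ∈ L²` and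
both derivatives of `χ_n` tend to zero uniformly, dominated convergence applies to both components
of the graph. -/
theorem mem_closure_coreOp_graph {V : ℝ → ℂ} {c : ℂ} (hc : 0 < c.re)
    (hV : ∀ x, 0 ≤ (c * V x).re) {p : L2R × L2R} (hp : p ∈ maxGraph V) :
    p ∈ closure ((coreOp V).graph : Set (L2R × L2R)) := by
  obtain ⟨φ, hφ, hp1, hp2⟩ := hp
  have m1 : MemLp φ 2 := memLp_of_ae hp1
  have m2 : MemLp (schrodingerExpr V φ) 2 := memLp_of_ae hp2
  have hd := hφ.continuous_deriv
  have hφc := hφ.1.continuous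
  have m3 : MemLp (deriv φ) 2 := (memLp_two_iff_integrable_sq_norm hd.aestronglyMeasurable).2
    (hφ.deriv_memLp m1 m2 hc hV).1
  have hδ : ∀ n : ℕ, 0 < 1 / ((n : ℝ) + 1) := fun n => by positivity
  choose r χ χ' χ'' hχ using fun n : ℕ => exists_isCutoff (hδ n)
  have hδ1 : ∀ n : ℕ, 1 / ((n : ℝ) + 1) ≤ 1 := fun n => by
    rw [div_le_one (by positivity)]; linarith [n.cast_nonneg (α := ℝ)]
  have c0 := fun n => (hχ n).continuous
  have c1 := fun n => (hχ n).continuous'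
  have c2 := fun n => (hχ n).continuous''
  have n1 : ∀ n, MemLp (fun x => χ n x * φ x) 2 := fun n => by
    refine m1.of_le (by fun_prop) (ae_of_all _ fun x => ?_)
    rw [norm_mul, Complex.norm_real, Real.norm_of_nonneg ((hχ n).nonneg x)]
    exact mul_le_of_le_one_left (norm_nonneg _) ((hχ n).le_one x)
  have hm2 := m2.aestronglyMeasurable
  have n2 : ∀ n, MemLp (fun x => χ n x * schrodingerExpr V φ x - 2 * χ' n x * deriv φ x
      - χ'' n x * φ x) 2 := fun n => by
    have a1 : MemLp (fun x => χ n x * schrodingerExpr V φ x) 2 := by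
      refine m2.of_le ((by fun_prop : Continuous fun x => (χ n x : ℂ)).aestronglyMeasurable.mul
        hm2) (ae_of_all _ fun x => ?_)
      rw [norm_mul, Complex.norm_real, Real.norm_of_nonneg ((hχ n).nonneg x)]
      exact mul_le_of_le_one_left (norm_nonneg _) ((hχ n).le_one x)
    have a2 : MemLp (fun x => 2 * χ' n x * deriv φ x) 2 := by
      refine m3.of_le_mul (c := 2) (by fun_prop) (ae_of_all _ fun x => ?_)
      rw [norm_mul, norm_mul, Complex.norm_real, Complex.norm_ofNat]
      have := ((hχ n).abs_deriv_le x).trans (hδ1 n)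
      rw [Real.norm_eq_abs]
      gcongr
      linarith
    have a3 : MemLp (fun x => χ'' n x * φ x) 2 := by
      refine m1.of_le (by fun_prop) (ae_of_all _ fun x => ?_)
      rw [norm_mul, Complex.norm_real, Real.norm_eq_abs]
      exact mul_le_of_le_one_left (norm_nonneg _) (((hχ n).abs_deriv2_le x).trans (hδ1 n))
    exact (a1.sub a2).sub a3
  have e1 := fun n => (n1 n).coeFn_toLp
  have e2 := fun n => (n2 n).coeFn_toLp
  have hev : ∀ x : ℝ, ∀ᶠ n : ℕ in atTop, χ n x = 1 := fun x => by
    filter_upwards [eventually_ge_atTop ⌈|x|⌉₊] with n hn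
    refine (hχ n).eq_one x ?_
    rw [one_div_one_div]
    linarith [Nat.ceil_le.1 hn]
  have hδt : Tendsto (fun n : ℕ => 1 / ((n : ℝ) + 1)) atTop (𝓝 0) :=
    tendsto_one_div_add_atTop_nhds_zero_nat
  have t0 : ∀ x, Tendsto (fun n => (χ n x : ℂ)) atTop (𝓝 1) := fun x =>
    tendsto_const_nhds.congr' (by filter_upwards [hev x] with n hn; simp [hn])
  have t1 : ∀ x, Tendsto (fun n => (χ' n x : ℂ)) atTop (𝓝 0) := fun x =>
    squeeze_zero_norm (fun n => by simpa using (hχ n).abs_deriv_le x) hδt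
  have t2 : ∀ x, Tendsto (fun n => (χ'' n x : ℂ)) atTop (𝓝 0) := fun x =>
    squeeze_zero_norm (fun n => by simpa using (hχ n).abs_deriv2_le x) hδt
  refine mem_closure_of_tendsto (f := fun n => ((n1 n).toLp, (n2 n).toLp)) (b := atTop)
    ((Tendsto.prodMk_nhds (tendsto_L2R_of_sq ?_) (tendsto_L2R_of_sq ?_)))
    (Eventually.of_forall fun n => ?_)
  · simp only [norm_sub_sq_L2R (e1 _) hp1]
    have := tendsto_integral_of_dominated_convergence (F := fun n x => ‖χ n x * φ x - φ x‖ ^ 2)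
      (f := fun _ => 0) (fun x => ‖φ x‖ ^ 2) (fun n => by fun_prop) m1.integrable_norm_sq
      (fun n => ae_of_all _ fun x => ?_) (ae_of_all _ fun x => ?_) (μ := volume)
    · simpa using this
    · rw [norm_pow, norm_norm]
      have h3 : χ n x * φ x - φ x = ((χ n x - 1 : ℝ) : ℂ) * φ x := by push_cast; ring
      rw [h3, norm_mul, Complex.norm_real]
      refine pow_le_pow_left₀ (by positivity) (mul_le_of_le_one_left (norm_nonneg _) ?_) 2
      exact abs_le.2 ⟨by linarith [(hχ n).nonneg x], by linarith [(hχ n).le_one x]⟩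
    · have := (((t0 x).mul_const (φ x)).sub_const (φ x)).norm.pow 2
      simpa using this
  · simp only [norm_sub_sq_L2R (e2 _) hp2]
    have := tendsto_integral_of_dominated_convergence (F := fun n x =>
      ‖χ n x * schrodingerExpr V φ x - 2 * χ' n x * deriv φ x - χ'' n x * φ x -
        schrodingerExpr V φ x‖ ^ 2)
      (f := fun _ => 0) (fun x => ‖‖schrodingerExpr V φ x‖ + 2 * ‖deriv φ x‖ + ‖φ x‖‖ ^ 2)
      (fun n => ((((n2 n).sub m2).aestronglyMeasurable).norm.pow 2))
      ((memLp_two_iff_integrable_sq_norm ?_).1 ((m2.norm.add (m3.norm.const_mul 2)).add m1.norm))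
      (fun n => ae_of_all _ fun x => ?_) (ae_of_all _ fun x => ?_) (μ := volume)
    · simpa using this
    · exact ((m2.norm.add (m3.norm.const_mul 2)).add m1.norm).aestronglyMeasurable
    · rw [norm_pow, norm_norm]
      refine pow_le_pow_left₀ (by positivity) ?_ 2
      rw [Real.norm_of_nonneg (by positivity)]
      have h3 : χ n x * schrodingerExpr V φ x - 2 * χ' n x * deriv φ x - χ'' n x * φ x -
        schrodingerExpr V φ x = ((χ n x - 1 : ℝ) : ℂ) * schrodingerExpr V φ x
          - ((2 * χ' n x : ℝ) : ℂ) * deriv φ x - ((χ'' n x : ℝ) : ℂ) * φ x := by push_cast; ring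
      rw [h3]
      refine (norm_sub_le _ _).trans (add_le_add ((norm_sub_le _ _).trans (add_le_add ?_ ?_)) ?_)
      · rw [norm_mul, Complex.norm_real]
        refine mul_le_of_le_one_left (norm_nonneg _) ?_
        exact abs_le.2 ⟨by linarith [(hχ n).nonneg x], by linarith [(hχ n).le_one x]⟩
      · rw [norm_mul, Complex.norm_real, norm_mul, Real.norm_ofNat, Real.norm_eq_abs]
        have := ((hχ n).abs_deriv_le x).trans (hδ1 n)
        gcongr
        linarith
      · rw [norm_mul, Complex.norm_real, Real.norm_eq_abs]
        exact mul_le_of_le_one_left (norm_nonneg _) (((hχ n).abs_deriv2_le x).trans (hδ1 n))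
    · have := ((((t0 x).mul_const (schrodingerExpr V φ x)).sub
        (((t1 x).const_mul 2).mul_const (deriv φ x))).sub
          ((t2 x).mul_const (φ x))).sub_const (schrodingerExpr V φ x)
      simpa using this.norm.pow 2
  · refine mem_coreOp_graph.2 ⟨?_, ?_⟩
    · obtain ⟨h1, h2⟩ := hφ.mul_cutoff (hχ n) V
      exact ⟨_, h1, e1 n, (e2 n).trans h2.symm⟩
    · refine ⟨r n, ?_⟩
      filter_upwards [e1 n] with x hx hr
      rw [hx, (hχ n).eq_zero x hr]
      simp

/-- The `star` undoes the conjugation in the inner product. With a complex potential, symmetry can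
be expected only for this bilinear pairing. -/
theorem inner_star_eq (f g : L2R) : inner ℂ (star f) g = ∫ x, f x * g x := by
  rw [L2.inner_def]
  refine integral_congr_ae ?_
  filter_upwards [Lp.coeFn_star f] with x hx
  rw [hx]
  simp [mul_comm]

theorem inner_star_comm (f g : L2R) : inner ℂ (star f) g = inner ℂ (star g) f := by
  rw [inner_star_eq, inner_star_eq]
  simp only [mul_comm]

theorem eq_zero_of_forall_inner_star {f : L2R} (h : ∀ g : L2R, inner ℂ (star f) g = 0) :
    f = 0 := by
  have h1 := h (star f)
  rw [inner_self_eq_zero] at h1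
  have h2 := congrArg star h1
  rw [star_star] at h2
  rw [h2]
  apply Lp.ext
  filter_upwards [Lp.coeFn_star (0 : L2R), Lp.coeFn_zero ℂ 2 (volume : Measure ℝ)] with x h3 h4
  rw [h3, Pi.star_apply, h4]
  simp

/-- Integration by parts against cutoffs moves the derivative onto `χ_n`, where it is at most `1 /
(n + 1)`. Integrability of `W` replaces any knowledge of its limits at infinity. -/
theorem IsPrimitive.integral_eq_zero_of_integrable {W w : ℝ → ℂ} (h : IsPrimitive W w)
    (hW : Integrable W) (hw : Integrable w) : ∫ x, w x = 0 := by
  have hδ : ∀ n : ℕ, 0 < 1 / ((n : ℝ) + 1) := fun n => by positivity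
  choose r χ χ' χ'' hχ using fun n : ℕ => exists_isCutoff (hδ n)
  have c0 := fun n => (hχ n).continuous
  have c1 := fun n => (hχ n).continuous'
  have hWc := h.continuous
  have hδt : Tendsto (fun n : ℕ => 1 / ((n : ℝ) + 1)) atTop (𝓝 0) :=
    tendsto_one_div_add_atTop_nhds_zero_nat
  have i1 : ∀ n, Integrable (fun x => χ n x * w x) := fun n => by
    refine hw.mono ((by fun_prop : Continuous fun x => (χ n x : ℂ)).aestronglyMeasurable.mul
      hw.aestronglyMeasurable) (ae_of_all _ fun x => ?_)
    rw [norm_mul, Complex.norm_real, Real.norm_of_nonneg ((hχ n).nonneg x)]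
    exact mul_le_of_le_one_left (norm_nonneg _) ((hχ n).le_one x)
  have i2 : ∀ n, Integrable (fun x => χ' n x * W x) := fun n => by
    refine integrable_of_continuous_of_support (by fun_prop) (r := r n) fun x hx => ?_
    simp [(hχ n).deriv_eq_zero x hx]
  have heq : ∀ n, ∫ x, χ n x * w x = -∫ x, χ' n x * W x := fun n => by
    have p0 : IsPrimitive (fun x => (χ n x : ℂ)) (fun x => (χ' n x : ℂ)) :=
      IsPrimitive.of_hasDerivAt (by fun_prop) fun x => ((hχ n).hasDerivAt x).ofReal_comp
    obtain ⟨-, h3⟩ := (p0.mul h).integral_eq_zero (r := r n)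
      fun x hx => by simp [(hχ n).eq_zero x hx]
    rw [integral_add (i2 n) (i1 n)] at h3
    exact (neg_eq_of_add_eq_zero_right h3).symm
  have l1 : Tendsto (fun n => ∫ x, χ n x * w x) atTop (𝓝 (∫ x, w x)) := by
    refine tendsto_integral_of_dominated_convergence (fun x => ‖w x‖)
      (fun n => (i1 n).aestronglyMeasurable) hw.norm (fun n => ae_of_all _ fun x => ?_)
      (ae_of_all _ fun x => ?_)
    · rw [norm_mul, Complex.norm_real, Real.norm_of_nonneg ((hχ n).nonneg x)]
      exact mul_le_of_le_one_left (norm_nonneg _) ((hχ n).le_one x)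
    · refine tendsto_const_nhds.congr' ?_
      filter_upwards [eventually_ge_atTop ⌈|x|⌉₊] with n hn
      rw [(hχ n).eq_one x (by rw [one_div_one_div]; linarith [Nat.ceil_le.1 hn])]
      simp
  have l2 : Tendsto (fun n => ∫ x, χ n x * w x) atTop (𝓝 0) := by
    refine squeeze_zero_norm (a := fun n : ℕ => 1 / ((n : ℝ) + 1) * ∫ x, ‖W x‖) (fun n => ?_) ?_
    · rw [heq n, norm_neg, ← integral_const_mul]
      refine norm_integral_le_of_norm_le (hW.norm.const_mul _) (ae_of_all _ fun x => ?_)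
      rw [norm_mul, Complex.norm_real]
      exact mul_le_mul_of_nonneg_right ((hχ n).abs_deriv_le x) (norm_nonneg _)
    · simpa using hδt.mul_const (∫ x, ‖W x‖)
  exact tendsto_nhds_unique l1 l2

/-- The maximal operator is symmetric with respect to the bilinear pairing `∫ f g`. -/
theorem maxGraph_symm {V : ℝ → ℂ} {c : ℂ} (hc : 0 < c.re) (hV : ∀ x, 0 ≤ (c * V x).re)
    {f g p q : L2R} (h1 : (f, g) ∈ maxGraph V) (h2 : (p, q) ∈ maxGraph V) :
    inner ℂ (star f) q = inner ℂ (star p) g := by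
  obtain ⟨φ, hφ, hf, hg⟩ := h1
  obtain ⟨ψ, hψ, hp, hq⟩ := h2
  simp only at hf hg hp hq
  have m1 : MemLp φ 2 := memLp_of_ae hf
  have m2 : MemLp (schrodingerExpr V φ) 2 := memLp_of_ae hg
  have m3 : MemLp (deriv φ) 2 :=
    (memLp_two_iff_integrable_sq_norm hφ.continuous_deriv.aestronglyMeasurable).2
    (hφ.deriv_memLp m1 m2 hc hV).1
  have k1 : MemLp ψ 2 := memLp_of_ae hp
  have k2 : MemLp (schrodingerExpr V ψ) 2 := memLp_of_ae hq
  have k3 : MemLp (deriv ψ) 2 :=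
    (memLp_two_iff_integrable_sq_norm hψ.continuous_deriv.aestronglyMeasurable).2
    (hψ.deriv_memLp k1 k2 hc hV).1
  -- The Wronskian `φ' ψ - φ ψ'` is integrable, all four factors being in `L²`; in its derivative
  -- the potential cancels and `φ L ψ - ψ L φ` remains.
  have hP := (hφ.isPrimitive_deriv.mul hψ.isPrimitive).sub
    (hφ.isPrimitive.mul hψ.isPrimitive_deriv)
  have i1 : Integrable (fun x => φ x * schrodingerExpr V ψ x) := m1.integrable_mul k2
  have i2 : Integrable (fun x => ψ x * schrodingerExpr V φ x) := k1.integrable_mul m2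
  have heq : (fun x => deriv (deriv φ) x * ψ x + deriv φ x * deriv ψ x -
      (deriv φ x * deriv ψ x + φ x * deriv (deriv ψ) x)) =
      fun x => φ x * schrodingerExpr V ψ x - ψ x * schrodingerExpr V φ x := by
    funext x
    simp only [schrodingerExpr]
    ring
  rw [heq] at hP
  have h0 := hP.integral_eq_zero_of_integrable ((m3.integrable_mul k1).sub (m1.integrable_mul k3))
    (i1.sub i2)
  rw [integral_sub i1 i2, sub_eq_zero] at h0
  rw [inner_star_eq, inner_star_eq]
  rw [show ∫ x, f x * q x = ∫ x, φ x * schrodingerExpr V ψ x from integral_congr_ae (hf.mul hq),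
    show ∫ x, p x * g x = ∫ x, ψ x * schrodingerExpr V φ x from integral_congr_ae (hp.mul hg), h0]

/-! ### Resolvents, closedness and uniqueness of the realization -/

/-- A right inverse of `maxOp V - z` is the resolvent. -/
theorem isResolventAt_of_mem_maxGraph {V : ℝ → ℂ} {c : ℂ} (hc : 0 < c.re)
    (hV : ∀ x, 0 ≤ (c * V x).re) {z : ℂ} {R : L2R →L[ℂ] L2R}
    (hR : ∀ h, (R h, h + z • R h) ∈ maxGraph V) : IsResolventAt (maxOp V) z R := by
  refine ⟨fun f => ?_, fun g => ?_⟩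
  · set h := maxOp V f - z • (f : L2R) with hh
    -- The defect `f - R h` lies in the kernel of `L^max - z`. Pairing it with the range of `R`, the
    -- terms with `z` cancel and the defect annihilates every `p`.
    have h1 : ((f : L2R) - R h, z • ((f : L2R) - R h)) ∈ maxGraph V := by
      have := (maxGraph V).sub_mem (maxOp_mem_maxGraph f) (hR h)
      have h2 : maxOp V f - (h + z • R h) = z • ((f : L2R) - R h) := by
        rw [hh, smul_sub]; abel
      rw [Prod.mk_sub_mk, h2] at this
      exact this
    have h0 : (f : L2R) - R h = 0 := by
      refine eq_zero_of_forall_inner_star fun p => ?_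
      have h3 := maxGraph_symm hc hV h1 (hR p)
      rw [inner_add_right, inner_smul_right, inner_smul_right, inner_star_comm (R p)] at h3
      exact add_eq_right.1 h3
    exact (sub_eq_zero.1 h0).symm
  · obtain ⟨hf, hg⟩ := mem_maxOp_domain (hR g)
    exact ⟨⟨R g, hf⟩, rfl, by rw [hg]; simp⟩

/-- The graph is the solution set of `f = R (g - z f)`, an equation between continuous functions of
`(f, g)`. -/
theorem IsResolventAt.isClosed {V : ℝ → ℂ} {z : ℂ} {R : L2R →L[ℂ] L2R}
    (h : IsResolventAt (maxOp V) z R) : (maxOp V).IsClosed := by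
  have heq : ((maxOp V).graph : Set (L2R × L2R)) = {p | p.1 = R (p.2 - z • p.1)} := by
    ext p
    constructor
    · intro hp
      obtain ⟨y, hy1, hy2⟩ := (LinearPMap.mem_graph_iff _).1 hp
      have := h.1 y
      rw [hy1, hy2] at this
      exact this.symm
    · intro hp
      obtain ⟨y, hy1, hy2⟩ := h.2 (p.2 - z • p.1)
      refine (LinearPMap.mem_graph_iff _).2 ⟨y, hy1.trans hp.symm, ?_⟩
      rw [hy1, show R (p.2 - z • p.1) = p.1 from hp.symm] at hy2
      simpa using hy2
  rw [LinearPMap.IsClosed, heq]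
  exact isClosed_eq (by fun_prop) (by fun_prop)

theorem minOp_eq_maxOp {V : ℝ → ℂ} {c : ℂ} (hc : 0 < c.re) (hV : ∀ x, 0 ≤ (c * V x).re)
    (hcl : (maxOp V).IsClosed) : minOp V = maxOp V := by
  have h1 : (coreOp V).IsClosable := hcl.isClosable.leIsClosable LinearPMap.domRestrict_le
  refine LinearPMap.eq_of_eq_graph (le_antisymm ?_ ?_)
  · rw [minOp, ← h1.graph_closure_eq_closure_graph]
    exact Submodule.topologicalClosure_minimal _
      (LinearPMap.le_graph_of_le LinearPMap.domRestrict_le) hcl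
  · rw [minOp, ← h1.graph_closure_eq_closure_graph, maxOp_graph]
    exact fun p hp => mem_closure_coreOp_graph hc hV hp

theorem isClosedRealization_iff {V : ℝ → ℂ} {c : ℂ} (hc : 0 < c.re)
    (hV : ∀ x, 0 ≤ (c * V x).re) (hcl : (maxOp V).IsClosed) (A : L2R →ₗ.[ℂ] L2R) :
    IsClosedRealization V A ↔ A = maxOp V := by
  constructor
  · rintro ⟨-, h1, h2⟩
    rw [minOp_eq_maxOp hc hV hcl] at h1
    exact le_antisymm h2 h1
  · rintro rfl
    exact ⟨hcl, (minOp_eq_maxOp hc hV hcl).le, le_rfl⟩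

/-! ## Integral operators with exponentially decaying kernels -/

theorem integrable_exp_neg_mul_abs {c : ℝ} (hc : 0 < c) :
    Integrable (fun x : ℝ => Real.exp (-(c * |x|))) := by
  have h1 : IntegrableOn (fun x : ℝ => Real.exp (-(c * |x|))) (Iic 0) := by
    refine (integrableOn_exp_mul_Iic hc 0).congr_fun (fun x hx => ?_) measurableSet_Iic
    simp [abs_of_nonpos (show x ≤ 0 from hx)]
  have h2 : IntegrableOn (fun x : ℝ => Real.exp (-(c * |x|))) (Ioi 0) := by
    refine (exp_neg_integrableOn_Ioi 0 hc).congr_fun (fun x hx => ?_) measurableSet_Ioi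
    simp [abs_of_pos (show 0 < x from hx)]
  rw [← integrableOn_univ, ← Iic_union_Ioi (a := (0 : ℝ))]
  exact h1.union h2

/-- The integrand is that of the convolution of two integrable functions, `‖g‖²` and `e^{-c|x|}`. -/
theorem integrable_norm_sq_mul_exp {c : ℝ} (hc : 0 < c) (g : L2R) :
    Integrable (fun p : ℝ × ℝ => ‖g p.2‖ ^ 2 * Real.exp (-(c * |p.1 - p.2|)))
      (volume.prod volume) ∧
    ∫ p : ℝ × ℝ, ‖g p.2‖ ^ 2 * Real.exp (-(c * |p.1 - p.2|)) ∂(volume.prod volume) =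
      ‖g‖ ^ 2 * ∫ x, Real.exp (-(c * |x|)) := by
  have h1 := (Lp.memLp g).integrable_norm_sq
  have h2 := integrable_exp_neg_mul_abs hc
  have h3 : Integrable (fun p : ℝ × ℝ => ‖g p.2‖ ^ 2 * Real.exp (-(c * |p.1 - p.2|)))
      (volume.prod volume) := h1.convolution_integrand (ContinuousLinearMap.mul ℝ ℝ) h2
  refine ⟨h3, ?_⟩
  rw [integral_prod _ h3, norm_sq_L2R]
  exact integral_convolution (ContinuousLinearMap.mul ℝ ℝ) h1 h2

theorem integrable_norm_sq_mul_exp' {c : ℝ} (hc : 0 < c) (f : L2R) :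
    Integrable (fun p : ℝ × ℝ => ‖f p.1‖ ^ 2 * Real.exp (-(c * |p.1 - p.2|)))
      (volume.prod volume) ∧
    ∫ p : ℝ × ℝ, ‖f p.1‖ ^ 2 * Real.exp (-(c * |p.1 - p.2|)) ∂(volume.prod volume) =
      ‖f‖ ^ 2 * ∫ x, Real.exp (-(c * |x|)) := by
  obtain ⟨h1, h2⟩ := integrable_norm_sq_mul_exp hc f
  have heq : (fun p : ℝ × ℝ => ‖f p.1‖ ^ 2 * Real.exp (-(c * |p.1 - p.2|))) =
      fun p : ℝ × ℝ => (fun p : ℝ × ℝ => ‖f p.2‖ ^ 2 * Real.exp (-(c * |p.1 - p.2|))) p.swap := by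
    funext p
    simp [abs_sub_comm]
  rw [heq]
  refine ⟨h1.swap, ?_⟩
  rw [← h2]
  exact integral_prod_swap (μ := volume) (ν := volume)
    (fun p : ℝ × ℝ => ‖f p.2‖ ^ 2 * Real.exp (-(c * |p.1 - p.2|)))

section Kernel

variable {N : ℝ → ℝ → ℂ} {c D : ℝ}

/-- A Schur test: `2 ‖f‖ ‖g‖ ≤ ‖f‖² + ‖g‖²` pointwise leaves one variable free in each term, where
the exponential integrates to a constant. -/
theorem kernel_integrable (hc : 0 < c) (hN : Continuous fun p : ℝ × ℝ => N p.1 p.2)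
    (hD : ∀ x y, ‖N x y‖ ≤ D * Real.exp (-(c * |x - y|))) (f g : L2R) :
    Integrable (fun p : ℝ × ℝ => conj (f p.1) * N p.1 p.2 * g p.2) (volume.prod volume) ∧
    ‖∫ p : ℝ × ℝ, conj (f p.1) * N p.1 p.2 * g p.2 ∂(volume.prod volume)‖ ≤
      D * (∫ x, Real.exp (-(c * |x|))) / 2 * (‖f‖ ^ 2 + ‖g‖ ^ 2) := by
  obtain ⟨h1, h2⟩ := integrable_norm_sq_mul_exp' hc f
  obtain ⟨h3, h4⟩ := integrable_norm_sq_mul_exp hc g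
  have hD0 : 0 ≤ D := by
    have := (norm_nonneg _).trans (hD 0 0)
    simpa using this
  have hb : Integrable (fun p : ℝ × ℝ => D / 2 * (‖f p.1‖ ^ 2 * Real.exp (-(c * |p.1 - p.2|)) +
      ‖g p.2‖ ^ 2 * Real.exp (-(c * |p.1 - p.2|)))) (volume.prod volume) :=
    (h1.add h3).const_mul _
  have hm : AEStronglyMeasurable (fun p : ℝ × ℝ => conj (f p.1) * N p.1 p.2 * g p.2)
      (volume.prod volume) := by
    have m1 : AEStronglyMeasurable (fun p : ℝ × ℝ => f p.1) (volume.prod volume) :=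
      (Lp.aestronglyMeasurable f).comp_fst
    have m2 : AEStronglyMeasurable (fun p : ℝ × ℝ => g p.2) (volume.prod volume) :=
      (Lp.aestronglyMeasurable g).comp_snd
    exact ((Complex.continuous_conj.comp_aestronglyMeasurable m1).mul
      hN.aestronglyMeasurable).mul m2
  have hle : ∀ p : ℝ × ℝ, ‖conj (f p.1) * N p.1 p.2 * g p.2‖ ≤
      D / 2 * (‖f p.1‖ ^ 2 * Real.exp (-(c * |p.1 - p.2|)) +
      ‖g p.2‖ ^ 2 * Real.exp (-(c * |p.1 - p.2|))) := fun p => by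
    rw [norm_mul, norm_mul, RCLike.norm_conj]
    have e1 := hD p.1 p.2
    set E := Real.exp (-(c * |p.1 - p.2|))
    have hE : 0 ≤ E := Real.exp_nonneg _
    have e2 : 2 * (‖f p.1‖ * ‖g p.2‖) ≤ ‖f p.1‖ ^ 2 + ‖g p.2‖ ^ 2 := by
      nlinarith [sq_nonneg (‖f p.1‖ - ‖g p.2‖)]
    calc ‖f p.1‖ * ‖N p.1 p.2‖ * ‖g p.2‖ ≤ ‖f p.1‖ * (D * E) * ‖g p.2‖ := by gcongr
      _ = D * E / 2 * (2 * (‖f p.1‖ * ‖g p.2‖)) := by ring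
      _ ≤ D * E / 2 * (‖f p.1‖ ^ 2 + ‖g p.2‖ ^ 2) := by gcongr
      _ = _ := by ring
  refine ⟨hb.mono' hm (ae_of_all _ hle), ?_⟩
  refine (norm_integral_le_of_norm_le hb (ae_of_all _ hle)).trans (le_of_eq ?_)
  rw [integral_const_mul, integral_add h1 h3, h2, h4]
  ring

/-- A continuous kernel dominated by `e^{-c|x-y|}` defines a bounded operator. -/
theorem exists_hasIntegralKernel (hc : 0 < c) (hN : Continuous fun p : ℝ × ℝ => N p.1 p.2)
    (hD : ∀ x y, ‖N x y‖ ≤ D * Real.exp (-(c * |x - y|))) :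
    ∃ R : L2R →L[ℂ] L2R, HasIntegralKernel R N := by
  have hint := fun f g : L2R => (kernel_integrable hc hN hD f g).1
  let B : L2R →ₛₗ[starRingEnd ℂ] L2R →ₗ[ℂ] ℂ := LinearMap.mk₂'ₛₗ (starRingEnd ℂ) (RingHom.id ℂ)
    (fun f g => ∫ p : ℝ × ℝ, conj (f p.1) * N p.1 p.2 * g p.2 ∂(volume.prod volume))
    (fun f f' g => by
      rw [← integral_add (hint f g) (hint f' g)]
      refine integral_congr_ae ?_
      filter_upwards [Measure.quasiMeasurePreserving_fst.ae (Lp.coeFn_add f f')] with p hp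
      rw [hp, Pi.add_apply, map_add]
      ring)
    (fun a f g => by
      rw [smul_eq_mul, ← integral_const_mul]
      refine integral_congr_ae ?_
      filter_upwards [Measure.quasiMeasurePreserving_fst.ae (Lp.coeFn_smul a f)] with p hp
      rw [hp, Pi.smul_apply, smul_eq_mul, map_mul]
      ring)
    (fun f g g' => by
      rw [← integral_add (hint f g) (hint f g')]
      refine integral_congr_ae ?_
      filter_upwards [Measure.quasiMeasurePreserving_snd.ae (Lp.coeFn_add g g')] with p hp
      rw [hp, Pi.add_apply]
      ring)
    (fun a f g => by
      rw [RingHom.id_apply, smul_eq_mul, ← integral_const_mul]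
      refine integral_congr_ae ?_
      filter_upwards [Measure.quasiMeasurePreserving_snd.ae (Lp.coeFn_smul a g)] with p hp
      rw [hp, Pi.smul_apply, smul_eq_mul]
      ring)
  have hB : ∀ f g, ‖B f g‖ ≤ D * (∫ x, Real.exp (-(c * |x|))) * ‖f‖ * ‖g‖ := by
    intro f g
    by_cases hf : f = 0
    · simp [hf]
    by_cases hg : g = 0
    · simp [hg]
    have hf' := norm_pos_iff.2 hf
    have hg' := norm_pos_iff.2 hg
    -- Applied to unit vectors, the bound by a sum of squares becomes a bound by the product of
    -- norms.
    have h1 := (kernel_integrable hc hN hD (((‖f‖⁻¹ : ℝ) : ℂ) • f) (((‖g‖⁻¹ : ℝ) : ℂ) • g)).2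
    change ‖B (((‖f‖⁻¹ : ℝ) : ℂ) • f) (((‖g‖⁻¹ : ℝ) : ℂ) • g)‖ ≤ _ at h1
    have h0 : B (((‖f‖⁻¹ : ℝ) : ℂ) • f) (((‖g‖⁻¹ : ℝ) : ℂ) • g) =
        ((‖g‖⁻¹ : ℝ) : ℂ) * (((‖f‖⁻¹ : ℝ) : ℂ) * B f g) := by
      rw [map_smulₛₗ, map_smulₛₗ, LinearMap.smul_apply, Complex.conj_ofReal, smul_eq_mul,
        smul_eq_mul, RingHom.id_apply]
    rw [h0, norm_mul, norm_mul, norm_smul, norm_smul, Complex.norm_real, Complex.norm_real,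
      norm_inv, norm_inv, norm_norm, norm_norm, inv_mul_cancel₀ hf'.ne',
      inv_mul_cancel₀ hg'.ne'] at h1
    have h2 : ‖B f g‖ = ‖f‖ * ‖g‖ * (‖g‖⁻¹ * (‖f‖⁻¹ * ‖B f g‖)) := by field_simp
    rw [h2]
    calc _ ≤ ‖f‖ * ‖g‖ * (D * (∫ x, Real.exp (-(c * |x|))) / 2 * (1 ^ 2 + 1 ^ 2)) := by gcongr
      _ = _ := by ring
  let B' := B.mkContinuous₂ (D * ∫ x, Real.exp (-(c * |x|))) hB
  -- The Riesz operator `T` satisfies `⟪T f, g⟫ = B f g`, so the operator with kernel `N` is its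
  -- adjoint.
  refine ⟨(InnerProductSpace.continuousLinearMapOfBilin B').adjoint, fun f g => ⟨hint f g, ?_⟩⟩
  rw [ContinuousLinearMap.adjoint_inner_right,
    InnerProductSpace.continuousLinearMapOfBilin_apply]
  rfl

/-- Testing the weak formula against indicators of sets of finite measure determines `R g` almost
everywhere. -/
theorem HasIntegralKernel.ae_eq {R : L2R →L[ℂ] L2R} (hR : HasIntegralKernel R N) (g : L2R) :
    R g =ᵐ[volume] fun x => ∫ y, N x y * g y := by
  have key : ∀ s : Set ℝ, MeasurableSet s → volume s < ⊤ →
      IntegrableOn (fun x => ∫ y, N x y * g y) s ∧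
        ∫ x in s, R g x = ∫ x in s, ∫ y, N x y * g y := by
    intro s hs hμ
    obtain ⟨h1, h2⟩ := hR (indicatorConstLp 2 hs hμ.ne 1) g
    rw [L2.inner_indicatorConstLp_one, integral_prod _ h1] at h2
    have h3 : (fun x => ∫ y, conj ((indicatorConstLp 2 hs hμ.ne (1 : ℂ) : L2R) x) * N x y * g y)
        =ᵐ[volume] s.indicator fun x => ∫ y, N x y * g y := by
      filter_upwards [indicatorConstLp_coeFn (p := 2) (hs := hs) (hμs := hμ.ne) (c := (1 : ℂ))]
        with x hx
      rw [hx]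
      by_cases hxs : x ∈ s <;> simp [hxs]
    refine ⟨?_, ?_⟩
    · rw [← integrable_indicator_iff hs]
      exact h1.integral_prod_left.congr h3
    · rw [h2, ← integral_indicator hs]
      exact integral_congr_ae h3
  exact ae_eq_of_forall_setIntegral_eq_of_sigmaFinite
    (fun s _ hμ => integrableOn_Lp_of_measure_ne_top (R g) (by norm_num) hμ.ne) (fun s hs hμ => (key s hs hμ).1)
      (fun s hs hμ => (key s hs hμ).2)

end Kernel

/-! ## Green's functions -/

theorem MeasureTheory.LocallyIntegrable.continuous_mul_complex {u g : ℝ → ℂ} (hu : Continuous u)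
    (hg : LocallyIntegrable g) : LocallyIntegrable (fun x => u x * g x) := by
  refine locallyIntegrable_iff.2 fun K hK => ?_
  exact (hg.integrableOn_isCompact hK).continuousOn_mul hu.continuousOn hK

/-- Solutions `u`, `v` of `y'' = (V - z) y` with Wronskian one, bounded by `e^{h}` and `e^{-h}`
for a weight `h` whose increments are at least linear. -/
structure IsGreenPair (V : ℝ → ℂ) (z : ℂ) (u u' v v' : ℝ → ℂ) (C c : ℝ) (h : ℝ → ℝ) : Prop where
  hasDerivAt_u : ∀ x, HasDerivAt u (u' x) x
  hasDerivAt_u' : ∀ x, HasDerivAt u' ((V x - z) * u x) x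
  hasDerivAt_v : ∀ x, HasDerivAt v (v' x) x
  hasDerivAt_v' : ∀ x, HasDerivAt v' ((V x - z) * v x) x
  wronskian : ∀ x, u' x * v x - u x * v' x = 1
  norm_u_le : ∀ x, ‖u x‖ ≤ C * Real.exp (h x)
  norm_v_le : ∀ x, ‖v x‖ ≤ C * Real.exp (-h x)
  pos : 0 < c
  le_sub : ∀ x y, x ≤ y → c * (y - x) ≤ h y - h x

theorem integrableOn_mul_of_exp_bound {w : ℝ → ℂ} (hw : Continuous w) {s : Set ℝ}
    (hs : MeasurableSet s) {D c x : ℝ} (hc : 0 < c)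
    (hD : ∀ y ∈ s, ‖w y‖ ≤ D * Real.exp (-(c * |y - x|))) (g : L2R) :
    IntegrableOn (fun y => w y * g y) s := by
  have h1 := (Lp.memLp g).integrable_norm_sq
  have h2 := ((integrable_exp_neg_mul_abs hc).comp_sub_right x).const_mul (D ^ 2)
  refine Integrable.mono' ((h2.add h1).integrableOn (s := s))
    (hw.aestronglyMeasurable.mul (Lp.aestronglyMeasurable g)).restrict ?_
  rw [ae_restrict_iff' hs]
  refine ae_of_all _ fun y hy => ?_
  rw [norm_mul, Pi.add_apply]
  have e1 := hD y hy
  set E := Real.exp (-(c * |y - x|))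
  have hE0 : 0 ≤ E := Real.exp_nonneg _
  have hE1 : E ≤ 1 := Real.exp_le_one_iff.2 (by have := abs_nonneg (y - x); nlinarith)
  have e2 : ‖w y‖ ^ 2 ≤ D ^ 2 * E := by
    calc ‖w y‖ ^ 2 ≤ (D * E) ^ 2 := pow_le_pow_left₀ (norm_nonneg _) e1 2
      _ = D ^ 2 * (E * E) := by ring
      _ ≤ D ^ 2 * (E * 1) := by gcongr
      _ = _ := by ring
  nlinarith [sq_nonneg (‖w y‖ - ‖g y‖), sq_nonneg ‖w y‖, sq_nonneg ‖g y‖]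

namespace IsGreenPair

variable {V : ℝ → ℂ} {z : ℂ} {u u' v v' : ℝ → ℂ} {C c : ℝ} {h : ℝ → ℝ}

theorem continuous_u (H : IsGreenPair V z u u' v v' C c h) : Continuous u :=
  continuous_iff_continuousAt.2 fun x => (H.hasDerivAt_u x).continuousAt

theorem continuous_v (H : IsGreenPair V z u u' v v' C c h) : Continuous v :=
  continuous_iff_continuousAt.2 fun x => (H.hasDerivAt_v x).continuousAt

theorem continuous_u' (H : IsGreenPair V z u u' v v' C c h) : Continuous u' :=
  continuous_iff_continuousAt.2 fun x => (H.hasDerivAt_u' x).continuousAt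

theorem continuous_v' (H : IsGreenPair V z u u' v v' C c h) : Continuous v' :=
  continuous_iff_continuousAt.2 fun x => (H.hasDerivAt_v' x).continuousAt

theorem C_nonneg (H : IsGreenPair V z u u' v v' C c h) : 0 ≤ C := by
  have := (norm_nonneg _).trans (H.norm_u_le 0)
  exact nonneg_of_mul_nonneg_left this (Real.exp_pos _)

theorem norm_kernel_le (H : IsGreenPair V z u u' v v' C c h) (x y : ℝ) :
    ‖u (min x y) * v (max x y)‖ ≤ C ^ 2 * Real.exp (-(c * |x - y|)) := by
  have h1 := H.norm_u_le (min x y)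
  have h2 := H.norm_v_le (max x y)
  have h3 := H.le_sub (min x y) (max x y) min_le_max
  rw [max_sub_min_eq_abs] at h3
  have hC := H.C_nonneg
  rw [norm_mul]
  calc _ ≤ C * Real.exp (h (min x y)) * (C * Real.exp (-h (max x y))) := by gcongr
    _ = C ^ 2 * Real.exp (h (min x y) - h (max x y)) := by
      rw [sub_eq_add_neg, Real.exp_add]; ring
    _ ≤ _ := by
      gcongr
      rw [abs_sub_comm] at h3
      linarith

theorem integrableOn_u (H : IsGreenPair V z u u' v v' C c h) (g : L2R) (x : ℝ) :
    IntegrableOn (fun y => u y * g y) (Iic x) := by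
  refine integrableOn_mul_of_exp_bound H.continuous_u measurableSet_Iic H.pos (x := x)
    (D := C * Real.exp (h x)) (fun y hy => (H.norm_u_le y).trans ?_) g
  rw [mul_assoc, ← Real.exp_add]
  refine mul_le_mul_of_nonneg_left (Real.exp_le_exp.2 ?_) H.C_nonneg
  have := H.le_sub y x hy
  rw [abs_of_nonpos (sub_nonpos.2 hy)]
  linarith

theorem integrableOn_v (H : IsGreenPair V z u u' v v' C c h) (g : L2R) (x : ℝ) :
    IntegrableOn (fun y => v y * g y) (Ioi x) := by
  refine integrableOn_mul_of_exp_bound H.continuous_v measurableSet_Ioi H.pos (x := x)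
    (D := C * Real.exp (-h x)) (fun y hy => (H.norm_v_le y).trans ?_) g
  rw [mul_assoc, ← Real.exp_add]
  refine mul_le_mul_of_nonneg_left (Real.exp_le_exp.2 ?_) H.C_nonneg
  have := H.le_sub x y (le_of_lt hy)
  rw [abs_of_nonneg (sub_nonneg.2 (le_of_lt hy))]
  linarith

theorem integral_kernel (H : IsGreenPair V z u u' v v' C c h) (g : L2R) (x : ℝ) :
    ∫ y, u (min x y) * v (max x y) * g y =
      v x * (∫ y in Iic x, u y * g y) + u x * ∫ y in Ioi x, v y * g y := by
  have hu := H.continuous_u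
  have hv := H.continuous_v
  have hi : Integrable (fun y => u (min x y) * v (max x y) * g y) := by
    rw [← integrableOn_univ]
    refine integrableOn_mul_of_exp_bound (by fun_prop) MeasurableSet.univ H.pos (x := x)
      (D := C ^ 2) (fun y _ => ?_) g
    rw [abs_sub_comm]
    exact H.norm_kernel_le x y
  rw [← intervalIntegral.integral_Iic_add_Ioi (b := x) hi.integrableOn hi.integrableOn,
    ← integral_const_mul, ← integral_const_mul]
  congr 1
  · refine setIntegral_congr_fun measurableSet_Iic fun y hy => ?_
    simp only [min_eq_right (show y ≤ x from hy), max_eq_left (show y ≤ x from hy)]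
    ring
  · refine setIntegral_congr_fun measurableSet_Ioi fun y hy => ?_
    simp only [min_eq_left (le_of_lt hy : x ≤ y), max_eq_right (le_of_lt hy : x ≤ y)]
    ring

/-- Variation of constants. In the first derivative of `v ∫_{-∞}^x u g + u ∫_x^∞ v g` the terms with
`g x` cancel; in the second they combine to minus the Wronskian times `g`. -/
theorem mem_maxGraph (H : IsGreenPair V z u u' v v' C c h) (hVc : Continuous V) {R : L2R →L[ℂ] L2R}
    (hR : HasIntegralKernel R fun x y => u (min x y) * v (max x y)) (g : L2R) :
    (R g, g + z • R g) ∈ maxGraph V := by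
  have hg : LocallyIntegrable g := (Lp.memLp g).locallyIntegrable (by norm_num)
  have lu := hg.continuous_mul_complex H.continuous_u
  have lv := hg.continuous_mul_complex H.continuous_v
  have p1 : IsPrimitive (fun x => ∫ y in Iic x, u y * g y) (fun y => u y * g y) := by
    refine IsPrimitive.of_integral lu fun x => ?_
    rw [← intervalIntegral.integral_Iic_sub_Iic (H.integrableOn_u g 0) (H.integrableOn_u g x)]
    ring
  have p2 : IsPrimitive (fun x => ∫ y in Ioi x, v y * g y) (fun y => -(v y * g y)) := by
    refine IsPrimitive.of_integral lv.neg fun x => ?_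
    have h0 := intervalIntegral.integral_interval_add_Ioi' (a := 0) (b := x)
      (intervalIntegrable_iff.mpr <|
      (lv.integrableOn_isCompact isCompact_uIcc).mono_set uIoc_subset_uIcc)
      (H.integrableOn_v g x)
    rw [intervalIntegral.integral_neg, ← h0]
    ring
  have pu := IsPrimitive.of_hasDerivAt H.continuous_u' H.hasDerivAt_u
  have pv := IsPrimitive.of_hasDerivAt H.continuous_v' H.hasDerivAt_v
  have pu' : IsPrimitive u' (fun x => (V x - z) * u x) :=
    IsPrimitive.of_hasDerivAt ((hVc.sub continuous_const).mul H.continuous_u) H.hasDerivAt_u'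
  have pv' : IsPrimitive v' (fun x => (V x - z) * v x) :=
    IsPrimitive.of_hasDerivAt ((hVc.sub continuous_const).mul H.continuous_v) H.hasDerivAt_v'
  have q1 := (pv.mul p1).add (pu.mul p2)
  have q2 := (pv'.mul p1).add (pu'.mul p2)
  refine mem_maxGraph_of_isPrimitive (φ := fun x => v x * (∫ y in Iic x, u y * g y) +
    u x * ∫ y in Ioi x, v y * g y) (ψ := fun x => v' x * (∫ y in Iic x, u y * g y) +
    u' x * ∫ y in Ioi x, v y * g y) ?_ q2 ?_ ?_
  · have hc1 := p1.continuous
    have hc2 := p2.continuous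
    have hu' := H.continuous_u'
    have hv' := H.continuous_v'
    refine (q1.congr_ae (ae_of_all _ fun x => ?_)).hasDerivAt_of_continuous (by fun_prop)
    ring
  · filter_upwards [hR.ae_eq g] with x hx
    rw [hx, H.integral_kernel g x]
  · filter_upwards [hR.ae_eq g, Lp.coeFn_add g (z • R g), Lp.coeFn_smul z (R g)] with x hx h1 h2
    rw [h1, Pi.add_apply, h2, Pi.smul_apply, hx, H.integral_kernel g x, smul_eq_mul]
    linear_combination (-(g x)) * H.wronskian x

theorem exists_resolvent (H : IsGreenPair V z u u' v v' C c h) (hVc : Continuous V)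
    {l : ℂ} (hl : 0 < l.re)
    (hV : ∀ x, 0 ≤ (l * V x).re) : ∃ R : L2R →L[ℂ] L2R, IsResolventAt (maxOp V) z R ∧
      HasIntegralKernel R fun x y => u (min x y) * v (max x y) := by
  have hu := H.continuous_u
  have hv := H.continuous_v
  obtain ⟨R, hR⟩ := exists_hasIntegralKernel (N := fun x y => u (min x y) * v (max x y))
    H.pos (by fun_prop) H.norm_kernel_le
  exact ⟨R, isResolventAt_of_mem_maxGraph hl hV (H.mem_maxGraph hVc hR), hR⟩

end IsGreenPair

/-! ## The modified Bessel function -/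

/-- The entire function `∑ₙ wⁿ / (n! Γ(m+1+n))`. -/
noncomputable def besselG (m w : ℂ) : ℂ :=
  ∑' n : ℕ, w ^ n / ((n.factorial : ℂ) * Complex.Gamma (m + 1 + n))

theorem besselI_eq (m r : ℂ) : besselI m r = (r / 2) ^ m * besselG m (r ^ 2 / 4) := rfl

theorem inv_Gamma_add_nat_succ (m : ℂ) (n : ℕ) : (Complex.Gamma (m + 1 + n))⁻¹ =
    (m + 1 + n) * (Complex.Gamma (m + 1 + (n + 1 : ℕ)))⁻¹ := by
  have := Complex.one_div_Gamma_eq_self_mul_one_div_Gamma_add_one (m + 1 + n)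
  rw [this]
  push_cast
  rw [add_assoc (m + 1) (n : ℂ) 1]

/-- Once `‖m + 1 + n‖ ≥ 1` the recurrence makes `‖1 / Γ‖` non-increasing in `n`, so finitely many
values bound all of them. -/
theorem exists_bound_inv_Gamma (m : ℂ) :
    ∃ B, ∀ n : ℕ, ‖(Complex.Gamma (m + 1 + n))⁻¹‖ ≤ B := by
  obtain ⟨n₀, hn₀⟩ := exists_nat_ge (‖m + 1‖ + 1)
  have hstep : ∀ n, n₀ ≤ n → ‖(Complex.Gamma (m + 1 + (n + 1 : ℕ)))⁻¹‖ ≤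
      ‖(Complex.Gamma (m + 1 + n))⁻¹‖ := by
    intro n hn
    rw [inv_Gamma_add_nat_succ m n, norm_mul]
    refine le_mul_of_one_le_left (norm_nonneg _) ?_
    have h1 : (n : ℝ) ≤ ‖m + 1 + n‖ + ‖m + 1‖ := by
      have := norm_sub_le (m + 1 + n) (m + 1)
      simpa using this
    have h2 : (n₀ : ℝ) ≤ n := by exact_mod_cast hn
    linarith
  refine ⟨∑ i ∈ Finset.range (n₀ + 1), ‖(Complex.Gamma (m + 1 + i))⁻¹‖, fun n => ?_⟩
  have hle : ∀ i ≤ n₀, ‖(Complex.Gamma (m + 1 + i))⁻¹‖ ≤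
      ∑ i ∈ Finset.range (n₀ + 1), ‖(Complex.Gamma (m + 1 + i))⁻¹‖ := fun i hi =>
    Finset.single_le_sum (f := fun i : ℕ => ‖(Complex.Gamma (m + 1 + i))⁻¹‖)
      (fun _ _ => norm_nonneg _) (Finset.mem_range.2 (by omega))
  rcases le_total n n₀ with hn | hn
  · exact hle n hn
  · induction n, hn using Nat.le_induction with
    | base => exact hle n₀ le_rfl
    | succ n hn ih => exact (hstep n hn).trans ih

theorem besselG_term_eq (m w : ℂ) (n : ℕ) :
    w ^ n / ((n.factorial : ℂ) * Complex.Gamma (m + 1 + n)) =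
      w ^ n / n.factorial * (Complex.Gamma (m + 1 + n))⁻¹ := by
  rw [div_mul_eq_div_div, div_eq_mul_inv _ (Complex.Gamma _)]

theorem besselG_term_bound (m : ℂ) : ∃ B, ∀ (w : ℂ) (R : ℝ), ‖w‖ ≤ R → ∀ n : ℕ,
    ‖w ^ n / ((n.factorial : ℂ) * Complex.Gamma (m + 1 + n))‖ ≤ B * (R ^ n / n.factorial) := by
  obtain ⟨B, hB⟩ := exists_bound_inv_Gamma m
  have hB0 : 0 ≤ B := (norm_nonneg _).trans (hB 0)
  refine ⟨B, fun w R hw n => ?_⟩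
  rw [besselG_term_eq, norm_mul, norm_div, norm_pow, Complex.norm_natCast, mul_comm]
  have := hB n
  gcongr

theorem besselG_summable (m w : ℂ) :
    Summable fun n : ℕ => w ^ n / ((n.factorial : ℂ) * Complex.Gamma (m + 1 + n)) := by
  obtain ⟨B, hB⟩ := besselG_term_bound m
  exact Summable.of_norm_bounded ((Real.summable_pow_div_factorial ‖w‖).mul_left B)
    (hB w ‖w‖ le_rfl)

theorem hasDerivAt_besselG (m w : ℂ) : HasDerivAt (besselG m) (besselG (m + 1) w) w := by
  obtain ⟨B, hB⟩ := besselG_term_bound m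
  set R := ‖w‖ + 1
  have hU : IsOpen (Metric.ball (0 : ℂ) R) := Metric.isOpen_ball
  have hw : w ∈ Metric.ball (0 : ℂ) R := by simp [R]
  have hu : Summable fun n : ℕ => B * (R ^ n / n.factorial) :=
    (Real.summable_pow_div_factorial R).mul_left B
  have hd : ∀ n : ℕ, DifferentiableOn ℂ
      (fun w : ℂ => w ^ n / ((n.factorial : ℂ) * Complex.Gamma (m + 1 + n)))
      (Metric.ball (0 : ℂ) R) := fun n => by fun_prop
  have hle : ∀ (n : ℕ) (w : ℂ), w ∈ Metric.ball (0 : ℂ) R →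
      ‖w ^ n / ((n.factorial : ℂ) * Complex.Gamma (m + 1 + n))‖ ≤ B * (R ^ n / n.factorial) :=
    fun n w hw => hB w R (by simpa using (mem_ball_zero_iff.1 hw).le) n
  have h1 := Complex.hasSum_deriv_of_summable_norm hu hd hU hle hw
  have h2 := Complex.differentiableOn_tsum_of_summable_norm hu hd hU hle
  have h3 := (h2.differentiableAt (hU.mem_nhds hw)).hasDerivAt
  have h4 : ∀ n : ℕ, deriv (fun w : ℂ => w ^ n / ((n.factorial : ℂ) *
      Complex.Gamma (m + 1 + n))) w = n * w ^ (n - 1) / ((n.factorial : ℂ) *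
      Complex.Gamma (m + 1 + n)) := fun n => by simp
  simp only [h4] at h1
  have h5 : deriv (fun w : ℂ => ∑' n : ℕ, w ^ n / ((n.factorial : ℂ) *
      Complex.Gamma (m + 1 + n))) w = besselG (m + 1) w := by
    rw [← h1.tsum_eq, h1.summable.tsum_eq_zero_add, besselG]
    simp only [Nat.cast_zero, zero_mul, zero_div, zero_add]
    refine tsum_congr fun n => ?_
    rw [Nat.factorial_succ, Nat.add_sub_cancel]
    have h6 : m + 1 + ((n + 1 : ℕ) : ℂ) = m + 1 + 1 + n := by push_cast; ring
    rw [h6]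
    push_cast
    have h7 : (n : ℂ) + 1 ≠ 0 := by exact_mod_cast Nat.succ_ne_zero n
    rw [mul_assoc, mul_div_mul_left _ _ h7]
  rw [← h5]
  exact h3

theorem continuous_besselG (m : ℂ) : Continuous (besselG m) :=
  continuous_iff_continuousAt.2 fun w => (hasDerivAt_besselG m w).continuousAt

theorem besselG_zero (m : ℂ) : besselG m 0 = (Complex.Gamma (m + 1))⁻¹ := by
  rw [besselG, tsum_eq_single 0 fun n hn => by simp [hn]]
  simp

/-- Coefficientwise this is `1/Γ(m+1+n) = (m+1+n)/Γ(m+2+n)`: the summand `m + 1` gives the first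
term, and `n` shifts the index and gives the second. It encodes the modified Bessel equation. -/
theorem besselG_recurrence (m w : ℂ) :
    besselG m w = (m + 1) * besselG (m + 1) w + w * besselG (m + 2) w := by
  have s1 := (besselG_summable (m + 1) w).mul_left (m + 1)
  have s2 : HasSum (fun n : ℕ => n * (w ^ n / ((n.factorial : ℂ) *
      Complex.Gamma (m + 1 + 1 + n)))) (w * besselG (m + 2) w) := by
    have h1 := ((besselG_summable (m + 2) w).mul_left w).hasSum
    rw [tsum_mul_left] at h1
    refine (hasSum_nat_add_iff' 1).1 ?_
    simp only [Finset.range_one, Finset.sum_singleton, Nat.cast_zero, zero_mul, sub_zero]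
    refine h1.congr_fun fun n => ?_
    rw [Nat.factorial_succ]
    have h6 : m + 1 + 1 + ((n + 1 : ℕ) : ℂ) = m + 2 + 1 + n := by push_cast; ring
    rw [h6]
    push_cast
    have h7 : (n : ℂ) + 1 ≠ 0 := by exact_mod_cast Nat.succ_ne_zero n
    rw [mul_assoc ((n : ℂ) + 1), ← mul_div_assoc, ← mul_div_assoc, mul_div_mul_left _ _ h7, pow_succ]
    ring
  have h3 := (s1.hasSum.add s2).tsum_eq
  rw [tsum_mul_left] at h3
  rw [besselG, show besselG (m + 1) w = ∑' n : ℕ, w ^ n / ((n.factorial : ℂ) *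
    Complex.Gamma (m + 1 + 1 + n)) from rfl, ← h3]
  refine tsum_congr fun n => ?_
  rw [besselG_term_eq, besselG_term_eq, inv_Gamma_add_nat_succ]
  have h6 : m + 1 + ((n + 1 : ℕ) : ℂ) = m + 1 + 1 + n := by push_cast; ring
  rw [h6]
  ring

/-- By the recurrences the left side has derivative zero in `w`; at `w = 0` it is evaluated by the
reflection formula for `Γ`. Using the entire functions `besselG` keeps the origin accessible. -/
theorem besselG_wronskian {m : ℂ} (hm : m ≠ 0) (w : ℂ) :
    -2 * m * (besselG m w * besselG (-m) w) + 2 * w * (besselG m w * besselG (-m + 1) w -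
      besselG (m + 1) w * besselG (-m) w) = -2 * Complex.sin (Real.pi * m) / Real.pi := by
  set P : ℂ → ℂ := fun w => -2 * m * (besselG m w * besselG (-m) w) +
    2 * w * (besselG m w * besselG (-m + 1) w - besselG (m + 1) w * besselG (-m) w) with hP
  have hd : ∀ w, HasDerivAt P 0 w := by
    intro w
    have d1 := hasDerivAt_besselG m w
    have d2 := hasDerivAt_besselG (-m) w
    have d3 := hasDerivAt_besselG (-m + 1) w
    have d4 := hasDerivAt_besselG (m + 1) w
    have r1 := besselG_recurrence m w
    have r2 := besselG_recurrence (-m) w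
    rw [show -m + 1 + 1 = -m + 2 by ring] at d3
    rw [show m + 1 + 1 = m + 2 by ring] at d4
    have h := ((d1.mul d2).const_mul (-2 * m)).add
      (((hasDerivAt_id w).const_mul 2).mul ((d1.mul d3).sub (d4.mul d2)))
    refine h.congr_deriv ?_
    simp only [Pi.mul_apply, Pi.sub_apply, id]
    linear_combination (-2 * besselG m w) * r2 + 2 * besselG (-m) w * r1
  have h0 : P w = P 0 := is_const_of_deriv_eq_zero (fun w => (hd w).differentiableAt)
    (fun w => (hd w).deriv) w 0
  change P w = _
  rw [h0, hP]
  simp only [besselG_zero, mul_zero, zero_mul, add_zero]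
  have h1 := Complex.Gamma_mul_Gamma_one_sub m
  rw [Complex.Gamma_add_one m hm, show -m + 1 = 1 - m by ring, mul_inv]
  have h2 : (Complex.Gamma m)⁻¹ * (Complex.Gamma (1 - m))⁻¹ =
      Complex.sin (Real.pi * m) / Real.pi := by
    rw [← mul_inv, h1, inv_div]
  have h3 : m * m⁻¹ = 1 := mul_inv_cancel₀ hm
  linear_combination (-2 : ℂ) * h2 - 2 * (Complex.Gamma m)⁻¹ * (Complex.Gamma (1 - m))⁻¹ * h3

/-! ### The modified Bessel function in exponential coordinates -/

/-- A positive factor does not disturb the principal branch: `log (k e^x / 2) = x + log (k / 2)`. -/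
theorem half_cpow_eq {k : ℂ} (hk : 0 < k.re) (m : ℂ) (x : ℝ) :
    (k * Real.exp x / 2) ^ m = Complex.exp (m * x) * (k / 2) ^ m := by
  have hk0 : k / 2 ≠ 0 := by
    intro h
    have : k = 0 := by simpa using h
    simp [this] at hk
  have h1 : k * Real.exp x / 2 = k / 2 * Real.exp x := by ring
  have h2 : k / 2 * Real.exp x ≠ 0 :=
    mul_ne_zero hk0 (by exact_mod_cast (Real.exp_pos x).ne')
  rw [h1, Complex.cpow_def_of_ne_zero h2, Complex.cpow_def_of_ne_zero hk0,
    Complex.log_mul_ofReal _ (Real.exp_pos x) _ hk0, Real.log_exp, ← Complex.exp_add]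
  ring_nf

theorem half_mul_exp_ne_zero {k : ℂ} (hk : 0 < k.re) (x : ℝ) : k * Real.exp x / 2 ≠ 0 := by
  have h1 : k ≠ 0 := by rintro rfl; simp at hk
  have h2 : (Real.exp x : ℂ) ≠ 0 := by exact_mod_cast (Real.exp_pos x).ne'
  exact div_ne_zero (mul_ne_zero h1 h2) two_ne_zero

theorem half_cpow_add_one {k : ℂ} (hk : 0 < k.re) (m : ℂ) (x : ℝ) :
    (k * Real.exp x / 2) ^ (m + 1) = (k * Real.exp x / 2) ^ m * (k * Real.exp x / 2) := by
  rw [Complex.cpow_add _ _ (half_mul_exp_ne_zero hk x), Complex.cpow_one]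

theorem hasDerivAt_ofReal_exp (x : ℝ) :
    HasDerivAt (fun x : ℝ => (Real.exp x : ℂ)) (Real.exp x) x :=
  (Real.hasDerivAt_exp x).ofReal_comp

theorem hasDerivAt_besselI_exp {k : ℂ} (hk : 0 < k.re) (m : ℂ) (x : ℝ) :
    HasDerivAt (fun x : ℝ => besselI m (k * Real.exp x))
      (m * besselI m (k * Real.exp x) + k * Real.exp x * besselI (m + 1) (k * Real.exp x)) x := by
  have h1 : HasDerivAt (fun x : ℝ => (k * Real.exp x / 2) ^ m)
      (m * (k * Real.exp x / 2) ^ m) x := by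
    simp only [half_cpow_eq hk]
    have h2 : HasDerivAt (fun x : ℝ => m * (x : ℂ)) m x := by
      simpa using (Complex.ofRealCLM.hasDerivAt (x := x)).const_mul m
    refine (h2.cexp.mul_const ((k / 2) ^ m)).congr_deriv ?_
    ring
  have h2 : HasDerivAt (fun x : ℝ => (k * Real.exp x) ^ 2 / 4)
      (2 * (k * Real.exp x) * (k * Real.exp x) / 4) x := by
    simpa using! ((((hasDerivAt_ofReal_exp x).const_mul k).pow 2).div_const 4)
  have h3 := (hasDerivAt_besselG m ((k * Real.exp x) ^ 2 / 4)).comp x h2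
  refine (h1.mul h3).congr_deriv ?_
  simp only [besselI_eq, half_cpow_add_one hk, Function.comp]
  ring

theorem hasDerivAt_besselI_exp_succ {k : ℂ} (hk : 0 < k.re) (m : ℂ) (x : ℝ) :
    HasDerivAt (fun x : ℝ => besselI (m + 1) (k * Real.exp x))
      (-(m + 1) * besselI (m + 1) (k * Real.exp x) +
        k * Real.exp x * besselI m (k * Real.exp x)) x := by
  refine (hasDerivAt_besselI_exp hk (m + 1) x).congr_deriv ?_
  simp only [besselI_eq, half_cpow_add_one hk]
  have := besselG_recurrence m ((k * Real.exp x) ^ 2 / 4)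
  rw [show m + 1 + 1 = m + 2 by ring]
  linear_combination -2 * ((k * Real.exp x / 2) ^ m * (k * Real.exp x / 2)) * this

/-- The Wronskian of `I_m` and `I_{-m}`. -/
theorem besselI_wronskian {k : ℂ} (hk : 0 < k.re) {m : ℂ} (hm : m ≠ 0) (x : ℝ) :
    besselI m (k * Real.exp x) * (-m * besselI (-m) (k * Real.exp x) +
      k * Real.exp x * besselI (-m + 1) (k * Real.exp x)) -
    (m * besselI m (k * Real.exp x) + k * Real.exp x * besselI (m + 1) (k * Real.exp x)) *
      besselI (-m) (k * Real.exp x) = -2 * Complex.sin (Real.pi * m) / Real.pi := by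
  rw [← besselG_wronskian hm ((k * Real.exp x) ^ 2 / 4)]
  have h0 := half_mul_exp_ne_zero hk x
  have h1 : (k * Real.exp x / 2) ^ m * (k * Real.exp x / 2) ^ (-m) = 1 := by
    rw [← Complex.cpow_add _ _ h0, add_neg_cancel, Complex.cpow_zero]
  simp only [besselI_eq, half_cpow_add_one hk]
  set A := (k * Real.exp x / 2) ^ m
  set B := (k * Real.exp x / 2) ^ (-m)
  set z := k * Real.exp x
  linear_combination (-2 * m * (besselG m (z ^ 2 / 4) * besselG (-m) (z ^ 2 / 4)) +
    2 * (z ^ 2 / 4) * (besselG m (z ^ 2 / 4) * besselG (-m + 1) (z ^ 2 / 4) -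
      besselG (m + 1) (z ^ 2 / 4) * besselG (-m) (z ^ 2 / 4))) * h1

/-! ### Growth of `I_m(k e^x)` as `x → ±∞` -/

theorem hasDerivAt_norm_sq {F : ℝ → ℂ} {d : ℂ} {x : ℝ} (h : HasDerivAt F d x) :
    HasDerivAt (fun x => ‖F x‖ ^ 2) (2 * (conj (F x) * d).re) x := by
  have h1 := (h.complex_re.mul h.complex_re).add (h.complex_im.mul h.complex_im)
  have h2 : (fun x => ‖F x‖ ^ 2) = fun x => (F x).re * (F x).re + (F x).im * (F x).im := by
    funext x
    rw [← Complex.normSq_eq_norm_sq, Complex.normSq_apply]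
  rw [h2]
  refine h1.congr_deriv ?_
  simp only [Complex.mul_re, Complex.conj_re, Complex.conj_im]
  ring

/-- A Gronwall argument for the first-order system satisfied by `A = I_m` and `B = I_{m+1}`. With `S
= |A|² + |B|²` and `e = e^x`, one has `S' = (2 Re k e - 1) S - 2 Re k e |A - B|² + (1 + 2 Re m)(|A|²
- |B|²)`. -/
theorem besselI_exp_bound_pos {k : ℂ} (hk : 0 < k.re) (m : ℂ) :
    ∃ C, ∀ x : ℝ, 0 ≤ x → ‖besselI m (k * Real.exp x)‖ ≤ C * Real.exp (k.re * Real.exp x) := by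
  set A : ℝ → ℂ := fun x => besselI m (k * Real.exp x) with hA
  set B : ℝ → ℂ := fun x => besselI (m + 1) (k * Real.exp x) with hB
  have hA' : ∀ x, HasDerivAt A (m * A x + k * Real.exp x * B x) x := hasDerivAt_besselI_exp hk m
  have hB' : ∀ x, HasDerivAt B (-(m + 1) * B x + k * Real.exp x * A x) x :=
    hasDerivAt_besselI_exp_succ hk m
  set M := (1 + 2 * m.re) ^ 2 / (4 * k.re) with hM
  have hM0 : 0 ≤ M := by positivity
  set S : ℝ → ℝ := fun x => ‖A x‖ ^ 2 + ‖B x‖ ^ 2 with hS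
  -- The first two summands integrate the factor `1 - 2 Re k e^x` of `S`; the last pays for the
  -- remainder `M e^{-x} S` of Young's inequality.
  set w : ℝ → ℝ := fun x => x - 2 * k.re * Real.exp x + M * Real.exp (-x) with hw
  set E : ℝ → ℝ := fun x => Real.exp (w x) * S x with hE
  have hw' : ∀ x, HasDerivAt w (1 - 2 * k.re * Real.exp x - M * Real.exp (-x)) x := fun x => by
    have h1 := ((hasDerivAt_id x).sub ((Real.hasDerivAt_exp x).const_mul (2 * k.re))).add
      ((hasDerivAt_neg x).exp.const_mul M)
    refine h1.congr_deriv ?_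
    ring
  have hE' := fun x => (hw' x).exp.mul ((hasDerivAt_norm_sq (hA' x)).add
    (hasDerivAt_norm_sq (hB' x)))
  have hanti : Antitone E := by
    refine antitone_of_hasDerivAt_nonpos (f' := _) hE' fun x => ?_
    have he := Real.exp_pos x
    have hee : Real.exp (-x) * Real.exp x = 1 := by rw [← Real.exp_add]; simp
    set e := Real.exp x
    have key : (1 - 2 * k.re * e - M * Real.exp (-x)) * (‖A x‖ ^ 2 + ‖B x‖ ^ 2) +
        (2 * (conj (A x) * (m * A x + k * e * B x)).re +
        2 * (conj (B x) * (-(m + 1) * B x + k * e * A x)).re) ≤ 0 := by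
      have n1 : ‖A x‖ ^ 2 = (A x).re ^ 2 + (A x).im ^ 2 := by
        rw [← Complex.normSq_eq_norm_sq, Complex.normSq_apply]; ring
      have n2 : ‖B x‖ ^ 2 = (B x).re ^ 2 + (B x).im ^ 2 := by
        rw [← Complex.normSq_eq_norm_sq, Complex.normSq_apply]; ring
      rw [n1, n2]
      set a := (A x).re
      set a' := (A x).im
      set b := (B x).re
      set b' := (B x).im
      have h1 : (2 * (conj (A x) * (m * A x + k * e * B x)).re +
        2 * (conj (B x) * (-(m + 1) * B x + k * e * A x)).re) =
        2 * m.re * (a ^ 2 + a' ^ 2) - 2 * (m.re + 1) * (b ^ 2 + b' ^ 2) +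
          4 * k.re * e * (a * b + a' * b') := by
        simp only [Complex.mul_re, Complex.mul_im, Complex.add_re, Complex.add_im,
          Complex.conj_re, Complex.conj_im, Complex.ofReal_re, Complex.ofReal_im, Complex.neg_re,
          Complex.neg_im, Complex.one_re, Complex.one_im]
        ring
      rw [h1]
      have hMe : M * Real.exp (-x) = (1 + 2 * m.re) ^ 2 / (4 * k.re * e) := by
        rw [hM, Real.exp_neg]
        field_simp
        try rfl
      rw [hMe]
      -- Used with `s` and `t` the components of `A - B` and `A + B`: the term in `s²` is
      -- compensated by `-2 Re k e |A - B|²`.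
      have h2 : ∀ s t : ℝ, (1 + 2 * m.re) * (s * t) ≤ 2 * k.re * e * s ^ 2 +
          (1 + 2 * m.re) ^ 2 / (4 * k.re * e) * (t ^ 2 / 2) := fun s t => by
        have h4 : 0 ≤ (4 * k.re * e * s - (1 + 2 * m.re) * t) ^ 2 / (8 * (k.re * e)) := by
          positivity
        have h5 : (4 * k.re * e * s - (1 + 2 * m.re) * t) ^ 2 / (8 * (k.re * e)) =
          2 * k.re * e * s ^ 2 + (1 + 2 * m.re) ^ 2 / (4 * k.re * e) * (t ^ 2 / 2) -
            (1 + 2 * m.re) * (s * t) := by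
          field_simp
          ring
        linarith
      have e1 := h2 (a - b) (a + b)
      have e2 := h2 (a' - b') (a' + b')
      have hq : 0 ≤ (1 + 2 * m.re) ^ 2 / (4 * k.re * e) := by positivity
      set q := (1 + 2 * m.re) ^ 2 / (4 * k.re * e)
      have e3 := mul_nonneg hq (sq_nonneg (a - b))
      have e4 := mul_nonneg hq (sq_nonneg (a' - b'))
      linarith
    have hp := Real.exp_pos (w x)
    have := mul_nonpos_of_nonneg_of_nonpos hp.le key
    refine le_trans (le_of_eq ?_) this
    simp only [Pi.add_apply]
    ring
  refine ⟨Real.sqrt (E 0), fun x hx => ?_⟩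
  have h1 : E x ≤ E 0 := hanti hx
  have h2 : Real.exp (-(2 * (k.re * Real.exp x))) * ‖A x‖ ^ 2 ≤ E 0 := by
    refine le_trans ?_ h1
    have h3 : -(2 * (k.re * Real.exp x)) ≤ w x := by
      have := mul_nonneg hM0 (Real.exp_pos (-x)).le
      simp only [hw]
      linarith
    have h4 : ‖A x‖ ^ 2 ≤ S x := le_add_of_nonneg_right (by positivity)
    simp only [hE]
    gcongr
  have h5 : ‖A x‖ ^ 2 ≤ E 0 * Real.exp (k.re * Real.exp x) ^ 2 := by
    rw [← Real.exp_nat_mul]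
    rw [Real.exp_neg, inv_mul_le_iff₀ (Real.exp_pos _)] at h2
    push_cast
    linarith
  have h6 := Real.sqrt_le_sqrt h5
  rw [Real.sqrt_sq (norm_nonneg _), Real.sqrt_mul' _ (sq_nonneg _),
    Real.sqrt_sq (Real.exp_pos _).le] at h6
  exact h6

theorem besselI_exp_bound_neg {k : ℂ} (hk : 0 < k.re) (m : ℂ) :
    ∃ C, ∀ x : ℝ, x ≤ 0 → ‖besselI m (k * Real.exp x)‖ ≤ C * Real.exp (m.re * x) := by
  obtain ⟨M, hM⟩ := (isCompact_closedBall (0 : ℂ) (‖k‖ ^ 2)).exists_bound_of_continuousOn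
    (continuous_besselG m).continuousOn
  refine ⟨‖(k / 2) ^ m‖ * M, fun x hx => ?_⟩
  rw [besselI_eq, half_cpow_eq hk, norm_mul, norm_mul, Complex.norm_exp]
  have h1 : ‖besselG m ((k * Real.exp x) ^ 2 / 4)‖ ≤ M := by
    refine hM _ ?_
    rw [mem_closedBall_zero_iff, norm_div, norm_pow, norm_mul, Complex.norm_real,
      Real.norm_of_nonneg (Real.exp_pos x).le, Complex.norm_ofNat, mul_pow]
    have : Real.exp x ^ 2 ≤ 1 := pow_le_one₀ (Real.exp_pos x).le (Real.exp_le_one_iff.2 hx)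
    have h2 : 0 ≤ ‖k‖ ^ 2 := by positivity
    nlinarith
  have h2 : (m * (x : ℂ)).re = m.re * x := by simp
  rw [h2]
  have := Real.exp_pos (m.re * x)
  calc _ ≤ Real.exp (m.re * x) * ‖(k / 2) ^ m‖ * M := by gcongr
    _ = _ := by ring

/-! ## The integral representation of the Macdonald function -/

/-- Since `cosh t ≥ t² / 4`, a Gaussian dominates. -/
theorem integrable_exp_neg_cosh {δ : ℝ} (hδ : 0 < δ) (b : ℝ) :
    Integrable fun t : ℝ => Real.exp (-(δ * Real.cosh t) + b * t) := by
  have h1 : Integrable fun t : ℝ => Real.exp (-(δ / 4) * t ^ 2 + b * t) := by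
    have h := (integrable_cexp_quadratic (b := ((δ / 4 : ℝ) : ℂ)) (by simpa using hδ)
      (b : ℂ) 0).norm
    refine h.congr (ae_of_all _ fun t => ?_)
    simp only [Complex.norm_exp]
    congr 1
    rw [show -((δ / 4 : ℝ) : ℂ) * (t : ℂ) ^ 2 + b * t + 0 =
      ((-(δ / 4) * t ^ 2 + b * t : ℝ) : ℂ) by push_cast; ring, Complex.ofReal_re]
  refine h1.mono' (by fun_prop) (ae_of_all _ fun t => ?_)
  rw [Real.norm_of_nonneg (Real.exp_pos _).le]
  refine Real.exp_le_exp.2 ?_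
  have h2 : t ^ 2 / 4 ≤ Real.cosh t := by
    rw [← Real.cosh_abs, Real.cosh_eq]
    have h3 := Real.quadratic_le_exp_of_nonneg (abs_nonneg t)
    rw [sq_abs] at h3
    have h4 := abs_nonneg t
    have h5 := Real.exp_pos (-|t|)
    linarith
  nlinarith

theorem integrable_exp_neg_cosh_abs {δ : ℝ} (hδ : 0 < δ) (b : ℝ) :
    Integrable fun t : ℝ => Real.exp (-(δ * Real.cosh t) + b * |t|) := by
  refine ((integrable_exp_neg_cosh hδ b).add (integrable_exp_neg_cosh hδ (-b))).mono'
    (by fun_prop) (ae_of_all _ fun t => ?_)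
  rw [Real.norm_of_nonneg (Real.exp_pos _).le, Pi.add_apply]
  rcases abs_cases t with ⟨h, -⟩ | ⟨h, -⟩ <;> rw [h]
  · exact le_add_of_nonneg_right (Real.exp_pos _).le
  · rw [show b * -t = -b * t by ring]
    exact le_add_of_nonneg_left (Real.exp_pos _).le

/-- The integrand `e^{-z cosh t - m t}`. -/
noncomputable def macdonaldIntegrand (m z : ℂ) (t : ℝ) : ℂ :=
  Complex.exp (-(z * Real.cosh t) - m * t)

/-- The integral `½ ∫ e^{-z cosh t - m t} dt`. -/
noncomputable def macdonald (m z : ℂ) : ℂ := 1 / 2 * ∫ t : ℝ, macdonaldIntegrand m z t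

theorem norm_macdonaldIntegrand (m z : ℂ) (t : ℝ) :
    ‖macdonaldIntegrand m z t‖ = Real.exp (-(z.re * Real.cosh t) + -m.re * t) := by
  rw [macdonaldIntegrand, Complex.norm_exp]
  congr 1
  simp only [Complex.sub_re, Complex.neg_re, Complex.re_mul_ofReal]
  ring

theorem continuous_macdonaldIntegrand (m z : ℂ) : Continuous (macdonaldIntegrand m z) := by
  unfold macdonaldIntegrand
  have := Real.continuous_cosh
  fun_prop

theorem integrable_macdonaldIntegrand (m : ℂ) {z : ℂ} (hz : 0 < z.re) :
    Integrable (macdonaldIntegrand m z) := by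
  refine (integrable_exp_neg_cosh hz (-m.re)).mono'
    (continuous_macdonaldIntegrand m z).aestronglyMeasurable (ae_of_all _ fun t => ?_)
  rw [norm_macdonaldIntegrand]

theorem macdonald_neg (m z : ℂ) : macdonald (-m) z = macdonald m z := by
  rw [macdonald, macdonald, ← integral_neg_eq_self]
  congr 2
  funext t
  simp [macdonaldIntegrand]

theorem macdonaldIntegrand_add_one (m z : ℂ) (t : ℝ) :
    macdonaldIntegrand (m + 1) z t = Complex.exp (-t) * macdonaldIntegrand m z t := by
  rw [macdonaldIntegrand, macdonaldIntegrand, ← Complex.exp_add]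
  congr 1
  ring

theorem macdonaldIntegrand_sub_one (m z : ℂ) (t : ℝ) :
    macdonaldIntegrand (m - 1) z t = Complex.exp t * macdonaldIntegrand m z t := by
  rw [macdonaldIntegrand, macdonaldIntegrand, ← Complex.exp_add]
  congr 1
  ring

theorem cosh_mul_macdonaldIntegrand (m z : ℂ) (t : ℝ) :
    Real.cosh t * macdonaldIntegrand m z t =
      1 / 2 * (macdonaldIntegrand (m + 1) z t + macdonaldIntegrand (m - 1) z t) := by
  rw [macdonaldIntegrand_add_one, macdonaldIntegrand_sub_one, Complex.ofReal_cosh, Complex.cosh]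
  ring

theorem sinh_mul_macdonaldIntegrand (m z : ℂ) (t : ℝ) :
    Real.sinh t * macdonaldIntegrand m z t =
      1 / 2 * (macdonaldIntegrand (m - 1) z t - macdonaldIntegrand (m + 1) z t) := by
  rw [macdonaldIntegrand_add_one, macdonaldIntegrand_sub_one, Complex.ofReal_sinh, Complex.sinh]
  ring

/-- The integral over `ℝ` of the `t`-derivative of the integrand vanishes. -/
theorem macdonald_recurrence (m : ℂ) {z : ℂ} (hz : 0 < z.re) :
    z * (macdonald (m + 1) z - macdonald (m - 1) z) = 2 * m * macdonald m z := by
  have i0 := integrable_macdonaldIntegrand m hz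
  have i1 := integrable_macdonaldIntegrand (m + 1) hz
  have i2 := integrable_macdonaldIntegrand (m - 1) hz
  have hd : ∀ t, HasDerivAt (macdonaldIntegrand m z)
      (z / 2 * (macdonaldIntegrand (m + 1) z t - macdonaldIntegrand (m - 1) z t)
        - m * macdonaldIntegrand m z t) t := fun t => by
    have h1 := (((Real.hasDerivAt_cosh t).ofReal_comp.const_mul z).neg.sub
      ((Complex.ofRealCLM.hasDerivAt (x := t)).const_mul m)).cexp
    refine h1.congr_deriv ?_
    have h2 := sinh_mul_macdonaldIntegrand m z t
    simp only [macdonaldIntegrand] at h2 ⊢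
    simp only [Complex.ofRealCLM_apply, Complex.ofReal_one, Pi.sub_apply, Pi.neg_apply]
    linear_combination (-z) * h2
  have h := integral_eq_zero_of_hasDerivAt_of_integrable hd
    (((i1.sub i2).const_mul (z / 2)).sub (i0.const_mul m)) i0
  have i3 : Integrable fun t => z / 2 *
      (macdonaldIntegrand (m + 1) z t - macdonaldIntegrand (m - 1) z t) :=
    (i1.sub i2).const_mul (z / 2)
  rw [integral_sub i3 (i0.const_mul m), integral_const_mul,
    integral_const_mul, integral_sub i1 i2] at h
  simp only [macdonald]
  linear_combination h

theorem hasDerivAt_macdonald (m : ℂ) {z : ℂ} (hz : 0 < z.re) : HasDerivAt (macdonald m)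
    (-(1 / 2) * (macdonald (m + 1) z + macdonald (m - 1) z)) z := by
  have i1 := integrable_macdonaldIntegrand (m + 1) hz
  have i2 := integrable_macdonaldIntegrand (m - 1) hz
  have hδ : 0 < z.re / 2 := by linarith
  have hs : {w : ℂ | z.re / 2 < w.re} ∈ 𝓝 z :=
    (isOpen_lt continuous_const Complex.continuous_re).mem_nhds (by simpa using hz)
  have j1 := integrable_exp_neg_cosh hδ (-(m + 1).re)
  have j2 := integrable_exp_neg_cosh hδ (-(m - 1).re)
  have h := (hasDerivAt_integral_of_dominated_loc_of_deriv_le (μ := volume)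
    (F := fun w t => macdonaldIntegrand m w t)
    (F' := fun w t => -(1 / 2) * (macdonaldIntegrand (m + 1) w t + macdonaldIntegrand (m - 1) w t))
    (bound := fun t => 1 / 2 * (Real.exp (-(z.re / 2 * Real.cosh t) + -(m + 1).re * t) +
      Real.exp (-(z.re / 2 * Real.cosh t) + -(m - 1).re * t))) hs
    (Eventually.of_forall fun w => (continuous_macdonaldIntegrand m w).aestronglyMeasurable)
    (integrable_macdonaldIntegrand m hz)
    ((i1.add i2).const_mul _).aestronglyMeasurable
    (ae_of_all _ fun t w hw => ?_) ((j1.add j2).const_mul _)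
    (ae_of_all _ fun t w _ => ?_)).2
  · refine (h.const_mul (1 / 2)).congr_deriv ?_
    rw [integral_const_mul, integral_add i1 i2]
    simp only [macdonald]
    ring
  · rw [norm_mul, norm_neg]
    refine mul_le_mul (by norm_num) ((norm_add_le _ _).trans ?_) (norm_nonneg _) (by norm_num)
    rw [norm_macdonaldIntegrand, norm_macdonaldIntegrand]
    have h1 := Real.cosh_pos t
    have h2 : z.re / 2 ≤ w.re := le_of_lt hw
    gcongr
  · have h1 := (((hasDerivAt_id w).mul_const (Real.cosh t : ℂ)).neg.sub_const (m * t)).cexp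
    refine h1.congr_deriv ?_
    have h2 := cosh_mul_macdonaldIntegrand m w t
    simp only [macdonaldIntegrand, Pi.neg_apply, id] at h2 ⊢
    linear_combination -h2

theorem mul_exp_re (k : ℂ) (x : ℝ) : (k * Real.exp x).re = k.re * Real.exp x :=
  Complex.re_mul_ofReal _ _

theorem mul_exp_re_pos {k : ℂ} (hk : 0 < k.re) (x : ℝ) : 0 < (k * Real.exp x).re := by
  rw [mul_exp_re]
  have := Real.exp_pos x
  positivity

theorem hasDerivAt_macdonald_exp {k : ℂ} (hk : 0 < k.re) (m : ℂ) (x : ℝ) :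
    HasDerivAt (fun x : ℝ => macdonald m (k * Real.exp x))
      (m * macdonald m (k * Real.exp x) -
        k * Real.exp x * macdonald (m + 1) (k * Real.exp x)) x := by
  have hz := mul_exp_re_pos hk x
  have h := (hasDerivAt_macdonald m hz).comp x ((hasDerivAt_ofReal_exp x).const_mul k)
  refine h.congr_deriv ?_
  linear_combination (1 / 2) * macdonald_recurrence m hz

theorem hasDerivAt_macdonald_exp_succ {k : ℂ} (hk : 0 < k.re) (m : ℂ) (x : ℝ) :
    HasDerivAt (fun x : ℝ => macdonald (m + 1) (k * Real.exp x))
      (-(m + 1) * macdonald (m + 1) (k * Real.exp x) -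
        k * Real.exp x * macdonald m (k * Real.exp x)) x := by
  refine (hasDerivAt_macdonald_exp hk (m + 1) x).congr_deriv ?_
  have h := macdonald_recurrence (m + 1) (mul_exp_re_pos hk x)
  rw [add_sub_cancel_right] at h
  linear_combination -h

theorem continuousAt_macdonald_order (m : ℂ) {z : ℂ} (hz : 0 < z.re) :
    ContinuousAt (fun ν => macdonald ν z) m := by
  refine ContinuousAt.mul continuousAt_const ?_
  have hs : {ν : ℂ | ‖ν‖ < ‖m‖ + 1} ∈ 𝓝 m :=
    (isOpen_lt continuous_norm continuous_const).mem_nhds (by simp)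
  refine continuousAt_of_dominated
    (bound := fun t => Real.exp (-(z.re * Real.cosh t) + (‖m‖ + 1) * |t|))
    (Eventually.of_forall fun ν => (continuous_macdonaldIntegrand ν z).aestronglyMeasurable)
    ?_ (integrable_exp_neg_cosh_abs hz _) (ae_of_all _ fun t => ?_)
  · filter_upwards [hs] with ν hν
    refine ae_of_all _ fun t => ?_
    rw [norm_macdonaldIntegrand]
    refine Real.exp_le_exp.2 (add_le_add_right ?_ _)
    calc -ν.re * t ≤ |-ν.re * t| := le_abs_self _
      _ = |ν.re| * |t| := by rw [abs_mul, abs_neg]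
      _ ≤ (‖m‖ + 1) * |t| := by
        gcongr
        exact (Complex.abs_re_le_norm ν).trans (le_of_lt hν)
  · unfold macdonaldIntegrand
    fun_prop

/-! ### Decay of the Macdonald integral at `+∞` and its growth at `-∞` -/

theorem macdonald_exp_bound_pos {k : ℂ} (hk : 0 < k.re) (m : ℂ) :
    ∃ C, ∀ x : ℝ, 0 ≤ x →
      ‖macdonald m (k * Real.exp x)‖ ≤ C * Real.exp (-(k.re * Real.exp x)) := by
  have hi := (integrable_exp_neg_cosh hk (-m.re)).const_mul (Real.exp k.re)
  refine ⟨1 / 2 * ∫ t, Real.exp k.re * Real.exp (-(k.re * Real.cosh t) + -m.re * t), fun x hx => ?_⟩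
  rw [macdonald, norm_mul, mul_assoc, ← integral_mul_const]
  refine mul_le_mul (by norm_num) (norm_integral_le_of_norm_le (hi.mul_const _)
    (ae_of_all _ fun t => ?_)) (norm_nonneg _) (by norm_num)
  rw [norm_macdonaldIntegrand, mul_exp_re, ← Real.exp_add, ← Real.exp_add]
  refine Real.exp_le_exp.2 ?_
  have h1 := Real.one_le_cosh t
  have h2 := Real.one_le_exp hx
  -- This decouples the variables: `e^x cosh t ≥ e^x + cosh t - 1`.
  have h3 : 0 ≤ k.re * ((Real.exp x - 1) * (Real.cosh t - 1)) :=
    mul_nonneg hk.le (mul_nonneg (by linarith) (by linarith))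
  linarith

theorem integrable_exp_neg_exp {δ a : ℝ} (hδ : 0 < δ) (ha : 0 < a) :
    Integrable fun s : ℝ => Real.exp (-(δ * Real.exp s) + a * s) := by
  have h1 : IntegrableOn (fun s : ℝ => Real.exp (-(δ * Real.exp s) + a * s)) (Iic 0) := by
    refine (integrableOn_exp_mul_Iic ha 0).mono' (by fun_prop) (ae_of_all _ fun s => ?_)
    rw [Real.norm_of_nonneg (Real.exp_pos _).le]
    refine Real.exp_le_exp.2 ?_
    have := mul_pos hδ (Real.exp_pos s)
    linarith
  have h2 : IntegrableOn (fun s : ℝ => Real.exp (-(δ * Real.exp s) + a * s)) (Ioi 0) := by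
    refine (integrable_exp_neg_cosh hδ a).integrableOn.mono' (by fun_prop) ?_
    refine (ae_restrict_iff' measurableSet_Ioi).2 (ae_of_all _ fun s hs => ?_)
    rw [Real.norm_of_nonneg (Real.exp_pos _).le]
    refine Real.exp_le_exp.2 ?_
    have h3 : Real.cosh s ≤ Real.exp s := by
      have h4 : (0 : ℝ) < s := hs
      have : Real.exp (-s) ≤ Real.exp s := Real.exp_le_exp.2 (by linarith)
      rw [Real.cosh_eq]
      linarith
    have := mul_le_mul_of_nonneg_left h3 hδ.le
    linarith
  rw [← integrableOn_univ, ← Iic_union_Ioi (a := (0 : ℝ))]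
  exact h1.union h2

theorem exp_mul_cosh_sub (x s : ℝ) :
    Real.exp x * Real.cosh (s - x) = (Real.exp s + Real.exp (2 * x - s)) / 2 := by
  rw [Real.cosh_eq, mul_div_assoc', mul_add, ← Real.exp_add, ← Real.exp_add]
  ring_nf

/-- The shift `s = t + x` (after `t ↦ -t`) extracts the singular factor `e^{-m x}`. If `Re k` and
`Re m` are positive, the remaining integrand has an integrable bound independent of `x`. -/
theorem exp_mul_macdonald_eq (k m : ℂ) (x : ℝ) :
    Complex.exp (m * x) * macdonald m (k * Real.exp x) =
      1 / 2 * ∫ s : ℝ, Complex.exp (-(k / 2 * (Real.exp s + Real.exp (2 * x - s))) + m * s) := by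
  rw [← macdonald_neg, macdonald, ← integral_sub_right_eq_self _ x, ← mul_assoc,
    mul_comm (Complex.exp _), mul_assoc, ← integral_const_mul]
  congr 2
  funext s
  rw [macdonaldIntegrand, ← Complex.exp_add]
  congr 1
  have h := exp_mul_cosh_sub x s
  have h' : (Real.exp x : ℂ) * Real.cosh (s - x) =
    (Real.exp s + Real.exp (2 * x - s)) / 2 := by exact_mod_cast h
  push_cast at h' ⊢
  linear_combination (-k) * h'

theorem norm_shifted_le {k : ℂ} (hk : 0 < k.re) (m : ℂ) (x s : ℝ) :
    ‖Complex.exp (-(k / 2 * (Real.exp s + Real.exp (2 * x - s))) + m * s)‖ ≤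
      Real.exp (-(k.re / 2 * Real.exp s) + m.re * s) := by
  rw [Complex.norm_exp]
  refine Real.exp_le_exp.2 ?_
  have h1 : (-(k / 2 * (Real.exp s + Real.exp (2 * x - s))) + m * s).re =
      -(k.re / 2 * (Real.exp s + Real.exp (2 * x - s))) + m.re * s := by
    rw [Complex.add_re, Complex.neg_re, Complex.re_mul_ofReal, ← Complex.ofReal_add,
      Complex.re_mul_ofReal]
    simp
  rw [h1]
  have h2 := mul_pos hk (Real.exp_pos (2 * x - s))
  linarith

theorem macdonald_exp_bound_neg {k : ℂ} (hk : 0 < k.re) {m : ℂ} (hm : 0 < m.re) :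
    ∃ C, ∀ x : ℝ, ‖macdonald m (k * Real.exp x)‖ ≤ C * Real.exp (-(m.re * x)) := by
  have hi := integrable_exp_neg_exp (δ := k.re / 2) (by linarith) hm
  refine ⟨1 / 2 * ∫ s, Real.exp (-(k.re / 2 * Real.exp s) + m.re * s), fun x => ?_⟩
  have h1 : ‖Complex.exp (m * x) * macdonald m (k * Real.exp x)‖ ≤
      1 / 2 * ∫ s, Real.exp (-(k.re / 2 * Real.exp s) + m.re * s) := by
    rw [exp_mul_macdonald_eq, norm_mul]
    exact mul_le_mul (by norm_num) (norm_integral_le_of_norm_le hi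
      (ae_of_all _ fun s => norm_shifted_le hk m x s)) (norm_nonneg _) (by norm_num)
  rw [norm_mul, Complex.norm_exp, Complex.re_mul_ofReal] at h1
  rw [Real.exp_neg, ← div_eq_mul_inv, le_div_iff₀ (Real.exp_pos _), mul_comm]
  exact h1

theorem integral_exp_neg_exp {m : ℂ} (hm : 0 < m.re) :
    ∫ s : ℝ, Complex.exp (-(Real.exp s : ℂ) + m * s) = Complex.Gamma m := by
  rw [Complex.Gamma_eq_integral hm, Complex.GammaIntegral]
  have h := integral_image_eq_integral_abs_deriv_smul (s := univ) (f := Real.exp) (f' := Real.exp)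
    MeasurableSet.univ (fun x _ => (Real.hasDerivAt_exp x).hasDerivWithinAt)
    Real.exp_injective.injOn (fun x : ℝ => (Real.exp (-x) : ℂ) * (x : ℂ) ^ (m - 1))
  rw [image_univ, Real.range_exp, setIntegral_univ] at h
  rw [h]
  congr 1
  funext s
  have h0 : (Real.exp s : ℂ) ≠ 0 := by exact_mod_cast (Real.exp_pos s).ne'
  rw [abs_of_pos (Real.exp_pos s), Complex.real_smul, Complex.cpow_def_of_ne_zero h0,
    ← Complex.ofReal_log (Real.exp_pos s).le, Real.log_exp]
  simp only [Complex.ofReal_exp, Complex.ofReal_neg]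
  rw [← Complex.exp_add, ← Complex.exp_add]
  congr 1
  ring

theorem tendsto_exp_mul_macdonald {m : ℂ} (hm : 0 < m.re) :
    Tendsto (fun x : ℝ => Complex.exp (m * x) * macdonald m (2 * Real.exp x)) atBot
      (𝓝 (1 / 2 * Complex.Gamma m)) := by
  simp only [exp_mul_macdonald_eq]
  rw [← integral_exp_neg_exp hm]
  refine Tendsto.const_mul _ (tendsto_integral_filter_of_dominated_convergence
    (fun s => Real.exp (-((2 : ℂ).re / 2 * Real.exp s) + m.re * s))
    (Eventually.of_forall fun x => (by fun_prop))
    (Eventually.of_forall fun x => ae_of_all _ fun s => norm_shifted_le (by norm_num) m x s)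
    (integrable_exp_neg_exp (by norm_num) hm) (ae_of_all _ fun s => ?_))
  have h1 : Tendsto (fun x : ℝ => 2 * x - s) atBot atBot :=
    tendsto_atBot_add_const_right _ _ (tendsto_id.const_mul_atBot (by norm_num))
  have h2 : Tendsto (fun x : ℝ => ((Real.exp (2 * x - s) : ℝ) : ℂ)) atBot (𝓝 ((0 : ℝ) : ℂ)) :=
    (Complex.continuous_ofReal.tendsto 0).comp (Real.tendsto_exp_atBot.comp h1)
  have h3 := ((((h2.const_add (Real.exp s : ℂ)).const_mul (2 / 2 : ℂ)).neg).add_const (m * s)).cexp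
  simpa using h3

/-! ## The connection formula and the Green's function of the exponential potential -/

theorem isOpen_re_pos : IsOpen {z : ℂ | 0 < z.re} :=
  isOpen_lt continuous_const Complex.continuous_re

theorem differentiableAt_besselI (m : ℂ) {z : ℂ} (hz : 0 < z.re) :
    DifferentiableAt ℂ (besselI m) z := by
  have h1 : DifferentiableAt ℂ (fun z : ℂ => (z / 2) ^ m) z := by
    refine DifferentiableAt.cpow (by fun_prop) (by fun_prop) (Or.inl ?_)
    rw [Complex.div_ofNat_re]
    linarith
  have h2 : DifferentiableAt ℂ (fun z : ℂ => besselG m (z ^ 2 / 4)) z :=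
    (hasDerivAt_besselG m (z ^ 2 / 4)).differentiableAt.comp z
      (f := fun z : ℂ => z ^ 2 / 4) (by fun_prop)
  exact h1.mul h2

theorem besselI_recurrence (m : ℂ) {z : ℂ} (hz : 0 < z.re) :
    z * besselI m z = 2 * (m + 1) * besselI (m + 1) z + z * besselI (m + 2) z := by
  have h1 := half_cpow_add_one hz m 0
  have h2 := half_cpow_add_one hz (m + 1) 0
  simp only [Real.exp_zero, Complex.ofReal_one, mul_one] at h1 h2
  rw [show m + 1 + 1 = m + 2 by ring] at h2
  rw [besselI_eq, besselI_eq, besselI_eq, h2, h1]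
  linear_combination (z * (z / 2) ^ m) * besselG_recurrence m (z ^ 2 / 4)

/-- `z (I_m K_{m+1} + I_{m+1} K_m)`, with `K` the integral `macdonald`. -/
noncomputable def besselCross (m z : ℂ) : ℂ :=
  z * (besselI m z * macdonald (m + 1) z + besselI (m + 1) z * macdonald m z)

/-- In the variable `x` this is the Wronskian of two solutions of one equation, hence constant along
each ray. -/
theorem besselCross_exp_eq {k : ℂ} (hk : 0 < k.re) (m : ℂ) (x y : ℝ) :
    besselCross m (k * Real.exp x) = besselCross m (k * Real.exp y) := by
  have hd : ∀ x, HasDerivAt (fun x : ℝ => besselCross m (k * Real.exp x)) 0 x := fun x => by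
    have h := ((hasDerivAt_ofReal_exp x).const_mul k).mul
      (((hasDerivAt_besselI_exp hk m x).mul (hasDerivAt_macdonald_exp_succ hk m x)).add
      ((hasDerivAt_besselI_exp_succ hk m x).mul (hasDerivAt_macdonald_exp hk m x)))
    refine h.congr_deriv ?_
    simp only [Pi.add_apply, Pi.mul_apply]
    ring
  exact is_const_of_deriv_eq_zero (fun x => (hd x).differentiableAt) (fun x => (hd x).deriv) x y

/-- The constant is read off as the limit at `-∞`: `I_m ~ e^{m y} / Γ(m+1)` meets `K_{m+1} ~ ½
Γ(m+1) e^{-(m+1) y}`, and the other product vanishes. The factor `2` makes the power `(k / 2)^m`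
equal to one. -/
theorem besselCross_two_mul_exp {m : ℂ} (hm : 0 < m.re) (x : ℝ) :
    besselCross m (2 * Real.exp x) = 1 := by
  have h2 : (0 : ℝ) < (2 : ℂ).re := by norm_num
  have hm1 : 0 < (m + 1).re := by simp; linarith
  have hlim : Tendsto (fun y : ℝ => besselCross m (2 * Real.exp y)) atBot (𝓝 1) := by
    have heq : ∀ y : ℝ, besselCross m (2 * Real.exp y) =
        2 * besselG m (Real.exp y ^ 2) *
          (Complex.exp ((m + 1) * y) * macdonald (m + 1) (2 * Real.exp y)) +
        2 * Real.exp y ^ 2 * besselG (m + 1) (Real.exp y ^ 2) *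
          (Complex.exp (m * y) * macdonald m (2 * Real.exp y)) := fun y => by
      have e1 := half_cpow_eq h2 m y
      have e2 := half_cpow_eq h2 (m + 1) y
      rw [div_self two_ne_zero, Complex.one_cpow, mul_one] at e1 e2
      have e3 : Complex.exp ((m + 1) * y) = Complex.exp (m * y) * Real.exp y := by
        rw [add_mul, one_mul, Complex.exp_add, Complex.ofReal_exp]
      have e4 : (2 * (Real.exp y : ℂ)) ^ 2 / 4 = Real.exp y ^ 2 := by ring
      rw [besselCross, besselI_eq, besselI_eq, e1, e2, e3, e4]
      ring
    have t0 : Tendsto (fun y : ℝ => (Real.exp y : ℂ) ^ 2) atBot (𝓝 0) := by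
      have := ((Complex.continuous_ofReal.tendsto 0).comp Real.tendsto_exp_atBot).pow 2
      simpa using this
    have t1 := ((continuous_besselG m).tendsto 0).comp t0
    have t2 := ((continuous_besselG (m + 1)).tendsto 0).comp t0
    have t3 := tendsto_exp_mul_macdonald hm
    have t4 := tendsto_exp_mul_macdonald hm1
    have t5 := ((t1.const_mul 2).mul t4).add (((t0.const_mul 2).mul t2).mul t3)
    rw [besselG_zero] at t5
    have hG : Complex.Gamma (m + 1) ≠ 0 := Complex.Gamma_ne_zero_of_re_pos hm1
    have hval : 2 * (Complex.Gamma (m + 1))⁻¹ * (1 / 2 * Complex.Gamma (m + 1)) +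
        2 * 0 * besselG (m + 1) 0 * (1 / 2 * Complex.Gamma m) = 1 := by
      field_simp
      ring
    rw [hval] at t5
    exact t5.congr fun y => (heq y).symm
  have hconst : (fun y : ℝ => besselCross m (2 * Real.exp y)) =
      fun _ => besselCross m (2 * Real.exp x) := funext fun y =>
    besselCross_exp_eq h2 m y x
  rw [hconst] at hlim
  exact tendsto_nhds_unique tendsto_const_nhds hlim

theorem besselCross_eq_one_of_re_pos {m : ℂ} (hm : 0 < m.re) {z : ℂ} (hz : 0 < z.re) :
    besselCross m z = 1 := by
  have hd : DifferentiableOn ℂ (besselCross m) {z : ℂ | 0 < z.re} := fun w hw =>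
    (DifferentiableAt.mul differentiableAt_id
      (((differentiableAt_besselI m hw).mul (hasDerivAt_macdonald (m + 1) hw).differentiableAt).add
      ((differentiableAt_besselI (m + 1) hw).mul
        (hasDerivAt_macdonald m hw).differentiableAt))).differentiableWithinAt
  have ha := hd.analyticOnNhd isOpen_re_pos
  have hfreq : ∃ᶠ w in 𝓝[≠] (2 : ℂ), besselCross m w = (fun _ => (1 : ℂ)) w := by
    have ht : Tendsto (fun x : ℝ => (2 : ℂ) * Real.exp x) (𝓝[≠] 0) (𝓝[≠] 2) := by
      refine tendsto_nhdsWithin_iff.2 ⟨?_, ?_⟩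
      · have hc : Continuous fun x : ℝ => (2 : ℂ) * Real.exp x := by fun_prop
        have := hc.tendsto 0
        simp only [Real.exp_zero, Complex.ofReal_one, mul_one] at this
        exact this.mono_left nhdsWithin_le_nhds
      · filter_upwards [self_mem_nhdsWithin] with x hx h
        have h1 : (2 : ℂ) * Real.exp x = 2 := h
        have h2 : (Real.exp x : ℂ) = 1 := by
          have := mul_left_cancel₀ (two_ne_zero (α := ℂ)) (h1.trans (mul_one 2).symm)
          exact this
        have h3 : Real.exp x = 1 := by exact_mod_cast h2
        exact hx (Real.exp_eq_one_iff x |>.1 h3)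
    refine ht.frequently (Eventually.frequently (Eventually.of_forall fun x => ?_))
    exact besselCross_two_mul_exp hm x
  exact ha.eqOn_of_preconnected_of_frequently_eq analyticOnNhd_const
    (convex_halfSpace_re_gt 0).isPreconnected (show (2 : ℂ) ∈ {z : ℂ | 0 < z.re} by simp)
    hfreq hz

/-- The recurrences make the cross product invariant under `m ↦ m + 1`, which moves any order into
`Re m > 0`. The connection formula needs it at both `m` and `-m`. -/
theorem besselCross_eq_one (m : ℂ) {z : ℂ} (hz : 0 < z.re) : besselCross m z = 1 := by
  have hstep : ∀ m : ℂ, besselCross (m + 1) z = besselCross m z := fun m => by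
    have h1 := besselI_recurrence m hz
    have h2 := macdonald_recurrence (m + 1) hz
    rw [add_sub_cancel_right] at h2
    rw [besselCross, besselCross]
    rw [show m + 1 + 1 = m + 2 by ring] at h2 ⊢
    linear_combination (-macdonald (m + 1) z) * h1 + besselI (m + 1) z * h2
  have hn : ∀ n : ℕ, besselCross (m + n) z = besselCross m z := fun n => by
    induction n with
    | zero => simp
    | succ n ih =>
      rw [← ih, ← hstep (m + n)]
      push_cast
      rw [add_assoc]
  obtain ⟨n, hn'⟩ := exists_nat_gt (-m.re)
  rw [← hn n]
  refine besselCross_eq_one_of_re_pos ?_ hz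
  simp
  linarith

theorem sin_pi_mul_ne_zero_of_not_int {m : ℂ} (hm : ¬ ∃ n : ℤ, m = n) : Complex.sin (Real.pi * m) ≠ 0 := by
  intro h
  obtain ⟨n, hn⟩ := Complex.sin_eq_zero_iff.1 h
  refine hm ⟨n, ?_⟩
  have hpi : (Real.pi : ℂ) ≠ 0 := by exact_mod_cast Real.pi_ne_zero
  exact mul_left_cancel₀ hpi (hn.trans (mul_comm _ _))

/-- The integral is even in `m`, so the cross products at `m` and `-m` together with the recurrence
eliminate the orders `m ± 1`; what multiplies `K_m` is the Wronskian of `I_m` and `I_{-m}`. -/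
theorem besselKAux_eq_macdonald {m : ℂ} (hm : ¬ ∃ n : ℤ, m = n) {z : ℂ} (hz : 0 < z.re) :
    besselKAux m z = macdonald m z := by
  have hm0 : m ≠ 0 := fun h => hm ⟨0, by simpa using h⟩
  have hs := sin_pi_mul_ne_zero_of_not_int hm
  have hpi : (Real.pi : ℂ) ≠ 0 := by exact_mod_cast Real.pi_ne_zero
  have h1 := besselCross_eq_one m hz
  have h2 := besselCross_eq_one (-m) hz
  have h3 := besselI_wronskian hz hm0 0
  have h4 := macdonald_recurrence m hz
  simp only [Real.exp_zero, Complex.ofReal_one, mul_one] at h3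
  rw [besselCross] at h1 h2
  rw [macdonald_neg, show -m + 1 = -(m - 1) by ring, macdonald_neg,
    show -(m - 1) = -m + 1 by ring] at h2
  have h5 : 2 * Complex.sin (Real.pi * m) / Real.pi * macdonald m z =
      besselI (-m) z - besselI m z := by
    linear_combination macdonald m z * h3 + besselI (-m) z * h1 - besselI m z * h2
      - besselI m z * besselI (-m) z * h4
  rw [besselKAux, ← h5]
  field_simp

theorem besselK_eq_macdonald (m : ℂ) {z : ℂ} (hz : 0 < z.re) :
    besselK m z = macdonald m z := by
  rw [besselK]
  split_ifs with h
  · obtain ⟨n, hn⟩ := h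
    refine Tendsto.limUnder_eq ?_
    have hc := (continuousAt_macdonald_order m hz).tendsto.mono_left
      (nhdsWithin_le_nhds (s := {m}ᶜ))
    refine hc.congr' ?_
    -- The unit ball about an integer contains no other integer, so the non-integer formula is
    -- available near `m`, and the integral is continuous in the order.
    have hb : Metric.ball m 1 ∈ 𝓝[≠] m := nhdsWithin_le_nhds (Metric.ball_mem_nhds m one_pos)
    filter_upwards [hb, self_mem_nhdsWithin] with ν hν hne
    refine (besselKAux_eq_macdonald ?_ hz).symm
    rintro ⟨n', rfl⟩
    rw [hn, Metric.mem_ball, Complex.dist_eq] at hν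
    have h1 : ‖((n' - n : ℤ) : ℂ)‖ < 1 := by push_cast; exact hν
    rw [Complex.norm_intCast] at h1
    have h2 : |n' - n| < 1 := by exact_mod_cast h1
    have h3 : n' = n := by
      have := Int.abs_lt_one_iff.1 h2
      omega
    exact hne (by rw [hn, h3]; rfl)
  · exact besselKAux_eq_macdonald h hz

/-- The modified Bessel functions form a Green pair for the exponential potential. -/
theorem isGreenPair_bessel {k m : ℂ} (hk : 0 < k.re) (hm : 0 < m.re) :
    ∃ (u' v' : ℝ → ℂ) (C c : ℝ) (h : ℝ → ℝ), IsGreenPair (expPotential k) (-m ^ 2)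
      (fun x => besselI m (k * Real.exp x)) u' (fun x => besselK m (k * Real.exp x)) v' C c h := by
  have hK : (fun x : ℝ => besselK m (k * Real.exp x)) =
      fun x : ℝ => macdonald m (k * Real.exp x) :=
    funext fun x => besselK_eq_macdonald m (mul_exp_re_pos hk x)
  rw [hK]
  obtain ⟨C1, hC1⟩ := besselI_exp_bound_pos hk m
  obtain ⟨C2, hC2⟩ := besselI_exp_bound_neg hk m
  obtain ⟨C3, hC3⟩ := macdonald_exp_bound_pos hk m
  obtain ⟨C4, hC4⟩ := macdonald_exp_bound_neg hk hm
  have hV : ∀ x, expPotential k x - -m ^ 2 = m ^ 2 + (k * Real.exp x) ^ 2 := fun x => by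
    rw [expPotential, two_mul, Real.exp_add]
    push_cast
    ring
  have hz : ∀ x : ℝ, HasDerivAt (fun x : ℝ => k * (Real.exp x : ℂ)) (k * Real.exp x) x :=
    fun x => (hasDerivAt_ofReal_exp x).const_mul k
  -- The weight `Re m · min x 0 + Re k e^x` matches both asymptotic regimes. On `x ≤ 0` its second
  -- term lies between `0` and `Re k`, whence the factor `e^{Re k}` beside `|C4|`.
  refine ⟨fun x => m * besselI m (k * Real.exp x) +
      k * Real.exp x * besselI (m + 1) (k * Real.exp x),
    fun x => m * macdonald m (k * Real.exp x) -
        k * Real.exp x * macdonald (m + 1) (k * Real.exp x),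
    |C1| + |C2| + |C3| + |C4| * Real.exp k.re, min m.re k.re,
    fun x => m.re * min x 0 + k.re * Real.exp x, ?_⟩
  have hE := Real.exp_pos k.re
  have hE1 := (Real.one_lt_exp_iff.2 hk).le
  have e1 : C1 ≤ |C1| + |C2| + |C3| + |C4| * Real.exp k.re := by
    have := mul_nonneg (abs_nonneg C4) hE.le
    linarith [le_abs_self C1, abs_nonneg C2, abs_nonneg C3]
  have e2 : |C2| ≤ |C1| + |C2| + |C3| + |C4| * Real.exp k.re := by
    have := mul_nonneg (abs_nonneg C4) hE.le
    linarith [abs_nonneg C1, abs_nonneg C3]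
  have e3 : C3 ≤ |C1| + |C2| + |C3| + |C4| * Real.exp k.re := by
    have := mul_nonneg (abs_nonneg C4) hE.le
    linarith [le_abs_self C3, abs_nonneg C2, abs_nonneg C1]
  have e4 : |C4| * Real.exp k.re ≤ |C1| + |C2| + |C3| + |C4| * Real.exp k.re := by
    linarith [abs_nonneg C1, abs_nonneg C2, abs_nonneg C3]
  constructor
  · exact hasDerivAt_besselI_exp hk m
  · intro x
    refine (((hasDerivAt_besselI_exp hk m x).const_mul m).add
      ((hz x).mul (hasDerivAt_besselI_exp_succ hk m x))).congr_deriv ?_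
    rw [hV]
    ring
  · exact hasDerivAt_macdonald_exp hk m
  · intro x
    refine (((hasDerivAt_macdonald_exp hk m x).const_mul m).sub
      ((hz x).mul (hasDerivAt_macdonald_exp_succ hk m x))).congr_deriv ?_
    rw [hV]
    ring
  · intro x
    have h := besselCross_eq_one m (mul_exp_re_pos hk x)
    rw [besselCross] at h
    linear_combination h
  · intro x
    rcases le_total 0 x with hx | hx
    · rw [min_eq_right hx, mul_zero, zero_add]
      exact (hC1 x hx).trans (mul_le_mul_of_nonneg_right e1 (Real.exp_pos _).le)
    · rw [min_eq_left hx]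
      have h1 : Real.exp (m.re * x) ≤ Real.exp (m.re * x + k.re * Real.exp x) := by
        refine Real.exp_le_exp.2 ?_
        have := mul_pos hk (Real.exp_pos x)
        linarith
      calc _ ≤ C2 * Real.exp (m.re * x) := hC2 x hx
        _ ≤ |C2| * Real.exp (m.re * x + k.re * Real.exp x) := by
          have := le_abs_self C2
          gcongr
        _ ≤ _ := by gcongr
  · intro x
    rcases le_total 0 x with hx | hx
    · rw [min_eq_right hx, mul_zero, zero_add]
      exact (hC3 x hx).trans (mul_le_mul_of_nonneg_right e3 (Real.exp_pos _).le)
    · rw [min_eq_left hx]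
      have h1 : Real.exp (-(m.re * x)) ≤
          Real.exp k.re * Real.exp (-(m.re * x + k.re * Real.exp x)) := by
        rw [← Real.exp_add]
        refine Real.exp_le_exp.2 ?_
        have := mul_le_mul_of_nonneg_left (Real.exp_le_one_iff.2 hx) hk.le
        linarith
      calc _ ≤ C4 * Real.exp (-(m.re * x)) := hC4 x
        _ ≤ |C4| * (Real.exp k.re * Real.exp (-(m.re * x + k.re * Real.exp x))) := by
          have := le_abs_self C4
          gcongr
        _ = |C4| * Real.exp k.re * Real.exp (-(m.re * x + k.re * Real.exp x)) := by ring
        _ ≤ _ := by gcongr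
  · exact lt_min hm hk
  · intro x y hxy
    have hcm := min_le_left m.re k.re
    have hck := min_le_right m.re k.re
    have hexp : Real.exp x + Real.exp x * (y - x) ≤ Real.exp y := by
      have h1 := Real.add_one_le_exp (y - x)
      have h2 : Real.exp y = Real.exp x * Real.exp (y - x) := by rw [← Real.exp_add]; ring_nf
      rw [h2]
      nlinarith [Real.exp_pos x]
    have hmono := Real.exp_le_exp.2 hxy
    set c := min m.re k.re
    rcases le_total 0 x with hx | hx
    · rw [min_eq_right hx, min_eq_right (hx.trans hxy)]
      have h1 := Real.one_le_exp hx
      have h2 : y - x ≤ Real.exp y - Real.exp x := by nlinarith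
      nlinarith
    · rcases le_total y 0 with hy | hy
      · rw [min_eq_left hx, min_eq_left hy]
        nlinarith
      · rw [min_eq_left hx, min_eq_right hy]
        have h1 := Real.add_one_le_exp y
        have h2 := Real.exp_le_one_iff.2 hx
        have h3 : y ≤ Real.exp y - Real.exp x := by linarith
        nlinarith

/-- Exponentials form a Green pair for the zero potential. -/
theorem isGreenPair_free {m : ℂ} (hm : 0 < m.re) :
    IsGreenPair (expPotential 0) (-m ^ 2) (fun x => Complex.exp (m * x))
      (fun x => m * Complex.exp (m * x)) (fun x => (2 * m)⁻¹ * Complex.exp (-m * x))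
      (fun x => -(1 / 2) * Complex.exp (-m * x)) (1 + ‖(2 * m)⁻¹‖) m.re (fun x => m.re * x) := by
  have hm0 : m ≠ 0 := by rintro rfl; simp at hm
  have hd : ∀ (a : ℂ) (x : ℝ), HasDerivAt (fun x : ℝ => Complex.exp (a * x))
      (a * Complex.exp (a * x)) x := fun a x => by
    have := ((Complex.ofRealCLM.hasDerivAt (x := x)).const_mul a).cexp
    refine this.congr_deriv ?_
    simp
    ring
  have hV : ∀ x, expPotential 0 x = 0 := fun x => by simp [expPotential]
  have hn := norm_nonneg (2 * m)⁻¹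
  constructor
  · exact hd m
  · intro x
    refine ((hd m x).const_mul m).congr_deriv ?_
    rw [hV]
    ring
  · intro x
    refine ((hd (-m) x).const_mul (2 * m)⁻¹).congr_deriv ?_
    field_simp
  · intro x
    refine ((hd (-m) x).const_mul (-(1 / 2))).congr_deriv ?_
    rw [hV]
    field_simp
    ring
  · intro x
    have : Complex.exp (m * x) * Complex.exp (-(m * x)) = 1 := by
      rw [← Complex.exp_add, add_neg_cancel, Complex.exp_zero]
    simp only [neg_mul]
    field_simp
    linear_combination 2 * this
  · intro x
    rw [Complex.norm_exp, Complex.re_mul_ofReal]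
    exact le_mul_of_one_le_left (Real.exp_pos _).le (by linarith)
  · intro x
    rw [norm_mul, Complex.norm_exp, Complex.re_mul_ofReal, Complex.neg_re, neg_mul]
    exact mul_le_mul_of_nonneg_right (by linarith) (Real.exp_pos _).le
  · exact hm
  · intro x y _
    linarith

/-! ## The spectrum -/

theorem continuous_expPotential (k : ℂ) : Continuous (expPotential k) := by
  unfold expPotential
  fun_prop

theorem norm_expPotential (k : ℂ) (x : ℝ) : ‖expPotential k x‖ = ‖k‖ ^ 2 * Real.exp (2 * x) := by
  rw [expPotential, norm_mul, norm_pow, Complex.norm_real, Real.norm_eq_abs, Real.abs_exp]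

theorem exists_accretive {k : ℂ} (hk : 0 < k.re ∨ k = 0) :
    ∃ c : ℂ, 0 < c.re ∧ ∀ x, 0 ≤ (c * expPotential k x).re := by
  rcases hk with hk | rfl
  · refine ⟨conj k, by simpa using hk, fun x => ?_⟩
    have h : conj k * expPotential k x =
        ((Complex.normSq k * Real.exp (2 * x) : ℝ) : ℂ) * k := by
      rw [expPotential]
      push_cast
      rw [Complex.normSq_eq_conj_mul_self]
      ring
    rw [h, Complex.re_ofReal_mul]
    have := Complex.normSq_nonneg k
    have := Real.exp_pos (2 * x)
    positivity
  · exact ⟨1, by simp, fun x => by simp [expPotential]⟩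

theorem exists_resolvent_hasIntegralKernel {k m : ℂ} (hk : 0 < k.re) (hm : 0 < m.re) :
    ∃ R : L2R →L[ℂ] L2R, IsResolventAt (maxOp (expPotential k)) (-m ^ 2) R ∧
      HasIntegralKernel R (expKernel m k) := by
  obtain ⟨c, hc, hV⟩ := exists_accretive (Or.inl hk)
  obtain ⟨u', v', C, c', h, H⟩ := isGreenPair_bessel hk hm
  exact H.exists_resolvent (continuous_expPotential k) hc hV

theorem exists_isResolventAt {k m : ℂ} (hk : 0 < k.re ∨ k = 0) (hm : 0 < m.re) :
    ∃ R : L2R →L[ℂ] L2R, IsResolventAt (maxOp (expPotential k)) (-m ^ 2) R := by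
  rcases hk with hk' | rfl
  · obtain ⟨R, hR, -⟩ := exists_resolvent_hasIntegralKernel hk' hm
    exact ⟨R, hR⟩
  · obtain ⟨c, hc, hV⟩ := exists_accretive (Or.inr (Eq.refl (0 : ℂ)))
    obtain ⟨R, hR, -⟩ := (isGreenPair_free hm).exists_resolvent (continuous_expPotential 0) hc hV
    exact ⟨R, hR⟩

theorem isClosed_maxOp_expPotential {k : ℂ} (hk : 0 < k.re ∨ k = 0) :
    (maxOp (expPotential k)).IsClosed := by
  obtain ⟨R, hR⟩ := exists_isResolventAt hk (m := 1) (by simp)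
  exact hR.isClosed

/-- A square root of `-z` is purely imaginary only if `z ∈ [0, ∞[`; otherwise one of the two roots
has positive real part. -/
theorem exists_re_pos_neg_sq_eq {z : ℂ} (hz : ¬ (0 ≤ z.re ∧ z.im = 0)) :
    ∃ m : ℂ, 0 < m.re ∧ -m ^ 2 = z := by
  obtain ⟨r, hr⟩ := IsAlgClosed.exists_pow_nat_eq (-z) (n := 2) two_pos
  have hz' : -r ^ 2 = z := by rw [hr, neg_neg]
  rcases lt_trichotomy r.re 0 with h | h | h
  · exact ⟨-r, by simpa using h, by rw [neg_sq, hz']⟩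
  · refine absurd ?_ hz
    rw [← hz']
    simp [pow_two, h, mul_self_nonneg]
  · exact ⟨r, h, hz'⟩

theorem nonpos_of_integrable_of_le {E : ℝ → ℝ} (hE : Integrable E) {a c : ℝ}
    (h : ∀ x ≤ a, c ≤ E x) : c ≤ 0 := by
  by_contra! hc
  have h1 : IntegrableOn (fun _ : ℝ => c) (Iic a) := by
    refine Integrable.mono' hE.integrableOn aestronglyMeasurable_const ?_
    rw [ae_restrict_iff' measurableSet_Iic]
    refine ae_of_all _ fun x hx => ?_
    rw [Real.norm_of_nonneg hc.le]
    exact h x hx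
  rw [integrableOn_const_iff] at h1
  simp [hc.ne'] at h1

/-- There are no positive eigenvalues. -/
theorem eq_zero_of_eigen_pos {k : ℂ} {μ : ℝ} (hμ : 0 < μ) {φ : ℝ → ℂ} (hφ : IsAC1 φ)
    (h0 : Integrable fun x => ‖φ x‖ ^ 2) (h1 : Integrable fun x => ‖deriv φ x‖ ^ 2)
    (hL : schrodingerExpr (expPotential k) φ =ᵐ[volume] fun x => (μ : ℂ) ^ 2 * φ x) (x₀ : ℝ) :
    φ x₀ = 0 := by
  have hφc := hφ.1.continuous
  have hVc := continuous_expPotential k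
  have hp : IsPrimitive (deriv φ) fun x => (expPotential k x - μ ^ 2) * φ x := by
    refine hφ.isPrimitive_deriv.congr_ae ?_
    filter_upwards [hL] with x hx
    rw [schrodingerExpr] at hx
    linear_combination -hx
  have hd2 := hp.hasDerivAt_of_continuous (by fun_prop)
  have hd1 : ∀ x, HasDerivAt φ (deriv φ x) x := fun x => (hφ.1 x).hasDerivAt
  -- The energy of the free oscillation. The potential increases it at relative rate at most `a
  -- e^{2x}`, which is integrable at `-∞`.
  set E : ℝ → ℝ := fun x => ‖deriv φ x‖ ^ 2 + μ ^ 2 * ‖φ x‖ ^ 2 with hE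
  have hEi : Integrable E := h1.add (h0.const_mul _)
  set a : ℝ := ‖k‖ ^ 2 / μ with ha
  have hdE : ∀ x, HasDerivAt E (2 * (conj (deriv φ x) * (expPotential k x * φ x)).re) x :=
    fun x => by
    have hns : ∀ {F : ℝ → ℂ} {f : ℂ}, HasDerivAt F f x →
        HasDerivAt (fun x => ‖F x‖ ^ 2) (2 * (conj (F x) * f).re) x := fun {F f} hF => by
      have h := ((hF.complex_re.pow 2).add (hF.complex_im.pow 2))
      have heq : (fun x => ‖F x‖ ^ 2) = (fun x => (F x).re ^ 2 + (F x).im ^ 2) := by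
        funext y
        rw [Complex.sq_norm, Complex.normSq_apply]
        ring
      rw [heq]
      refine h.congr_deriv ?_
      simp
      ring
    refine ((hns (hd2 x)).add ((hns (hd1 x)).const_mul (μ ^ 2))).congr_deriv ?_
    have : conj (deriv φ x) * ((expPotential k x - μ ^ 2) * φ x) =
        conj (deriv φ x) * (expPotential k x * φ x)
          - ((μ ^ 2 : ℝ) : ℂ) * (conj (deriv φ x) * φ x) := by
      push_cast
      ring
    rw [this, Complex.sub_re, Complex.re_ofReal_mul]
    simp
    ring
  have hEb : ∀ x, 2 * (conj (deriv φ x) * (expPotential k x * φ x)).re ≤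
      a * Real.exp (2 * x) * E x := fun x => by
    have h1 := Complex.re_le_norm (conj (deriv φ x) * (expPotential k x * φ x))
    rw [norm_mul, norm_mul, norm_expPotential, Complex.norm_conj] at h1
    have h2 : 2 * (‖deriv φ x‖ * ‖φ x‖) ≤ E x / μ := by
      rw [le_div_iff₀ hμ]
      have := sq_nonneg (‖deriv φ x‖ - μ * ‖φ x‖)
      simp only [hE]
      linarith
    have h3 : 0 ≤ ‖k‖ ^ 2 * Real.exp (2 * x) := by positivity
    have h4 := mul_le_mul_of_nonneg_left h2 h3
    calc _ ≤ ‖k‖ ^ 2 * Real.exp (2 * x) * (2 * (‖deriv φ x‖ * ‖φ x‖)) := by linarith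
      _ ≤ _ := h4
      _ = _ := by rw [ha]; ring
  have hE0 : ∀ x, 0 ≤ E x := fun x => by positivity
  -- Integrating factor. As `b ≤ 1`, monotonicity gives `E ≥ E x₀ * b x₀` on the half-line left of
  -- `x₀`, so integrability of `E` forces `E x₀ = 0`.
  set b : ℝ → ℝ := fun x => Real.exp (-(a / 2 * Real.exp (2 * x))) with hb
  have hanti : Antitone fun x => E x * b x := by
    have hdb : ∀ x, HasDerivAt b (b x * -(a * Real.exp (2 * x))) x := fun x => by
      have h := ((((hasDerivAt_id x).const_mul 2).exp).const_mul (a / 2)).neg.exp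
      refine h.congr_deriv ?_
      simp [hb]
      ring
    refine antitone_of_hasDerivAt_nonpos (fun x => (hdE x).mul (hdb x)) fun x => ?_
    have h1 := mul_le_mul_of_nonneg_right (hEb x) (Real.exp_pos (-(a / 2 * Real.exp (2 * x)))).le
    simp only [Pi.zero_apply, hb]
    linarith
  have hle : E x₀ * b x₀ ≤ 0 := by
    refine nonpos_of_integrable_of_le hEi (a := x₀) fun x hx => (hanti hx).trans ?_
    refine mul_le_of_le_one_right (hE0 x) ?_
    rw [hb]
    refine Real.exp_le_one_iff.2 ?_
    have : 0 ≤ a := by positivity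
    have := Real.exp_pos (2 * x)
    have : 0 ≤ a / 2 * Real.exp (2 * x) := by positivity
    linarith
  have h2 : E x₀ ≤ 0 := by
    have := Real.exp_pos (-(a / 2 * Real.exp (2 * x₀)))
    by_contra! h
    exact absurd hle (not_le.2 (mul_pos h this))
  have h3 : ‖φ x₀‖ ^ 2 ≤ 0 := by
    have h4 := sq_nonneg ‖deriv φ x₀‖
    have h5 : 0 < μ ^ 2 := by positivity
    simp only [hE] at h2
    by_contra! h
    have := mul_pos h5 h
    linarith
  exact norm_eq_zero.1 (pow_eq_zero_iff two_ne_zero |>.1 (le_antisymm h3 (sq_nonneg _)))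

/-- Zero is not an eigenvalue. -/
theorem eq_zero_of_eigen_zero {V : ℝ → ℂ} {c : ℂ} (hc : 0 < c.re)
    (hV : ∀ x, 0 ≤ (c * V x).re) {φ : ℝ → ℂ} (hφ : IsAC1 φ) (h2 : MemLp φ 2)
    (hL : schrodingerExpr V φ =ᵐ[volume] 0) (x₀ : ℝ) : φ x₀ = 0 := by
  have hLm : MemLp (schrodingerExpr V φ) 2 := (memLp_congr_ae hL).2 MemLp.zero
  obtain ⟨h1, h3⟩ := hφ.deriv_memLp h2 hLm hc hV
  have h4 : ∫ x, ‖φ x‖ * ‖schrodingerExpr V φ x‖ = 0 := by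
    refine integral_eq_zero_of_ae ?_
    filter_upwards [hL] with x hx
    simp [hx]
  rw [h4, mul_zero] at h3
  have hcont := hφ.continuous_deriv
  have h5 : (fun x => ‖deriv φ x‖ ^ 2) =ᵐ[volume] 0 :=
    (integral_eq_zero_iff_of_nonneg (fun x => by positivity) h1).1
      (le_antisymm h3 (integral_nonneg fun x => by positivity))
  have h6 : (fun x => ‖deriv φ x‖ ^ 2) = fun _ => (0 : ℝ) :=
    (Continuous.ae_eq_iff_eq volume (by fun_prop) continuous_const).1 h5
  have h7 : ∀ x, φ x = φ x₀ := fun x => is_const_of_deriv_eq_zero hφ.1 (fun y => by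
    simpa using congrFun h6 y) x x₀
  have h8 : ‖φ x₀‖ ^ 2 ≤ 0 :=
    nonpos_of_integrable_of_le h2.integrable_norm_sq (a := 0) fun x _ => by rw [h7 x]
  exact norm_eq_zero.1 (pow_eq_zero_iff two_ne_zero |>.1 (le_antisymm h8 (sq_nonneg _)))

theorem unboundedPointSpectrum_maxOp {k : ℂ} (hk : 0 < k.re ∨ k = 0) :
    unboundedPointSpectrum (maxOp (expPotential k)) = ∅ := by
  refine eq_empty_iff_forall_notMem.2 ?_
  rintro z ⟨f, hf0, hf⟩
  by_cases hz : 0 ≤ z.re ∧ z.im = 0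
  · obtain ⟨φ, hφ, h1, h2⟩ := maxOp_mem_maxGraph f
    simp only at h1 h2
    obtain ⟨c, hc, hV⟩ := exists_accretive hk
    have m1 : MemLp φ 2 := memLp_of_ae h1
    have hL : schrodingerExpr (expPotential k) φ =ᵐ[volume] fun x => z * φ x := by
      rw [hf] at h2
      filter_upwards [h1, h2, Lp.coeFn_smul z (f : L2R)] with x e1 e2 e3
      rw [← e2, e3, Pi.smul_apply, e1, smul_eq_mul]
    have m2 : MemLp (schrodingerExpr (expPotential k) φ) 2 := memLp_of_ae h2
    have hφ0 : φ = fun _ => 0 := by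
      funext x
      rcases hz.1.eq_or_lt with h0 | h0
      · refine eq_zero_of_eigen_zero hc hV hφ m1 (hL.trans (ae_of_all _ fun x => ?_)) x
        have : z = 0 := Complex.ext h0.symm hz.2
        simp [this]
      · refine eq_zero_of_eigen_pos (k := k) (Real.sqrt_pos.2 h0) hφ m1.integrable_norm_sq
          (hφ.deriv_memLp m1 m2 hc hV).1 (hL.trans (ae_of_all _ fun x => ?_)) x
        have : ((√z.re : ℝ) : ℂ) ^ 2 = z := by
          rw [← Complex.ofReal_pow, Real.sq_sqrt h0.le]
          exact Complex.ext rfl (by simpa using hz.2.symm)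
        simp only [this]
    refine hf0 ?_
    rw [Lp.eq_zero_iff_ae_eq_zero]
    rw [hφ0] at h1
    exact h1
  · obtain ⟨m, hm, rfl⟩ := exists_re_pos_neg_sq_eq hz
    obtain ⟨R, hR⟩ := exists_isResolventAt hk hm
    refine hf0 ?_
    rw [← hR.1 f, hf, sub_self, map_zero]

/-- A quasimode at energy `μ²` concentrated near `-∞`. -/
theorem exists_quasimode (k : ℂ) {μ : ℝ} (hμ : 0 ≤ μ) : ∃ C : ℝ, ∀ n : ℝ, 1 ≤ n →
    ∃ f g : L2R, (f, g) ∈ maxGraph (expPotential k) ∧ n ≤ ‖f‖ ^ 2 ∧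
      ‖g - ((μ : ℂ) ^ 2) • f‖ ^ 2 ≤ C / n := by
  obtain ⟨r, χ, χ', χ'', hχ⟩ := exists_isCutoff one_pos
  have hr : 1 ≤ r := by
    by_contra! h
    have h1 := hχ.eq_zero 1 (by simpa using h)
    have h2 := hχ.eq_one 1 (by simp)
    exact one_ne_zero (h2.symm.trans h1)
  -- Length `2 r n` of the interval containing the support, times the square of the pointwise bound
  -- `(2 + 2 μ) / n` for the residual, times `n`.
  refine ⟨2 * r * (2 + 2 * μ) ^ 2, fun n hn => ?_⟩
  have hn0 : 0 < n := by linarith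
  have hVc := continuous_expPotential k
  obtain ⟨a, ha⟩ : ∃ a : ℝ, ∀ x ≤ a, ‖expPotential k x‖ ≤ 1 / n := by
    have ht : Tendsto (fun x : ℝ => ‖k‖ ^ 2 * Real.exp (2 * x)) atBot (𝓝 0) := by
      have := (Real.tendsto_exp_atBot.comp (tendsto_id.const_mul_atBot (two_pos (α := ℝ)))).const_mul
        (‖k‖ ^ 2)
      simpa using this
    have := ht.eventually (gt_mem_nhds (show 0 < 1 / n by positivity))
    obtain ⟨a, ha⟩ := eventually_atBot.1 this
    exact ⟨a, fun x hx => by rw [norm_expPotential]; exact (ha x hx).le⟩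
  -- The shift places the right end of the supporting interval at `a`, left of which the potential
  -- is below `1 / n`.
  set s : ℝ := r * n - a with hs
  set y : ℝ → ℝ := fun x => (x + s) / n with hy
  set e : ℝ → ℂ := fun x => Complex.exp (μ * Complex.I * x) with he
  have hyc : Continuous y := by fun_prop
  have hec : Continuous e := by fun_prop
  have hχc := hχ.continuous
  have hχc' := hχ.continuous'
  have hχc'' := hχ.continuous''
  have hyd : ∀ x, HasDerivAt y (1 / n) x := fun x =>
    ((hasDerivAt_id x).add_const s).div_const n
  have hed : ∀ x, HasDerivAt e (μ * Complex.I * e x) x := fun x => by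
    have := ((Complex.ofRealCLM.hasDerivAt (x := x)).const_mul (μ * Complex.I)).cexp
    refine this.congr_deriv ?_
    simp [he]
    ring
  have hen : ∀ x, ‖e x‖ = 1 := fun x => by
    rw [he]
    simp [Complex.norm_exp]
  have hd1 : ∀ x, HasDerivAt (fun x => (χ (y x) : ℂ)) ((χ' (y x) * (1 / n) : ℝ) : ℂ) x :=
    fun x => ((hχ.hasDerivAt (y x)).comp x (hyd x)).ofReal_comp
  have hd2 : ∀ x, HasDerivAt (fun x => (χ' (y x) : ℂ)) ((χ'' (y x) * (1 / n) : ℝ) : ℂ) x :=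
    fun x => ((hχ.hasDerivAt' (y x)).comp x (hyd x)).ofReal_comp
  set φ : ℝ → ℂ := fun x => χ (y x) * e x with hφ
  set ψ : ℝ → ℂ := fun x => (1 / n) * (χ' (y x)) * e x + μ * Complex.I * (χ (y x) * e x) with hψ
  -- The residual `(L - μ²) φ`: the potential, the second derivative of the cutoff and the cross
  -- term.
  set w : ℝ → ℂ := fun x => expPotential k x * φ x - (1 / n) ^ 2 * χ'' (y x) * e x
    - 2 * μ * Complex.I * (1 / n) * χ' (y x) * e x with hw
  have hφd : ∀ x, HasDerivAt φ (ψ x) x := fun x => by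
    refine ((hd1 x).mul (hed x)).congr_deriv ?_
    simp only [hψ]
    push_cast
    ring
  have hψd : ∀ x, HasDerivAt ψ (expPotential k x * φ x - μ ^ 2 * φ x - w x) x := fun x => by
    refine ((((hd2 x).const_mul (1 / (n : ℂ))).mul (hed x)).add
      ((((hd1 x).mul (hed x))).const_mul (μ * Complex.I))).congr_deriv ?_
    simp only [hw, hφ]
    push_cast
    linear_combination (χ (y x) * e x * μ ^ 2) * Complex.I_sq
  have hout : ∀ x, r * n + |s| < |x| → r < |y x| := fun x hx => by
    rw [hy]
    simp only
    rw [abs_div, abs_of_pos hn0, lt_div_iff₀ hn0]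
    have := abs_sub_abs_le_abs_sub x (-s)
    rw [abs_neg, sub_neg_eq_add] at this
    linarith
  have hφc : Continuous φ := by fun_prop
  have hwc : Continuous w := by fun_prop
  have hφ0 : ∀ x, r < |y x| → φ x = 0 := fun x hx => by simp [hφ, hχ.eq_zero _ hx]
  have hw0 : ∀ x, r < |y x| → w x = 0 := fun x hx => by
    simp [hw, hφ0 x hx, hχ.deriv_eq_zero _ hx, hχ.deriv2_eq_zero _ hx]
  have hm : ∀ {q : ℝ → ℂ}, Continuous q → (∀ x, r < |y x| → q x = 0) → MemLp q 2 :=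
    fun {q} hq h0 => (memLp_two_iff_integrable_sq_norm hq.aestronglyMeasurable).2
      (integrable_of_continuous_of_support (by fun_prop) (r := r * n + |s|)
        fun x hx => by simp [h0 x (hout x hx)])
  have hm1 := hm hφc hφ0
  have hm2 := hm hwc hw0
  have hg : MemLp (fun x => (μ : ℂ) ^ 2 * φ x + w x) 2 :=
    hm (by fun_prop) fun x hx => by simp [hφ0 x hx, hw0 x hx]
  have e1 := hm1.coeFn_toLp
  have e2 := hg.coeFn_toLp
  refine ⟨hm1.toLp φ, hg.toLp _, ?_, ?_, ?_⟩
  · refine mem_maxGraph_of_isPrimitive hφd (IsPrimitive.of_hasDerivAt (by fun_prop) hψd) e1 ?_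
    filter_upwards [e2] with x hx
    rw [hx]
    ring
  · rw [norm_sq_eq_of_ae e1]
    have h1 : ∫ x in Icc (-n - s) (n - s), (1 : ℝ) ≤ ∫ x, ‖φ x‖ ^ 2 := by
      refine le_trans ?_ (setIntegral_le_integral (s := Icc (-n - s) (n - s))
        hm1.integrable_norm_sq (ae_of_all _ fun x => by positivity))
      refine setIntegral_mono_on (integrableOn_const (by simp))
        hm1.integrable_norm_sq.integrableOn measurableSet_Icc fun x hx => ?_
      have : χ (y x) = 1 := by
        refine hχ.eq_one _ ?_
        rw [div_one, hy]
        simp only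
        rw [abs_div, abs_of_pos hn0, div_le_one hn0, abs_le]
        exact ⟨by linarith [hx.1], by linarith [hx.2]⟩
      simp [hφ, this, hen]
    have h2 : ∫ x in Icc (-n - s) (n - s), (1 : ℝ) = 2 * n := by
      rw [setIntegral_const, smul_eq_mul, Real.volume_real_Icc_of_le (by linarith)]
      ring
    linarith
  · have e3 : (hg.toLp _ - ((μ : ℂ) ^ 2) • hm1.toLp φ : L2R) =ᵐ[volume] w := by
      filter_upwards [Lp.coeFn_sub (hg.toLp _) (((μ : ℂ) ^ 2) • hm1.toLp φ),
        Lp.coeFn_smul ((μ : ℂ) ^ 2) (hm1.toLp φ), e1, e2] with x h1 h2 h3 h4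
      rw [h1, Pi.sub_apply, h2, Pi.smul_apply, h3, h4, smul_eq_mul]
      ring
    rw [norm_sq_eq_of_ae e3]
    have hwb : ∀ x, ‖w x‖ ≤ (2 + 2 * μ) / n := fun x => by
      by_cases hx : r < |y x|
      · rw [hw0 x hx, norm_zero]
        positivity
      · have hxa : x ≤ a := by
          have h1 := (le_abs_self _).trans (not_lt.1 hx)
          rw [hy] at h1
          simp only at h1
          rw [div_le_iff₀ hn0] at h1
          linarith
        have h1 : ‖expPotential k x * φ x‖ ≤ 1 / n := by
          rw [norm_mul]
          have : ‖φ x‖ ≤ 1 := by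
            rw [hφ]
            simp only
            rw [norm_mul, hen, mul_one, Complex.norm_real, Real.norm_of_nonneg (hχ.nonneg _)]
            exact hχ.le_one _
          exact (mul_le_of_le_one_right (norm_nonneg _) this).trans (ha x hxa)
        have hin : 1 / n ≤ 1 := by rw [div_le_one hn0]; exact hn
        have hi0 : 0 < 1 / n := by positivity
        have h2 : ‖(1 / n) ^ 2 * χ'' (y x) * e x‖ ≤ 1 / n := by
          rw [norm_mul, norm_mul, hen, mul_one, norm_pow, Complex.norm_real, norm_div,
            Complex.norm_real, norm_one, Real.norm_of_nonneg hn0.le, Real.norm_eq_abs]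
          have := hχ.abs_deriv2_le (y x)
          have h5 := abs_nonneg (χ'' (y x))
          calc (1 / n) ^ 2 * |χ'' (y x)| ≤ (1 / n) ^ 2 * 1 := by gcongr
            _ ≤ 1 / n := by nlinarith
        have h3 : ‖2 * μ * Complex.I * (1 / n) * χ' (y x) * e x‖ ≤ 2 * μ * (1 / n) := by
          rw [norm_mul, norm_mul, norm_mul, norm_mul, norm_mul, hen, mul_one, Complex.norm_real,
            norm_div, Complex.norm_real, Complex.norm_real, norm_one,
            Real.norm_of_nonneg hn0.le, Real.norm_of_nonneg hμ, Complex.norm_I, mul_one,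
            Complex.norm_ofNat, Real.norm_eq_abs]
          have := hχ.abs_deriv_le (y x)
          exact mul_le_of_le_one_right (by positivity) this
        calc ‖w x‖ ≤ ‖expPotential k x * φ x‖ + ‖(1 / n) ^ 2 * χ'' (y x) * e x‖ +
            ‖2 * μ * Complex.I * (1 / n) * χ' (y x) * e x‖ :=
              (norm_sub_le _ _).trans (add_le_add_left (norm_sub_le _ _) _)
          _ ≤ 1 / n + 1 / n + 2 * μ * (1 / n) := by linarith
          _ = _ := by ring
    have h1 : ∫ x, ‖w x‖ ^ 2 =
        ∫ x in Icc (-(r * n) - s) (r * n - s), ‖w x‖ ^ 2 := by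
      refine (setIntegral_eq_integral_of_forall_compl_eq_zero fun x hx => ?_).symm
      rw [hw0 x ?_, norm_zero, zero_pow two_ne_zero]
      rw [hy]
      simp only
      rw [abs_div, abs_of_pos hn0, lt_div_iff₀ hn0]
      by_contra! h
      have := abs_le.1 h
      exact hx ⟨by linarith [this.1], by linarith [this.2]⟩
    have h2 : ∫ x in Icc (-(r * n) - s) (r * n - s), ‖w x‖ ^ 2 ≤
        ∫ x in Icc (-(r * n) - s) (r * n - s), ((2 + 2 * μ) / n) ^ 2 := by
      refine setIntegral_mono_on hm2.integrable_norm_sq.integrableOn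
        (integrableOn_const (by simp)) measurableSet_Icc fun x _ => ?_
      exact pow_le_pow_left₀ (norm_nonneg _) (hwb x) 2
    have h3 : ∫ x in Icc (-(r * n) - s) (r * n - s), ((2 + 2 * μ) / n) ^ 2 =
        2 * r * (2 + 2 * μ) ^ 2 / n := by
      rw [setIntegral_const, smul_eq_mul, Real.volume_real_Icc_of_le (by nlinarith)]
      field_simp
      ring
    rw [h1, ← h3]
    exact h2

theorem unboundedSpectrum_maxOp {k : ℂ} (hk : 0 < k.re ∨ k = 0) :
    unboundedSpectrum (maxOp (expPotential k)) = {z : ℂ | 0 ≤ z.re ∧ z.im = 0} := by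
  ext z
  constructor
  · intro hz
    by_contra h
    obtain ⟨m, hm, rfl⟩ := exists_re_pos_neg_sq_eq h
    exact hz (exists_isResolventAt hk hm)
  · rintro ⟨hz1, hz2⟩ ⟨R, hR⟩
    have hz : ((√z.re : ℝ) : ℂ) ^ 2 = z := by
      rw [← Complex.ofReal_pow, Real.sq_sqrt hz1]
      exact Complex.ext rfl (by simpa using hz2.symm)
    obtain ⟨C, hC⟩ := exists_quasimode k (Real.sqrt_nonneg z.re)
    -- A resolvent would give `n ≤ ‖f‖² ≤ ‖R‖² C / n ≤ ‖R‖² |C| = n - 1`.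
    set n : ℝ := 1 + ‖R‖ ^ 2 * |C| with hn
    have hn1 : 1 ≤ n := by
      have : 0 ≤ ‖R‖ ^ 2 * |C| := by positivity
      linarith
    obtain ⟨f, g, hfg, h1, h2⟩ := hC n hn1
    rw [hz] at h2
    obtain ⟨hf, hg⟩ := mem_maxOp_domain hfg
    have h3 := hR.1 ⟨f, hf⟩
    rw [hg] at h3
    have h4 : ‖f‖ ≤ ‖R‖ * ‖g - z • f‖ := by
      calc ‖f‖ = ‖R (g - z • f)‖ := by rw [h3]
        _ ≤ _ := R.le_opNorm _
    have h5 : ‖f‖ ^ 2 ≤ ‖R‖ ^ 2 * (C / n) := by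
      calc ‖f‖ ^ 2 ≤ (‖R‖ * ‖g - z • f‖) ^ 2 := pow_le_pow_left₀ (norm_nonneg _) h4 2
        _ = ‖R‖ ^ 2 * ‖g - z • f‖ ^ 2 := by ring
        _ ≤ _ := by gcongr
    have h6 : ‖R‖ ^ 2 * (C / n) ≤ ‖R‖ ^ 2 * |C| := by
      refine mul_le_mul_of_nonneg_left ?_ (by positivity)
      rw [div_le_iff₀ (by linarith)]
      calc C ≤ |C| := le_abs_self C
        _ ≤ |C| * n := le_mul_of_one_le_right (abs_nonneg C) hn1
    linarith

/-! ## Holomorphic dependence on the parameter -/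

/-- The two energy estimates chained together: `e^{2x} φ` is controlled by `L φ` and `φ'`, and `φ'`
by `φ` and `L φ`, that is, by the graph norm. -/
theorem exists_exp_mul_of_mem_maxGraph {k : ℂ} (hk : 0 < k.re) :
    ∃ C : ℝ, ∀ p ∈ maxGraph (expPotential k), ∃ e : L2R,
      e =ᵐ[volume] (fun x => (Real.exp (2 * x) : ℂ) * p.1 x) ∧ ‖e‖ ≤ C * ‖p‖ := by
  obtain ⟨c, hc, hV⟩ := exists_accretive (Or.inl hk)
  set D : ℝ := 2 / (k.re ^ 2 * ‖k‖ ^ 2) * (1 + 16 * (2 * ‖c‖ / c.re)) with hD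
  refine ⟨√D, ?_⟩
  rintro ⟨f, g⟩ ⟨φ, hφ, hf, hg⟩
  simp only at hf hg ⊢
  set L := schrodingerExpr (expPotential k) φ
  have m1 : MemLp φ 2 := memLp_of_ae hf
  have m2 : MemLp L 2 := memLp_of_ae hg
  obtain ⟨i1, b1⟩ := hφ.deriv_memLp m1 m2 hc hV
  obtain ⟨i2, b2⟩ := hφ.exp_mul_memLp hk m2 i1
  have hφc := hφ.1.continuous
  have m3 : MemLp (fun x => (Real.exp (2 * x) : ℂ) * φ x) 2 := by
    refine (memLp_two_iff_integrable_sq_norm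
      (Continuous.aestronglyMeasurable (by fun_prop))).2 (i2.congr (ae_of_all _ fun x => ?_))
    simp only [norm_mul, Complex.norm_real, Real.norm_eq_abs, Real.abs_exp]
  have e1 := m3.coeFn_toLp
  refine ⟨m3.toLp _, ?_, ?_⟩
  · filter_upwards [e1, hf] with x h1 h2
    rw [h1, h2]
  set N := ‖((f, g) : L2R × L2R)‖ with hN
  have hfN : ‖f‖ ≤ N := norm_fst_le (f, g)
  have hgN : ‖g‖ ≤ N := norm_snd_le (f, g)
  have n1 : ∫ x, ‖φ x‖ ^ 2 ≤ N ^ 2 := by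
    rw [← norm_sq_eq_of_ae hf]
    exact pow_le_pow_left₀ (norm_nonneg _) hfN 2
  have n2 : ∫ x, ‖L x‖ ^ 2 ≤ N ^ 2 := by
    rw [← norm_sq_eq_of_ae hg]
    exact pow_le_pow_left₀ (norm_nonneg _) hgN 2
  have n3 : ∫ x, ‖φ x‖ * ‖L x‖ ≤ N ^ 2 := by
    have h1 : ∫ x, ‖φ x‖ * ‖L x‖ ≤ ∫ x, ((1 / 2) * ‖φ x‖ ^ 2 + (1 / 2) * ‖L x‖ ^ 2) := by
      refine integral_mono (m1.integrable_norm_mul_norm m2)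
        ((m1.integrable_norm_sq.const_mul _).add (m2.integrable_norm_sq.const_mul _)) fun x => ?_
      have := sq_nonneg (‖φ x‖ - ‖L x‖)
      simp only
      linarith
    rw [integral_add (m1.integrable_norm_sq.const_mul _) (m2.integrable_norm_sq.const_mul _),
      integral_const_mul, integral_const_mul] at h1
    linarith
  have hcc : 0 ≤ 2 * ‖c‖ / c.re := by positivity
  have hsq : ‖m3.toLp _‖ ^ 2 ≤ D * N ^ 2 := by
    rw [norm_sq_eq_of_ae e1]
    have h1 : ∫ x, ‖(Real.exp (2 * x) : ℂ) * φ x‖ ^ 2 =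
        ∫ x, (Real.exp (2 * x) * ‖φ x‖) ^ 2 := by
      simp only [norm_mul, Complex.norm_real, Real.norm_eq_abs, Real.abs_exp]
    rw [h1]
    refine b2.trans ?_
    rw [hD, mul_assoc]
    refine mul_le_mul_of_nonneg_left ?_ (by positivity)
    have := mul_le_mul_of_nonneg_left n3 hcc
    linarith
  have h4 := Real.sqrt_le_sqrt hsq
  have hD0 : 0 ≤ D := by positivity
  rwa [Real.sqrt_sq (norm_nonneg _), Real.sqrt_mul hD0, Real.sqrt_sq (norm_nonneg _)] at h4

theorem mem_maxGraph_expPotential_of_mem {k l : ℂ} {f g e : L2R}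
    (h : (f, g) ∈ maxGraph (expPotential k))
    (he : e =ᵐ[volume] fun x => (Real.exp (2 * x) : ℂ) * f x) :
    (f, g + (l ^ 2 - k ^ 2) • e) ∈ maxGraph (expPotential l) := by
  obtain ⟨φ, hφ, h1, h2⟩ := h
  refine ⟨φ, hφ, h1, ?_⟩
  simp only at h1 h2 ⊢
  filter_upwards [h1, h2, he, Lp.coeFn_add g ((l ^ 2 - k ^ 2) • e),
    Lp.coeFn_smul (l ^ 2 - k ^ 2) e] with x e1 e2 e3 e4 e5
  rw [e4, Pi.add_apply, e5, Pi.smul_apply, e2, e3, e1, schrodingerExpr, schrodingerExpr,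
    expPotential, expPotential, smul_eq_mul]
  ring

theorem exists_expMul : ∃ E : maxGraph (expPotential 1) →L[ℂ] L2R,
    ∀ p, E p =ᵐ[volume] fun x => (Real.exp (2 * x) : ℂ) * p.1.1 x := by
  obtain ⟨C, hC⟩ := exists_exp_mul_of_mem_maxGraph (k := 1) (by simp)
  choose e he hn using fun p : maxGraph (expPotential 1) => hC p.1 p.2
  refine ⟨LinearMap.mkContinuous
    { toFun := e
      map_add' := fun p q => ?_
      map_smul' := fun c p => ?_ } C hn, he⟩
  · apply Lp.ext
    filter_upwards [he (p + q), he p, he q, Lp.coeFn_add (e p) (e q),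
      Lp.coeFn_add p.1.1 q.1.1] with x h1 h2 h3 h4 h5
    rw [h1, h4, Pi.add_apply, h2, h3]
    change _ * (p.1.1 + q.1.1 : L2R) x = _
    rw [h5, Pi.add_apply]
    ring
  · apply Lp.ext
    filter_upwards [he (c • p), he p, Lp.coeFn_smul c (e p), Lp.coeFn_smul c p.1.1]
      with x h1 h2 h3 h4
    rw [RingHom.id_apply, h1, h3, Pi.smul_apply, h2]
    change _ * (c • p.1.1 : L2R) x = _
    rw [h4, Pi.smul_apply, smul_eq_mul, smul_eq_mul]
    ring

theorem completeSpace_maxGraph : CompleteSpace (maxGraph (expPotential 1)) := by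
  have h := isClosed_maxOp_expPotential (k := 1) (Or.inl (by simp))
  rw [LinearPMap.IsClosed, maxOp_graph] at h
  exact h.completeSpace_coe

theorem differentiable_add_sq_smul {G H : Type*} [NormedAddCommGroup G] [NormedSpace ℂ G]
    [NormedAddCommGroup H] [NormedSpace ℂ H] (T E : G →L[ℂ] H) :
    Differentiable ℂ fun k : ℂ => T + (k ^ 2 - 1 ^ 2) • E := by
  fun_prop

/-- A Banach space that parametrizes the domains of all the operators with parameter in the right
half-plane, namely the graph of the operator with parameter `1`. -/
theorem exists_parametrization : ∃ (G : Type) (_ : NormedAddCommGroup G) (_ : NormedSpace ℂ G)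
    (_ : CompleteSpace G) (S : G →L[ℂ] L2R) (W : ℂ → G →L[ℂ] L2R),
      Function.Injective S ∧ Differentiable ℂ W ∧
      (∀ k u, (S u, W k u) ∈ maxGraph (expPotential k)) ∧
      ∀ k : ℂ, 0 < k.re → ∀ f g, (f, g) ∈ maxGraph (expPotential k) → ∃ u, S u = f ∧ W k u = g := by
  obtain ⟨E, hE⟩ := exists_expMul
  refine ⟨maxGraph (expPotential 1), inferInstance, inferInstance, completeSpace_maxGraph,
    (ContinuousLinearMap.fst ℂ L2R L2R).comp (maxGraph (expPotential 1)).subtypeL,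
    fun k => (ContinuousLinearMap.snd ℂ L2R L2R).comp (maxGraph (expPotential 1)).subtypeL +
      (k ^ 2 - 1 ^ 2) • E, ?_, differentiable_add_sq_smul _ E, fun k u => ?_, fun k hk f g h => ?_⟩
  · rintro ⟨⟨f, g⟩, hp⟩ ⟨⟨f', g'⟩, hq⟩ h
    have h : f = f' := h
    subst h
    obtain ⟨hf, h1⟩ := mem_maxOp_domain hp
    obtain ⟨_, h2⟩ := mem_maxOp_domain hq
    have h3 : g = g' := h1.symm.trans h2
    subst h3
    rfl
  · exact mem_maxGraph_expPotential_of_mem u.2 (hE u)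
  · obtain ⟨C, hC⟩ := exists_exp_mul_of_mem_maxGraph hk
    obtain ⟨e, he, -⟩ := hC _ h
    have h1 := mem_maxGraph_expPotential_of_mem (l := 1) h he
    refine ⟨⟨_, h1⟩, rfl, ?_⟩
    have h2 : E ⟨_, h1⟩ = e := Lp.ext ((hE ⟨_, h1⟩).trans he.symm)
    change g + (1 ^ 2 - k ^ 2) • e + (k ^ 2 - 1 ^ 2) • E ⟨_, h1⟩ = g
    rw [h2, add_assoc, ← add_smul]
    simp

theorem isHolomorphicFamily_maxOp :
    IsHolomorphicFamily {k : ℂ | 0 < k.re} (fun k => maxOp (expPotential k)) := by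
  refine ⟨fun k hk => isClosed_maxOp_expPotential (Or.inl hk), fun k₀ hk₀ => ?_⟩
  obtain ⟨G, _, _, _, S, W, hS, hW, hmem, hex⟩ := exists_parametrization
  refine ⟨_, isOpen_re_pos, hk₀, Subset.rfl, G, inferInstance, inferInstance, inferInstance, fun _ => S, W, differentiableOn_const _,
    hW.differentiableOn, fun k hk => ⟨hS, ?_, fun u f hf => ?_⟩⟩
  · ext f
    constructor
    · rintro ⟨u, rfl⟩
      exact (mem_maxOp_domain (hmem k u)).1
    · intro hf
      obtain ⟨u, hu, -⟩ := hex k hk _ _ (maxOp_mem_maxGraph ⟨f, hf⟩)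
      exact ⟨u, hu⟩
  · obtain ⟨h1, h2⟩ := mem_maxOp_domain (hmem k u)
    rw [← h2]
    congr 1
    exact Subtype.ext hf

/-- On the parametrizing space `A k = W k - z S` is a holomorphic family of bijections onto `L²`,
and `R k = S ∘ (A k)⁻¹`; inversion of bounded operators is differentiable. -/
theorem differentiableOn_resolvent {z : ℂ} {R : ℂ → L2R →L[ℂ] L2R}
    (hR : ∀ k : ℂ, 0 < k.re → IsResolventAt (maxOp (expPotential k)) z (R k)) :
    DifferentiableOn ℂ R {k : ℂ | 0 < k.re} := by
  obtain ⟨G, _, _, _, S, W, hS, hW, hmem, hex⟩ := exists_parametrization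
  set A : ℂ → G →L[ℂ] L2R := fun k => W k - z • S with hA
  have hAd : Differentiable ℂ A := fun k =>
    (hW k).sub (differentiableAt_const (z • S))
  have hRA : ∀ k : ℂ, 0 < k.re → ∀ u, R k (A k u) = S u := fun k hk u => by
    obtain ⟨h1, h2⟩ := mem_maxOp_domain (hmem k u)
    have := (hR k hk).1 ⟨S u, h1⟩
    rw [h2] at this
    exact this
  have hbij : ∀ k : ℂ, 0 < k.re → Function.Bijective (A k) := fun k hk => by
    refine ⟨fun u v huv => hS ?_, fun g => ?_⟩
    · rw [← hRA k hk, ← hRA k hk, huv]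
    · obtain ⟨f, -, h2⟩ := (hR k hk).2 g
      obtain ⟨u, hu1, hu2⟩ := hex k hk _ _ (maxOp_mem_maxGraph f)
      refine ⟨u, ?_⟩
      rw [← h2, ← hu1, ← hu2]
      rfl
  let e : ∀ k : ℂ, 0 < k.re → G ≃L[ℂ] L2R := fun k hk =>
    ContinuousLinearEquiv.ofBijective (A k) (LinearMap.ker_eq_bot.2 (hbij k hk).1)
      (LinearMap.range_eq_top.2 (hbij k hk).2)
  have he : ∀ k hk, (e k hk : G →L[ℂ] L2R) = A k := fun k hk =>
    ContinuousLinearMap.ext fun u => rfl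
  have hRe : ∀ k : ℂ, 0 < k.re → R k = S.comp (ContinuousLinearMap.inverse (A k)) :=
    fun k hk => by
    refine ContinuousLinearMap.ext fun g => ?_
    obtain ⟨u, rfl⟩ := (hbij k hk).2 g
    rw [hRA k hk, ← he k hk, ContinuousLinearMap.inverse_equiv]
    simp
  refine DifferentiableOn.congr (fun k hk => ?_) hRe
  refine DifferentiableAt.differentiableWithinAt ?_
  have h1 : DifferentiableAt ℂ ContinuousLinearMap.inverse (A k) := by
    rw [← he k hk]
    exact (contDiffAt_map_inverse (n := 1) (e k hk)).differentiableAt one_ne_zero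
  have h2 : DifferentiableAt ℂ (fun k => ContinuousLinearMap.inverse (A k)) k :=
    h1.comp k (hAd k)
  exact (differentiableAt_const S).clm_comp h2

/-! ## Translations and scaling of the parameter -/

theorem IsPrimitive.comp_add_right {F f : ℝ → ℂ} (hF : IsPrimitive F f) (τ : ℝ) :
    IsPrimitive (fun x => F (x + τ)) fun x => f (x + τ) := by
  have hi : ∀ a b : ℝ, IntervalIntegrable (fun x => f (x + τ)) volume a b := fun a b => by
    have := (hF.intervalIntegrable (a + τ) (b + τ)).comp_add_right τ
    simpa using this
  refine IsPrimitive.of_integral (fun x => ?_) fun x => ?_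
  · exact ⟨Ioc (x - 1) (x + 1), Ioc_mem_nhds (by linarith) (by linarith),
      (intervalIntegrable_iff_integrableOn_Ioc_of_le (by linarith)).1 (hi (x - 1) (x + 1))⟩
  · rw [intervalIntegral.integral_comp_add_right, hF.integral_eq_sub]
    ring

/-- The translation `f ↦ f (· + τ)` on `L²(ℝ)`. -/
noncomputable def translation (τ : ℝ) : L2R →L[ℂ] L2R :=
  (Lp.compMeasurePreservingₗᵢ ℂ (fun x : ℝ => x + τ)
    (measurePreserving_add_right volume τ)).toContinuousLinearMap

theorem translation_ae_eq (τ : ℝ) (f : L2R) :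
    translation τ f =ᵐ[volume] fun x => f (x + τ) :=
  Lp.coeFn_compMeasurePreserving f (measurePreserving_add_right volume τ)

theorem norm_translation_le (τ : ℝ) : ‖translation τ‖ ≤ 1 :=
  LinearIsometry.norm_toContinuousLinearMap_le _

theorem ae_comp_add_right {p : ℝ → Prop} (h : ∀ᵐ x, p x) (τ : ℝ) : ∀ᵐ x, p (x + τ) :=
  (measurePreserving_add_right volume τ).quasiMeasurePreserving.ae h

theorem translation_translation_neg (τ : ℝ) (f : L2R) :
    translation τ (translation (-τ) f) = f := by
  apply Lp.ext
  filter_upwards [translation_ae_eq τ (translation (-τ) f),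
    ae_comp_add_right (translation_ae_eq (-τ) f) τ] with x h1 h2
  rw [h1, h2, add_neg_cancel_right]

theorem expPotential_add (k : ℂ) (τ x : ℝ) :
    expPotential k (x + τ) = expPotential (Real.exp τ * k) x := by
  rw [expPotential, expPotential, mul_add, Real.exp_add, show 2 * τ = τ + τ by ring, Real.exp_add]
  push_cast
  ring

theorem expPotential_neg (k : ℂ) : expPotential (-k) = expPotential k := by
  funext x
  rw [expPotential, expPotential, neg_sq]

theorem translation_mem_maxGraph {k : ℂ} {f g : L2R} (h : (f, g) ∈ maxGraph (expPotential k))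
    (τ : ℝ) : (translation τ f, translation τ g) ∈ maxGraph (expPotential (Real.exp τ * k)) := by
  obtain ⟨φ, hφ, h1, h2⟩ := h
  refine mem_maxGraph_of_isPrimitive (φ := fun x => φ (x + τ))
    (fun x => (hφ.1 (x + τ)).hasDerivAt.comp_add_const x τ)
    (hφ.isPrimitive_deriv.comp_add_right τ) ?_ ?_
  · filter_upwards [translation_ae_eq τ f, ae_comp_add_right h1 τ] with x e1 e2
    rw [e1, e2]
  · filter_upwards [translation_ae_eq τ g, ae_comp_add_right h2 τ] with x e1 e2
    rw [e1, e2, schrodingerExpr, expPotential_add]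

theorem IsResolventAt.mem_maxGraph {V : ℝ → ℂ} {z : ℂ} {R : L2R →L[ℂ] L2R}
    (hR : IsResolventAt (maxOp V) z R) (g : L2R) : (R g, g + z • R g) ∈ maxGraph V := by
  obtain ⟨f, h1, h2⟩ := hR.2 g
  have h3 := maxOp_mem_maxGraph f
  rw [sub_eq_iff_eq_add.1 h2, h1] at h3
  exact h3

theorem IsResolventAt.apply_sub {V : ℝ → ℂ} {z : ℂ} {R : L2R →L[ℂ] L2R}
    (hR : IsResolventAt (maxOp V) z R) {f g : L2R} (h : (f, g) ∈ maxGraph V) :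
    R (g - z • f) = f := by
  obtain ⟨hf, hg⟩ := mem_maxOp_domain h
  have := hR.1 ⟨f, hf⟩
  rwa [hg] at this

/-! ### The imaginary axis as a natural boundary of the resolvent -/

section Extension

variable {z : ℂ} {R : ℂ → L2R →L[ℂ] L2R}

/-- Scaling the parameter is implemented by translations. -/
theorem resolvent_exp_mul
    (hR : ∀ k : ℂ, 0 < k.re → IsResolventAt (maxOp (expPotential k)) z (R k)) {k : ℂ}
    (hk : 0 < k.re) (τ : ℝ) :
    R (Real.exp τ * k) = (translation τ).comp ((R k).comp (translation (-τ))) := by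
  have hk' : 0 < (Real.exp τ * k).re := by
    rw [Complex.re_ofReal_mul]
    exact mul_pos (Real.exp_pos τ) hk
  refine ContinuousLinearMap.ext fun g => ?_
  have h1 := translation_mem_maxGraph ((hR k hk).mem_maxGraph (translation (-τ) g)) τ
  rw [map_add, map_smul, translation_translation_neg] at h1
  have h2 := (hR _ hk').apply_sub h1
  rw [add_sub_cancel_right] at h2
  exact h2

/-- The even extension of the resolvent to the left half-plane. -/
noncomputable def evenResolvent (R : ℂ → L2R →L[ℂ] L2R) (k : ℂ) : L2R →L[ℂ] L2R :=
  if 0 < k.re then R k else R (-k)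

theorem evenResolvent_isResolventAt
    (hR : ∀ k : ℂ, 0 < k.re → IsResolventAt (maxOp (expPotential k)) z (R k)) {k : ℂ}
    (hk : k.re ≠ 0) : IsResolventAt (maxOp (expPotential k)) z (evenResolvent R k) := by
  rw [evenResolvent]
  split_ifs with h
  · exact hR k h
  · have := hR (-k) (by
      rw [Complex.neg_re]
      exact neg_pos.2 (lt_of_le_of_ne (not_lt.1 h) hk))
    rwa [expPotential_neg] at this

theorem evenResolvent_neg {k : ℂ} (hk : k.re ≠ 0) : evenResolvent R (-k) = evenResolvent R k := by
  rw [evenResolvent, evenResolvent, neg_neg, Complex.neg_re]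
  rcases lt_or_gt_of_ne hk with h | h
  · rw [if_pos (neg_pos.2 h), if_neg h.le.not_gt]
  · rw [if_neg (by linarith), if_pos h]

theorem isOpen_re_ne_zero : IsOpen {k : ℂ | k.re ≠ 0} :=
  isOpen_ne_fun Complex.continuous_re continuous_const

theorem differentiableAt_evenResolvent
    (hR : ∀ k : ℂ, 0 < k.re → IsResolventAt (maxOp (expPotential k)) z (R k)) {k : ℂ}
    (hk : k.re ≠ 0) : DifferentiableAt ℂ (evenResolvent R) k := by
  have hd := differentiableOn_resolvent hR
  rcases lt_or_gt_of_ne hk with h | h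
  · have h1 : DifferentiableAt ℂ (fun k => R (-k)) k :=
      (hd.differentiableAt (isOpen_re_pos.mem_nhds (x := -k) (by simpa using h))).comp k
        (f := fun k : ℂ => -k) differentiableAt_fun_id.neg
    refine h1.congr_of_eventuallyEq ?_
    filter_upwards [(isOpen_lt Complex.continuous_re continuous_const).mem_nhds h] with l hl
    exact if_neg (not_lt.2 (le_of_lt hl))
  · refine (hd.differentiableAt (isOpen_re_pos.mem_nhds h)).congr_of_eventuallyEq ?_
    filter_upwards [isOpen_re_pos.mem_nhds h] with l hl
    exact if_pos hl

/-- Positive factors act by translations, and a sign is harmless by evenness, so all nonzero real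
rescalings act. -/
theorem evenResolvent_ofReal_mul
    (hR : ∀ k : ℂ, 0 < k.re → IsResolventAt (maxOp (expPotential k)) z (R k)) {k : ℂ}
    (hk : k.re ≠ 0) {s : ℝ} (hs : s ≠ 0) : evenResolvent R (s * k) =
      (translation (Real.log |s|)).comp ((evenResolvent R k).comp (translation (-Real.log |s|))) := by
  have hpos : ∀ {l : ℂ}, 0 < l.re → ∀ {t : ℝ}, 0 < t → evenResolvent R (t * l) =
      (translation (Real.log t)).comp ((evenResolvent R l).comp (translation (-Real.log t))) := by
    intro l hl t ht
    have h1 : 0 < (t * l).re := by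
      rw [Complex.re_ofReal_mul]
      exact mul_pos ht hl
    rw [evenResolvent, evenResolvent, if_pos h1, if_pos hl, ← resolvent_exp_mul hR hl,
      Real.exp_log ht]
  have habs : ∀ {l : ℂ}, 0 < l.re → evenResolvent R (s * l) =
      (translation (Real.log |s|)).comp
        ((evenResolvent R l).comp (translation (-Real.log |s|))) := by
    intro l hl
    rcases lt_or_gt_of_ne hs with h | h
    · have h1 : (s * l).re ≠ 0 := by
        rw [Complex.re_ofReal_mul]
        exact mul_ne_zero hs hl.ne'
      rw [abs_of_neg h, ← hpos hl (neg_pos.2 h), ← evenResolvent_neg h1]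
      push_cast
      rw [neg_mul]
    · rw [abs_of_pos h, hpos hl h]
  rcases lt_or_gt_of_ne hk with h | h
  · have h1 : (s * k).re ≠ 0 := by
      rw [Complex.re_ofReal_mul]
      exact mul_ne_zero hs hk
    rw [← evenResolvent_neg h1, ← evenResolvent_neg hk, ← mul_neg, habs (by simpa using h)]
  · exact habs h

theorem norm_evenResolvent_ofReal_mul_le
    (hR : ∀ k : ℂ, 0 < k.re → IsResolventAt (maxOp (expPotential k)) z (R k)) {k : ℂ}
    (hk : k.re ≠ 0) {s : ℝ} (hs : s ≠ 0) :
    ‖evenResolvent R (s * k)‖ ≤ ‖evenResolvent R k‖ := by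
  rw [evenResolvent_ofReal_mul hR hk hs]
  refine (ContinuousLinearMap.opNorm_comp_le _ _).trans ?_
  refine (mul_le_of_le_one_left (norm_nonneg _) (norm_translation_le _)).trans ?_
  refine (ContinuousLinearMap.opNorm_comp_le _ _).trans ?_
  exact mul_le_of_le_one_right (norm_nonneg _) (norm_translation_le _)

/-- A holomorphic extension of the resolvent to a connected domain is even. -/
theorem eq_evenResolvent_of_extension
    (hR : ∀ k : ℂ, 0 < k.re → IsResolventAt (maxOp (expPotential k)) z (R k))
    {Ω : Set ℂ} {F : ℂ → L2R →L[ℂ] L2R} (hΩ : IsOpen Ω) (hc : IsPreconnected Ω)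
    (hsub : {k : ℂ | 0 < k.re} ⊆ Ω) (hF : DifferentiableOn ℂ F Ω)
    (hFR : ∀ k : ℂ, 0 < k.re → F k = R k) {k : ℂ} (hk : k ∈ Ω) (hk0 : k.re ≠ 0) :
    F k = evenResolvent R k := by
  obtain ⟨G, _, _, _, S, W, hS, hW, hmem, hex⟩ := exists_parametrization
  -- The left-inverse identity holds on the right half-plane and makes sense for all `k`, since `W`
  -- is entire; analytic continuation carries it over `Ω`.
  have key : ∀ u : G, F k (W k u - z • S u) = S u := fun u => by
    have h1 : DifferentiableOn ℂ (fun k => F k (W k u - z • S u)) Ω := by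
      refine hF.clm_apply (DifferentiableOn.sub_const (fun k _ => ?_) _)
      exact ((hW k).clm_apply (differentiableAt_const u)).differentiableWithinAt
    have h2 : (1 : ℂ) ∈ {k : ℂ | 0 < k.re} := by simp
    refine (h1.analyticOnNhd hΩ).eqOn_of_preconnected_of_eventuallyEq
      (analyticOnNhd_const (v := S u)) hc (hsub h2) ?_ hk
    filter_upwards [isOpen_re_pos.mem_nhds h2] with l hl
    rw [hFR l hl]
    exact (hR l hl).apply_sub (hmem l u)
  have hE := evenResolvent_isResolventAt hR hk0
  refine ContinuousLinearMap.ext fun g => ?_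
  have hm := hE.mem_maxGraph g
  -- For `Re k < 0` the domain is that of the operator at `-k`, which has the same potential, so it
  -- too is exhausted by the parametrization.
  obtain ⟨u, hu1, hu2⟩ : ∃ u, S u = evenResolvent R k g ∧
      W k u = g + z • evenResolvent R k g := by
    rcases lt_or_gt_of_ne hk0 with h | h
    · rw [← expPotential_neg] at hm
      obtain ⟨u, hu1, hu2⟩ := hex (-k) (by simpa using h) _ _ hm
      have h3 := hmem k u
      rw [← expPotential_neg, hu1] at h3
      obtain ⟨_, e1⟩ := mem_maxOp_domain hm
      obtain ⟨_, e2⟩ := mem_maxOp_domain h3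
      exact ⟨u, hu1, e2.symm.trans e1⟩
    · exact hex k h _ _ hm
  have h4 := key u
  rw [hu1, hu2, add_sub_cancel_right] at h4
  exact h4

/-- The real part takes the value zero on `Ω` by the intermediate value theorem; should this happen
at the origin, openness supplies a nearby nonzero imaginary point. -/
theorem exists_re_eq_zero_of_isConnected {Ω : Set ℂ} (hΩ : IsOpen Ω) (hc : IsPreconnected Ω)
    (hsub : {k : ℂ | 0 < k.re} ⊂ Ω) : ∃ b ∈ Ω, b.re = 0 ∧ b ≠ 0 := by
  obtain ⟨hsub1, hsub2⟩ := hsub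
  obtain ⟨w, hw, hw0⟩ := not_subset.1 hsub2
  have h1 : (1 : ℂ) ∈ Ω := hsub1 (by simp)
  obtain ⟨b, hb, hb0⟩ := hc.intermediate_value hw h1 Complex.continuous_re.continuousOn
    (show (0 : ℝ) ∈ Icc w.re (1 : ℂ).re from ⟨not_lt.1 hw0, by simp⟩)
  by_cases h : b = 0
  · subst h
    obtain ⟨ε, hε, hball⟩ := Metric.isOpen_iff.1 hΩ 0 hb
    refine ⟨(ε / 2 : ℝ) * Complex.I, hball ?_, by simp, ?_⟩
    · rw [Metric.mem_ball, dist_zero_right, norm_mul, Complex.norm_I, mul_one, Complex.norm_real,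
        Real.norm_of_nonneg (by positivity)]
      linarith
    · simp [hε.ne']
  · exact ⟨b, hb, hb0, h⟩

theorem neBot_nhdsWithin_re_ne_zero (k : ℂ) : (𝓝[{l : ℂ | l.re ≠ 0}] k).NeBot := by
  rw [← mem_closure_iff_nhdsWithin_neBot]
  have h : closure {x : ℝ | x ≠ 0} = univ := (dense_compl_singleton (0 : ℝ)).closure_eq
  have h2 := Complex.closure_preimage_re {x : ℝ | x ≠ 0}
  rw [h, preimage_univ] at h2
  exact h2.ge (mem_univ k)

/-- Extension of a holomorphic function across the imaginary axis by limits. -/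
theorem exists_extension {E : Type*} [NormedAddCommGroup E] [NormedSpace ℂ E] {Q : ℂ → E}
    (hQ : ∀ k : ℂ, k.re ≠ 0 → DifferentiableAt ℂ Q k)
    (hloc : ∀ k : ℂ, k ≠ 0 → k.re = 0 → ∃ N ∈ 𝓝 k, ∃ H : ℂ → E,
      DifferentiableOn ℂ H N ∧ ∀ l ∈ N, l.re ≠ 0 → H l = Q l) :
    ∃ P : ℂ → E, (∀ k, k ≠ 0 → DifferentiableAt ℂ P k) ∧ ∀ k : ℂ, k.re ≠ 0 → P k = Q k := by
  classical
  set P : ℂ → E := fun k => if k.re ≠ 0 then Q k else limUnder (𝓝[{l : ℂ | l.re ≠ 0}] k) Q with hP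
  have hPQ : ∀ k : ℂ, k.re ≠ 0 → P k = Q k := fun k hk => if_pos hk
  refine ⟨P, fun k hk => ?_, hPQ⟩
  by_cases h0 : k.re = 0
  · obtain ⟨N, hN, H, hH, hHQ⟩ := hloc k hk h0
    obtain ⟨N', hN', hN'o, hkN⟩ := mem_nhds_iff.1 hN
    have hHd : ∀ l ∈ N', DifferentiableAt ℂ H l := fun l hl =>
      hH.differentiableAt (mem_of_superset (hN'o.mem_nhds hl) hN')
    refine (hHd k hkN).congr_of_eventuallyEq ?_
    filter_upwards [hN'o.mem_nhds hkN] with l hl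
    by_cases hl0 : l.re = 0
    · have := neBot_nhdsWithin_re_ne_zero l
      rw [hP]
      simp only [hl0, ne_eq, not_true_eq_false, if_false]
      refine Tendsto.limUnder_eq ?_
      refine ((hHd l hl).continuousAt.tendsto.mono_left nhdsWithin_le_nhds).congr' ?_
      filter_upwards [self_mem_nhdsWithin, nhdsWithin_le_nhds (hN'o.mem_nhds hl)] with p hp1 hp2
      exact hHQ p (hN' hp2) hp1
    · rw [hPQ l hl0, hHQ l (hN' hl) hl0]
  · refine (hQ k h0).congr_of_eventuallyEq ?_
    filter_upwards [isOpen_re_ne_zero.mem_nhds h0] with l hl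
    exact hPQ l hl

/-- The resolvent is not constant in the parameter. -/
theorem resolvent_one_ne_two
    (hR : ∀ k : ℂ, 0 < k.re → IsResolventAt (maxOp (expPotential k)) z (R k)) : R 1 ≠ R 2 := by
  intro h
  have h1 := hR 1 (by simp)
  have h2 := hR 2 (by simp)
  obtain ⟨C, hC⟩ := exists_exp_mul_of_mem_maxGraph (k := 1) (by simp)
  have hz : ∀ g, R 1 g = 0 := fun g => by
    have m1 := h1.mem_maxGraph g
    have m2 := h2.mem_maxGraph g
    rw [← h] at m2
    obtain ⟨e, he, -⟩ := hC _ m1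
    obtain ⟨_, e1⟩ := mem_maxOp_domain (mem_maxGraph_expPotential_of_mem (l := 2) m1 he)
    obtain ⟨_, e2⟩ := mem_maxOp_domain m2
    -- On the common range the two operators agree, so their difference `3 e^{2x}` annihilates `R 1
    -- g`, and hence `R 1 g = 0`.
    have e3 : ((2 : ℂ) ^ 2 - 1 ^ 2) • e = 0 := by
      have := e1.symm.trans e2
      rwa [add_eq_left] at this
    have e4 : e = 0 := (smul_eq_zero.1 e3).resolve_left (by norm_num)
    rw [Lp.eq_zero_iff_ae_eq_zero]
    rw [e4] at he
    filter_upwards [he, Lp.coeFn_zero ℂ 2 (volume : Measure ℝ)] with x a1 a2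
    rw [a1] at a2
    exact (mul_eq_zero.1 a2).resolve_left (by exact_mod_cast (Real.exp_pos (2 * x)).ne')
  obtain ⟨C', hC'⟩ := exists_quasimode 1 (le_refl (0 : ℝ))
  obtain ⟨f, g, hfg, hf, -⟩ := hC' 1 le_rfl
  have h3 := h1.apply_sub hfg
  rw [hz] at h3
  rw [← h3] at hf
  norm_num at hf

theorem not_exists_extension
    (hR : ∀ k : ℂ, 0 < k.re → IsResolventAt (maxOp (expPotential k)) z (R k)) :
    ¬ ∃ (Ω : Set ℂ) (F : ℂ → L2R →L[ℂ] L2R),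
      IsOpen Ω ∧ IsConnected Ω ∧ {k : ℂ | 0 < k.re} ⊂ Ω ∧
      DifferentiableOn ℂ F Ω ∧ ∀ k : ℂ, 0 < k.re → F k = R k := by
  rintro ⟨Ω, F, hΩ, hc, hsub, hF, hFR⟩
  obtain ⟨b, hbΩ, hb0, hb⟩ := exists_re_eq_zero_of_isConnected hΩ hc.isPreconnected hsub
  have hFE : ∀ k ∈ Ω, k.re ≠ 0 → F k = evenResolvent R k := fun k hk hk0 =>
    eq_evenResolvent_of_extension hR hΩ hc.isPreconnected hsub.1 hF hFR hk hk0
  have hbi : b.im ≠ 0 := fun h => hb (Complex.ext hb0 h)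
  obtain ⟨P, hP, hPE⟩ := exists_extension (Q := evenResolvent R)
    (fun k hk => differentiableAt_evenResolvent hR hk) fun k hk hk0 => by
      have hki : k.im ≠ 0 := fun h => hk (Complex.ext hk0 h)
      -- A real multiple, of either sign, takes the crossing point `b` to the given imaginary point
      -- `k`; the conjugated and rescaled `F` is the local extension there.
      set s : ℝ := k.im / b.im with hs
      have hs0 : s ≠ 0 := div_ne_zero hki hbi
      have hsk : k = s * b := by
        refine Complex.ext (by simp [hk0, hb0]) ?_
        rw [Complex.im_ofReal_mul, hs]
        field_simp
      have hcont : Continuous fun l : ℂ => (s⁻¹ : ℝ) * l := by fun_prop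
      refine ⟨(fun l : ℂ => (s⁻¹ : ℝ) * l) ⁻¹' Ω, ?_, fun l => (translation (Real.log |s|)).comp
        ((F ((s⁻¹ : ℝ) * l)).comp (translation (-Real.log |s|))), ?_, fun l hl hl0 => ?_⟩
      · refine hcont.continuousAt.preimage_mem_nhds (hΩ.mem_nhds ?_)
        rw [hsk, ← mul_assoc, ← Complex.ofReal_mul, inv_mul_cancel₀ hs0]
        simpa using hbΩ
      · have h1 : DifferentiableOn ℂ (fun l : ℂ => F ((s⁻¹ : ℝ) * l))
            ((fun l : ℂ => (s⁻¹ : ℝ) * l) ⁻¹' Ω) :=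
          hF.comp (f := fun l : ℂ => (s⁻¹ : ℝ) * l) (by fun_prop) fun l hl => hl
        exact (differentiableOn_const _).clm_comp (h1.clm_comp (differentiableOn_const _))
      · have h1 : ((s⁻¹ : ℝ) * l).re ≠ 0 := by
          rw [Complex.re_ofReal_mul]
          exact mul_ne_zero (inv_ne_zero hs0) hl0
        have h2 : F ((s⁻¹ : ℝ) * l) = evenResolvent R ((s⁻¹ : ℝ) * l) := hFE _ hl h1
        simp only [h2]
        rw [← evenResolvent_ofReal_mul hR h1 hs0, ← mul_assoc, ← Complex.ofReal_mul,
          mul_inv_cancel₀ hs0, Complex.ofReal_one, one_mul]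
  have hcont : ContinuousOn (fun k => ‖P k‖) (Metric.sphere 0 1) := fun k hk => by
    refine (hP k ?_).continuousAt.norm.continuousWithinAt
    rintro rfl
    simp at hk
  obtain ⟨C, hC⟩ := ((isCompact_sphere (0 : ℂ) 1).bddAbove_image hcont)
  -- Rescaling to modulus one does not decrease the norm, so the maximum on the unit circle bounds
  -- `P`; continuity extends this to the imaginary axis.
  have hbound0 : ∀ k : ℂ, k.re ≠ 0 → ‖P k‖ ≤ C := fun k hk => by
    have hk0 : k ≠ 0 := by rintro rfl; simp at hk
    have hn : ‖k‖ ≠ 0 := norm_ne_zero_iff.2 hk0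
    have h1 : (((‖k‖⁻¹ : ℝ) : ℂ) * k).re ≠ 0 := by
      rw [Complex.re_ofReal_mul]
      exact mul_ne_zero (inv_ne_zero hn) hk
    have h2 := norm_evenResolvent_ofReal_mul_le hR h1 hn
    rw [← mul_assoc, ← Complex.ofReal_mul, mul_inv_cancel₀ hn, Complex.ofReal_one, one_mul] at h2
    rw [hPE k hk]
    refine h2.trans ?_
    rw [← hPE _ h1]
    refine hC (mem_image_of_mem _ ?_)
    rw [mem_sphere_zero_iff_norm, norm_mul, Complex.norm_real, norm_inv, norm_norm,
      inv_mul_cancel₀ hn]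
  have hbound : ∀ k : ℂ, k ≠ 0 → ‖P k‖ ≤ C := fun k hk => by
    have := neBot_nhdsWithin_re_ne_zero k
    refine le_of_tendsto ((hP k hk).continuousAt.norm.tendsto.mono_left
      (nhdsWithin_le_nhds (s := {l : ℂ | l.re ≠ 0}))) ?_
    filter_upwards [self_mem_nhdsWithin] with l hl using hbound0 l hl
  -- Composition with `exp` avoids the puncture at the origin, so Liouville's theorem applies
  -- without a removable-singularity argument.
  have hd : Differentiable ℂ fun w => P (Complex.exp w) := fun w =>
    (hP _ (Complex.exp_ne_zero w)).comp w Complex.differentiable_exp.differentiableAt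
  have hbd : Bornology.IsBounded (range fun w => P (Complex.exp w)) := by
    refine isBounded_iff_forall_norm_le.2 ⟨C, ?_⟩
    rintro _ ⟨w, rfl⟩
    exact hbound _ (Complex.exp_ne_zero w)
  have h12 := hd.apply_eq_apply_of_bounded hbd (Complex.log 1) (Complex.log 2)
  rw [Complex.exp_log one_ne_zero, Complex.exp_log two_ne_zero, hPE 1 (by simp),
    hPE 2 (by simp), evenResolvent, evenResolvent, if_pos (by simp), if_pos (by simp)] at h12
  exact resolvent_one_ne_two hR h12

end Extension

theorem mainTheorem3 :
    -- the closed realization is unique, has spectrum `[0, ∞[` and no eigenvalues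
    (∀ k : ℂ, (0 < k.re ∨ k = 0) →
      (∀ A : L2R →ₗ.[ℂ] L2R,
        IsClosedRealization (expPotential k) A ↔ A = maxOp (expPotential k)) ∧
      unboundedSpectrum (maxOp (expPotential k)) = {z : ℂ | 0 ≤ z.re ∧ z.im = 0} ∧
      unboundedPointSpectrum (maxOp (expPotential k)) = ∅) ∧
    -- it depends holomorphically on `k` in the right half-plane
    IsHolomorphicFamily {k : ℂ | 0 < k.re} (fun k => maxOp (expPotential k)) ∧
    -- the resolvent, its integral kernel, its holomorphy, and the maximality of its domain
    (∀ m : ℂ, 0 < m.re →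
      ∃ R : ℂ → L2R →L[ℂ] L2R,
        (∀ k : ℂ, 0 < k.re →
          IsResolventAt (maxOp (expPotential k)) (-m ^ 2) (R k) ∧
          HasIntegralKernel (R k) (expKernel m k)) ∧
        DifferentiableOn ℂ R {k : ℂ | 0 < k.re} ∧
        ¬ ∃ (Ω : Set ℂ) (F : ℂ → L2R →L[ℂ] L2R),
          IsOpen Ω ∧ IsConnected Ω ∧ {k : ℂ | 0 < k.re} ⊂ Ω ∧
          DifferentiableOn ℂ F Ω ∧ ∀ k : ℂ, 0 < k.re → F k = R k) := by
  refine ⟨fun k hk => ⟨?_, unboundedSpectrum_maxOp hk, unboundedPointSpectrum_maxOp hk⟩,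
    isHolomorphicFamily_maxOp, fun m hm => ?_⟩
  · obtain ⟨c, hc, hV⟩ := exists_accretive hk
    exact isClosedRealization_iff hc hV (isClosed_maxOp_expPotential hk)
  · choose! R hR using fun (k : ℂ) (hk : 0 < k.re) => exists_resolvent_hasIntegralKernel hk hm
    exact ⟨R, hR, differentiableOn_resolvent fun k hk => (hR k hk).1,
      not_exists_extension fun k hk => (hR k hk).1⟩
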